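/- **Conventions.** All vector spaces are complex. For finite sets $H$, $X$ let $\mathcal E_0(H;X)$ be the algebra freely generated by $H\sqcup X$ subject to $hh'=h'h$ for $h,h'\in H$. It has a basis of monomials $w$; write $|w|$ for the number of letters of $w$, and for $r>0$ put $\|\sum_w a_w w\|_r=\sum_w|a_w|\,r^{|w|}$. Grade $\mathcal E_0(H;X)$ by the number of letters from $X$, let $\mathcal E^{(n)}$ be the completion of the degree-$n$ part with respect to the family of norms $(\|\cdot\|_r)_{r>0}$, and let $\mathcal E(H;X)=\bigoplus_{n\ge 0}\mathcal E^{(n)}$, with the locally convex direct sum topology and the multiplication extended by continuity. Quotients "by relations" are quotients of topological algebras by the closed two-sided ideal generated by the relations. A representation of a topological algebra $B$ is an algebra homomorphism $\rho:B\to\mathrm{End}(V)$, $V$ a vector space of any dimension, such that $b\mapsto\phi(\rho(b)v)$ is continuous for all $v\in V$ and all linear forms $\phi$ on $V$; morphisms are intertwiners. **The category $\mathcal C$.** Fix $\kappa\in\mathbb C$ and $\omega\in\mathbb C^\times$. Let $\mathcal A=\mathcal E(h;\emptyset)$ with $\Delta(h)=h\otimes 1+1\otimes h$ and $\varepsilon(h)=0$,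 where $\Delta$ takes values in the completed tensor product $\mathcal A\bar\otimes\mathcal A=\mathcal E(h\otimes1,1\otimes h;\emptyset)$. Let $\mathcal C=\mathrm{Rep}^{ss}(\mathcal A)$ be the category of representations of $\mathcal A$ which are direct sums of simple ones. It is a braided monoidal category, with the tensor product given by $\Delta$, the associator of vector spaces, and the braiding $c_{V,V'}=\tau_{V,V'}\circ(\rho\otimes\rho')(e^{\kappa\,h\otimes h})$, where $\tau$ is the flip. Let $\mathbb C_\alpha$ be $\mathbb C$ with $h$ acting by $\alpha$. Put $F_\omega=\mathbb C_\omega\oplus\mathbb C_{-\omega}$ and $$F=\iota^+(F_\omega)\oplus\iota^-(F_\omega)\in\mathcal Z(\mathcal C),$$ where $\mathcal Z(\mathcal C)$ is the monoidal centre (objects are pairs $(U,\varphi_{U,-})$ with half-braiding $\varphi_{U,X}:U\otimes X\to X\otimes U$), $\iota^+(U)=(U,c_{U,-})$ and $\iota^-(U)=(U,c_{-,U}^{-1})$. **The three monoidal categories** (associators are suppressed). 1. $\mathcal C_F$: objects are pairs $(X,m)$ with $X\in\mathcal C$ and $m:F\otimes X\to X$ any morphism of $\mathcal C$; morphisms $(X,m)\to(Y,n)$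 are morphisms $f:X\to Y$ of $\mathcal C$ with $f\circ m=n\circ(\mathrm{id}_F\otimes f)$. The tensor product is $(X,m)\otimes(Y,n)=(X\otimes Y,\;m\otimes\mathrm{id}_Y+(\mathrm{id}_X\otimes n)\circ(\varphi_{F,X}\otimes\mathrm{id}_Y))$ and the unit is $(\mathbf 1,0)$; the associator and the unit isomorphisms are those of $\mathcal C$. 2. $T(F)\text{-}\mathrm{Mod}_{\mathcal C}$: the tensor algebra $T(F)$ is a bialgebra in $\mathcal Z(\mathcal C)$ with a morphism $i:F\to T(F)$ in $\mathcal Z(\mathcal C)$ such that (a) for every algebra $B$ in $\mathcal C$ and every morphism $f:F\to B$ of $\mathcal C$ there is a unique algebra homomorphism $g:T(F)\to B$ in $\mathcal C$ with $g\circ i=f$, and (b) $\Delta\circ i=i\otimes\eta+\eta\otimes i$ and $\varepsilon\circ i=0$, where $\eta$ is the unit of $T(F)$. Objects of $T(F)\text{-}\mathrm{Mod}_{\mathcal C}$ are the left $T(F)$-modules in $\mathcal C$; the action on the tensor product of $(X,m)$ and $(Y,n)$ is $(m\otimes n)\circ(\mathrm{id}\otimes\varphi_{T(F),X}\otimes\mathrm{id})\circ(\Delta\otimes\mathrm{id}_{X\otimes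 Y})$, and the unit is $\mathbf 1$ with the action through $\varepsilon$. 3. $\mathrm{Rep}^{\mathcal A\text{-}ss}(\mathcal A_F)$: let $\mathcal A_F$ be the quotient of $\mathcal E(h;f^+,f^-,\bar f^+,\bar f^-)$ by the relations $$[h,f^\pm]=\pm\omega f^\pm,\qquad [h,\bar f^\pm]=\pm\omega\bar f^\pm,$$ with counit vanishing on the five generators and with coproduct $$\Delta(h)=h\otimes1+1\otimes h,\qquad \Delta(f^\pm)=f^\pm\otimes1+e^{\pm\kappa\omega h}\otimes f^\pm,\qquad \Delta(\bar f^\pm)=\bar f^\pm\otimes1+e^{\mp\kappa\omega h}\otimes\bar f^\pm,$$ taking values in the completed tensor product $\mathcal A_F\bar\otimes\mathcal A_F$, the quotient of $\mathcal E(h_1,h_2;\,f_1^\pm,\bar f_1^\pm,f_2^\pm,\bar f_2^\pm)$, where $y_1=y\otimes1$ and $y_2=1\otimes y$, by the above relations for each of the two copies and the relations that the two copies commute. Objects of $\mathrm{Rep}^{\mathcal A\text{-}ss}(\mathcal A_F)$ are the representations of $\mathcal A_F$ whose restriction to $\mathcal A$ along $h\mapsto h$ is semisimple; the tensor product is given by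 $\Delta$, the unit by $\varepsilon$, and the associator and the unit isomorphisms are those of vector spaces. **Theorem.** The tensor algebra $T(F)$ exists, and there are monoidal isomorphisms $$T(F)\text{-}\mathrm{Mod}_{\mathcal C}\;\cong\;\mathcal C_F\;\cong\;\mathrm{Rep}^{\mathcal A\text{-}ss}(\mathcal A_F),$$ i.e. isomorphisms of categories which are strong monoidal functors. -/

import Mathlib

open scoped ENNReal NNReal

noncomputable section

namespace FreeBoson

/-! ### Weighted sequence spaces -/

/-- An index set of monomials; a monomial has a length and an `X`-degree. -/
class Weighted (ι : Type) where
  len : ι → ℕ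
  deg : ι → ℕ

open Weighted

section Koethe
variable {ι ι' : Type} [Weighted ι] [Weighted ι']

/-- The weighted `ℓ¹`-norm of a family of coefficients. -/
def wsum {ι : Type} (w : ι → ℝ≥0) (f : ι → ℂ) : ℝ≥0∞ := ∑' i, ‖f i‖ₑ * (w i : ℝ≥0∞)

/-- `‖f‖_r = ∑ |f_i| r ^ len i`. -/
def nrm (r : ℝ≥0) (f : ι → ℂ) : ℝ≥0∞ := wsum (fun i => r ^ len i) f

/-- The weight `c_n * r_n ^ len`, where `n` is the `X`-degree. -/
def wt (c r : ℕ → ℝ≥0) (i : ι) : ℝ≥0 := c (deg i) * r (deg i) ^ len i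

lemma wsum_add_le {ι : Type} (w : ι → ℝ≥0) (f g : ι → ℂ) :
    wsum w (f + g) ≤ wsum w f + wsum w g := by
  unfold wsum
  rw [← ENNReal.tsum_add]
  refine ENNReal.tsum_le_tsum fun i => ?_
  rw [← add_mul]
  gcongr
  exact enorm_add_le _ _

lemma wsum_smul {ι : Type} (w : ι → ℝ≥0) (a : ℂ) (f : ι → ℂ) :
    wsum w (a • f) = ‖a‖ₑ * wsum w f := by
  unfold wsum
  rw [← ENNReal.tsum_mul_left]
  simp [mul_assoc]

variable (ι) in
/-- The families of coefficients which are supported in finitely many `X`-degrees and for which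
all the norms `‖·‖_r` are finite. -/
def koethe : Submodule ℂ (ι → ℂ) where
  carrier := {f | (∃ N, ∀ i, f i ≠ 0 → deg i ≤ N) ∧ ∀ r, nrm r f ≠ ∞}
  add_mem' := by
    rintro f g ⟨⟨N, hN⟩, hf⟩ ⟨⟨M, hM⟩, hg⟩
    refine ⟨⟨max N M, fun i hi => ?_⟩, fun r => ?_⟩
    · by_cases h : f i = 0
      · exact (hM i (by simpa [h] using hi)).trans (le_max_right _ _)
      · exact (hN i h).trans (le_max_left _ _)
    · exact ne_top_of_le_ne_top (ENNReal.add_ne_top.2 ⟨hf r, hg r⟩) (wsum_add_le _ _ _)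
  zero_mem' := ⟨⟨0, by simp⟩, by simp [nrm, wsum]⟩
  smul_mem' := by
    rintro a f ⟨⟨N, hN⟩, hf⟩
    refine ⟨⟨N, fun i hi => hN i (by simpa using (mul_ne_zero_iff.1 hi).2)⟩, fun r => ?_⟩
    rw [nrm, wsum_smul]
    exact ENNReal.mul_ne_top (by simp) (hf r)

variable (ι) in
/-- The space underlying `⨁ₙ E⁽ⁿ⁾`: an element of `E⁽ⁿ⁾`, the completion of the span of the monomials
of `X`-degree `n` with respect to all the norms `‖·‖_r`, is a family of coefficients. -/
def K : Type := koethe ι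

namespace K

instance : AddCommGroup (K ι) := inferInstanceAs (AddCommGroup (koethe ι))
instance : Module ℂ (K ι) := inferInstanceAs (Module ℂ (koethe ι))
instance : FunLike (K ι) ι ℂ where
  coe f := f.1
  coe_injective _ _ h := Subtype.ext h

@[ext] lemma ext {f g : K ι} (h : ∀ i, f i = g i) : f = g := DFunLike.ext _ _ h
lemma deg_le (f : K ι) : ∃ N, ∀ i, f i ≠ 0 → deg i ≤ N := f.2.1
lemma nrm_ne_top (f : K ι) (r : ℝ≥0) : nrm r f ≠ ∞ := f.2.2 r
@[simp] lemma add_apply (f g : K ι) (i : ι) : (f + g) i = f i + g i := rfl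
@[simp] lemma smul_apply (a : ℂ) (f : K ι) (i : ι) : (a • f) i = a * f i := rfl
@[simp] lemma zero_apply (i : ι) : (0 : K ι) i = 0 := rfl
@[simp] lemma sub_apply (f g : K ι) (i : ι) : (f - g) i = f i - g i := rfl
lemma sum_apply {J : Type} (s : Finset J) (f : J → K ι) (i : ι) :
    (∑ j ∈ s, f j) i = ∑ j ∈ s, f j i := by
  classical
  induction s using Finset.induction_on with
  | empty => simp
  | insert a s ha ih => rw [Finset.sum_insert ha, Finset.sum_insert ha, add_apply, ih]

end K

/-- Maximum of `c 0, …, c N`. -/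
def bd (c : ℕ → ℝ≥0) (N : ℕ) : ℝ≥0 := (Finset.range (N + 1)).sup c

lemma le_bd (c : ℕ → ℝ≥0) {n N : ℕ} (h : n ≤ N) : c n ≤ bd c N :=
  Finset.le_sup (f := c) (Finset.mem_range.2 (Nat.lt_succ_of_le h))

lemma wsum_le_bd (c r : ℕ → ℝ≥0) {f : ι → ℂ} {N : ℕ} (hN : ∀ i, f i ≠ 0 → deg i ≤ N) :
    wsum (wt c r) f ≤ bd c N * nrm (bd r N) f := by
  unfold nrm wsum
  rw [← ENNReal.tsum_mul_left]
  refine ENNReal.tsum_le_tsum fun i => ?_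
  by_cases h : f i = 0
  · simp [h]
  · rw [mul_left_comm]
    gcongr
    rw [← ENNReal.coe_mul]
    refine ENNReal.coe_le_coe.2 ?_
    unfold wt
    gcongr
    · exact le_bd c (hN i h)
    · exact pow_le_pow_left₀ zero_le (le_bd r (hN i h)) _

lemma wsum_ne_top (c r : ℕ → ℝ≥0) (f : K ι) : wsum (wt c r) f ≠ ∞ := by
  obtain ⟨N, hN⟩ := f.deg_le
  exact ne_top_of_le_ne_top (ENNReal.mul_ne_top (by simp) (f.nrm_ne_top _)) (wsum_le_bd c r hN)

/-- The continuous seminorms `∑ₙ c_n ‖f⁽ⁿ⁾‖_{r_n}` on `⨁ₙ E⁽ⁿ⁾`. -/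
def fam : SeminormFamily ℂ (K ι) ((ℕ → ℝ≥0) × (ℕ → ℝ≥0)) := fun p =>
  Seminorm.of (fun f => (wsum (wt p.1 p.2) f).toReal)
    (fun f g => by
      rw [← ENNReal.toReal_add (wsum_ne_top _ _ _) (wsum_ne_top _ _ _)]
      exact ENNReal.toReal_mono (ENNReal.add_ne_top.2 ⟨wsum_ne_top _ _ _, wsum_ne_top _ _ _⟩)
        (wsum_add_le _ _ _))
    (fun a f => by
      change (wsum _ (a • ⇑f)).toReal = _
      rw [wsum_smul, ENNReal.toReal_mul, toReal_enorm])

lemma fam_apply (p : (ℕ → ℝ≥0) × (ℕ → ℝ≥0)) (f : K ι) :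
    fam p f = (wsum (wt p.1 p.2) f).toReal := rfl

/-- The topology of the locally convex direct sum `⨁ₙ E⁽ⁿ⁾`. -/
instance : TopologicalSpace (K ι) := (fam (ι := ι)).moduleFilterBasis.topology

lemma fam_with : WithSeminorms (fam (ι := ι)) := ⟨rfl⟩

instance : IsTopologicalAddGroup (K ι) := fam_with.topologicalAddGroup

open Classical in
/-- The monomial `i` as an element. -/
def K.of (i : ι) : K ι := ⟨Pi.single i 1, ⟨deg i, fun j hj => by
    by_cases h : j = i
    · rw [h]
    · simp [h] at hj⟩, fun r => by
    rw [nrm, wsum, tsum_eq_single i (fun j hj => by simp [hj])]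
    exact ENNReal.mul_ne_top (by simp) (by simp)⟩

open Classical in
lemma K.of_apply (i j : ι) : K.of i j = if j = i then 1 else 0 := by
  exact Pi.single_apply i (1 : ℂ) j

lemma wsum_of (w : ι → ℝ≥0) (i : ι) : wsum w (K.of i) = w i := by
  rw [wsum, tsum_eq_single i (fun j hj => by simp [K.of_apply, hj])]
  simp [K.of_apply]

lemma K.hasSum_of (f : K ι) : HasSum (fun i => f i • K.of i) f := by
  classical
  refine (fam_with.tendsto_nhds _ _).2 fun p ε hε => ?_
  have h1 := ENNReal.tendsto_tsum_compl_atTop_zero (wsum_ne_top p.1 p.2 f)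
  have h2 := (h1.eventually (gt_mem_nhds (ENNReal.ofReal_pos.2 hε)))
  filter_upwards [h2] with s hs
  rw [fam_apply]
  have : wsum (wt p.1 p.2) ((∑ i ∈ s, f i • K.of i - f : K ι)) =
      ∑' i : {i // i ∉ s}, ‖f i‖ₑ * (wt p.1 p.2 (i : ι) : ℝ≥0∞) := by
    have e := tsum_subtype {i : ι | i ∉ s} (fun i => ‖f i‖ₑ * (wt p.1 p.2 i : ℝ≥0∞))
    refine Eq.trans (tsum_congr fun i => ?_) e.symm
    have : (∑ j ∈ s, f j • K.of j - f : K ι) i = if i ∈ s then 0 else - f i := by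
      rw [K.sub_apply, K.sum_apply]
      simp only [K.smul_apply, K.of_apply]
      simp
      split_ifs <;> simp
    rw [this]
    by_cases h : i ∈ s <;> simp [h]
  rw [this]
  exact (ENNReal.toReal_lt_of_lt_ofReal hs)

lemma K.hasSum_functional {Λ : K ι →ₗ[ℂ] ℂ} (hΛ : Continuous Λ) (f : K ι) :
    HasSum (fun i => f i * Λ (K.of i)) (Λ f) := by
  simpa [Function.comp_def] using (K.hasSum_of f).map Λ hΛ

lemma K.functional_ext {Λ Λ' : K ι →ₗ[ℂ] ℂ} (h : Continuous Λ) (h' : Continuous Λ')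
    (hof : ∀ i, Λ (K.of i) = Λ' (K.of i)) (f : K ι) : Λ f = Λ' f := by
  have := K.hasSum_functional h f
  simp only [hof] at this
  exact this.unique (K.hasSum_functional h' f)

lemma K.coef_le (c r : ℕ → ℝ≥0) {γ : ι → ℂ} (h : ∀ i, ‖γ i‖ₑ ≤ (wt c r i : ℝ≥0∞)) (f : K ι) :
    ∑' i, ‖f i * γ i‖ₑ ≤ wsum (wt c r) f :=
  ENNReal.tsum_le_tsum fun i => by rw [enorm_mul]; gcongr; exact h i

/-- A family of numbers of at most exponential growth on the monomials of any given degree. -/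
def Growth (γ : ι → ℂ) : Prop := ∃ c r : ℕ → ℝ≥0, ∀ i, ‖γ i‖ₑ ≤ (wt c r i : ℝ≥0∞)

lemma Growth.summable {γ : ι → ℂ} (h : Growth γ) (f : K ι) : Summable fun i => f i * γ i := by
  obtain ⟨c, r, h⟩ := h
  exact Summable.of_norm (tsum_enorm_ne_top_iff_summable_norm.1
    (ne_top_of_le_ne_top (wsum_ne_top c r f) (K.coef_le c r h f)))

lemma Growth.continuous {γ : ι → ℂ} (h : Growth γ) {Λ : K ι →ₗ[ℂ] ℂ}
    (hΛ : ∀ f, Λ f = ∑' i, f i * γ i) : Continuous Λ := by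
  obtain ⟨c, r, h⟩ := h
  refine fam_with.continuous_normedSpace_rng _ Λ ⟨{(c, r)}, 1, fun f => ?_⟩
  simp only [Finset.sup_singleton, one_smul]
  change ‖Λ f‖ ≤ _
  rw [fam_apply, hΛ, ← toReal_enorm]
  exact ENNReal.toReal_mono (wsum_ne_top _ _ _)
    (enorm_tsum_le_tsum_enorm.trans (K.coef_le c r h f))

lemma K.growth_of (u : ι) : Growth (fun i => K.of i u) := by
  refine ⟨1, 1, fun i => ?_⟩
  by_cases h : u = i <;> simp [K.of_apply, wt, h]

lemma K.tsum_of (f : K ι) (u : ι) : ∑' i, f i * K.of i u = f u := by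
  rw [tsum_eq_single u (fun j hj => by simp [K.of_apply, hj.symm])]
  simp [K.of_apply]

lemma K.continuous_coef (u : ι) {Λ : K ι →ₗ[ℂ] ℂ} (h : ∀ f, Λ f = f u) : Continuous Λ :=
  (K.growth_of u).continuous fun f => (h f).trans (f.tsum_of u).symm

/-- Condition on a family `y` under which `f ↦ ∑ f_i y_i` defines a continuous linear map. -/
def Ctrl (y : ι → K ι') : Prop :=
  (∃ d, ∀ i u, y i u ≠ 0 → deg u ≤ deg i + d) ∧
    ∀ r : ℝ≥0, ∃ c R : ℕ → ℝ≥0, ∀ i, nrm r (y i) ≤ (wt c R i : ℝ≥0∞)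

lemma wsum_tsum_le (w : ι' → ℝ≥0) (f : K ι) (y : ι → K ι') :
    wsum w (fun u => ∑' i, f i * y i u) ≤ ∑' i, ‖f i‖ₑ * wsum w (y i) := by
  calc wsum w (fun u => ∑' i, f i * y i u)
      ≤ ∑' u, ∑' i, ‖f i‖ₑ * (‖y i u‖ₑ * w u) := by
        refine ENNReal.tsum_le_tsum fun u => ?_
        simp only [← mul_assoc]
        rw [ENNReal.tsum_mul_right]
        gcongr
        simpa only [enorm_mul] using enorm_tsum_le_tsum_enorm (f := fun i => f i * y i u)
    _ = _ := by
        rw [ENNReal.tsum_comm]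
        simp only [ENNReal.tsum_mul_left]
        rfl

lemma nrm_le_of_wsum {y : ι → K ι'} (w : ι' → ℝ≥0) (c R : ℕ → ℝ≥0) (f : K ι)
    (h : ∀ i, wsum w (y i) ≤ (wt c R i : ℝ≥0∞)) :
    wsum w (fun u => ∑' i, f i * y i u) ≤ wsum (wt c R) f :=
  (wsum_tsum_le w f y).trans (ENNReal.tsum_le_tsum fun i => by gcongr; exact h i)

lemma Ctrl.growth {y : ι → K ι'} (h : Ctrl y) (u : ι') : Growth (fun i => y i u) := by
  obtain ⟨c, R, h⟩ := h.2 1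
  refine ⟨c, R, fun i => le_trans ?_ (h i)⟩
  refine le_trans ?_ (ENNReal.le_tsum u)
  simp

/-- The continuous linear map `f ↦ ∑ f_i y_i`. -/
def Ctrl.lin {y : ι → K ι'} (h : Ctrl y) : K ι →ₗ[ℂ] K ι' where
  toFun f := ⟨fun u => ∑' i, f i * y i u, by
    obtain ⟨N, hN⟩ := f.deg_le
    obtain ⟨d, hd⟩ := h.1
    refine ⟨⟨N + d, fun u hu => ?_⟩, fun r => ?_⟩
    · by_contra hlt
      refine hu ((tsum_congr fun i => ?_).trans tsum_zero)
      by_contra hne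
      obtain ⟨h1, h2⟩ := mul_ne_zero_iff.1 hne
      exact hlt ((hd i u h2).trans (by have := hN i h1; omega))
    · obtain ⟨c, R, hr⟩ := h.2 r
      exact ne_top_of_le_ne_top (wsum_ne_top c R f) (nrm_le_of_wsum _ c R f hr)⟩
  map_add' f g := K.ext fun u => by
    change ∑' i, (f i + g i) * y i u = (∑' i, f i * y i u) + ∑' i, g i * y i u
    rw [← ((h.growth u).summable f).tsum_add ((h.growth u).summable g)]
    simp only [add_mul]
  map_smul' a f := K.ext fun u => by
    change ∑' i, (a * f i) * y i u = a * ∑' i, f i * y i u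
    rw [← tsum_mul_left]
    simp only [mul_assoc]

lemma Ctrl.lin_apply {y : ι → K ι'} (h : Ctrl y) (f : K ι) (u : ι') :
    h.lin f u = ∑' i, f i * y i u := rfl

lemma Ctrl.lin_of {y : ι → K ι'} (h : Ctrl y) (i : ι) : h.lin (K.of i) = y i := by
  ext u
  rw [h.lin_apply, tsum_eq_single i (fun j hj => by simp [K.of_apply, hj])]
  simp [K.of_apply]

lemma Ctrl.continuous {y : ι → K ι'} (h : Ctrl y) : Continuous h.lin := by
  obtain ⟨d, hd⟩ := h.1
  choose c R hcR using h.2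
  refine fam_with.continuous_of_isBounded fam_with _ fun p => ?_
  refine ⟨{(fun n => bd p.1 (n + d) * c (bd p.2 (n + d)) n, fun n => R (bd p.2 (n + d)) n)}, 1,
    fun f => ?_⟩
  simp only [Finset.sup_singleton, one_smul]
  refine ENNReal.toReal_mono (wsum_ne_top _ _ _) (nrm_le_of_wsum _ _ _ f fun i => ?_)
  refine (wsum_le_bd _ _ (hd i)).trans ?_
  refine (mul_le_mul_right (hcR (bd p.2 (deg i + d)) i) _).trans (le_of_eq ?_)
  simp only [wt, ENNReal.coe_mul, mul_assoc]

end Koethe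

/-! ### The convolution algebra -/

section Coef
variable {ι ι' : Type} [Weighted ι] [Weighted ι']

/-- The coefficient functional. -/
def K.coef (u : ι) : K ι →ₗ[ℂ] ℂ where
  toFun f := f u
  map_add' _ _ := rfl
  map_smul' _ _ := rfl

lemma K.coef_cont (u : ι) : Continuous (K.coef u) := K.continuous_coef u fun _ => rfl

lemma K.lin_ext {L L' : K ι →ₗ[ℂ] K ι'} (h : Continuous L) (h' : Continuous L')
    (hof : ∀ i, L (K.of i) = L' (K.of i)) (f : K ι) : L f = L' f :=
  K.ext fun u => K.functional_ext (Λ := K.coef u ∘ₗ L) (Λ' := K.coef u ∘ₗ L')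
    ((K.coef_cont u).comp h) ((K.coef_cont u).comp h') (fun i => by simp [hof]) f

end Coef

/-- A monoid of monomials. -/
class WeightedMonoid (M : Type) [Monoid M] extends Weighted M where
  len_mul (a b : M) : len (a * b) = len a + len b
  deg_mul (a b : M) : deg (a * b) = deg a + deg b
  len_one : len (1 : M) = 0
  deg_one : deg (1 : M) = 0

open WeightedMonoid

section Conv
variable {M : Type} [Monoid M] [WeightedMonoid M]

lemma nrm_of {ι : Type} [Weighted ι] (r : ℝ≥0) (i : ι) : nrm r (K.of i) = (r ^ len i : ℝ≥0) :=
  wsum_of _ i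

lemma of_ne_zero {ι : Type} [Weighted ι] {i u : ι} (h : K.of i u ≠ 0) : u = i := by
  by_contra hne
  simp [K.of_apply, hne] at h

lemma ctrl_left (w : M) : Ctrl fun v => K.of (w * v) := by
  refine ⟨⟨deg w, fun v u hu => ?_⟩, fun r => ⟨fun _ => r ^ len w, fun _ => r, fun v => ?_⟩⟩
  · rw [of_ne_zero hu, deg_mul, add_comm]
  · rw [nrm_of, wt, len_mul, pow_add]

lemma ctrl_right (w : M) : Ctrl fun v => K.of (v * w) := by
  refine ⟨⟨deg w, fun v u hu => ?_⟩, fun r => ⟨fun _ => r ^ len w, fun _ => r, fun v => ?_⟩⟩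
  · rw [of_ne_zero hu, deg_mul]
  · rw [nrm_of, wt, len_mul, pow_add, mul_comm]

lemma ctrl_shift (g : K M) {y : M → M → K M} (hy : ∀ w, Ctrl (y w))
    (hd : ∀ w v u, y w v u ≠ 0 → deg u ≤ deg w + deg v)
    (hn : ∀ (r : ℝ≥0) w v, nrm r (y w v) ≤ (r ^ len w * r ^ len v : ℝ≥0)) :
    Ctrl fun w => (hy w).lin g := by
  obtain ⟨N, hN⟩ := g.deg_le
  refine ⟨⟨N, fun w u hu => ?_⟩, fun r =>
    ⟨fun _ => (nrm r g).toNNReal, fun _ => r, fun w => ?_⟩⟩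
  · by_contra hlt
    refine hu ((tsum_congr fun v => ?_).trans tsum_zero)
    by_contra hne
    obtain ⟨h1, h2⟩ := mul_ne_zero_iff.1 hne
    exact hlt ((hd w v u h2).trans (by have := hN v h1; omega))
  · refine (wsum_tsum_le _ g (y w)).trans ?_
    rw [wt, ENNReal.coe_mul, ENNReal.coe_toNNReal (g.nrm_ne_top r), nrm, wsum,
      ← ENNReal.tsum_mul_right]
    refine ENNReal.tsum_le_tsum fun v => ?_
    rw [mul_assoc]
    gcongr
    exact (hn r w v).trans (by rw [mul_comm, ENNReal.coe_mul])

lemma ctrl_mulL (g : K M) : Ctrl fun w => (ctrl_left w).lin g :=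
  ctrl_shift g ctrl_left (fun w v u h => by rw [of_ne_zero h, deg_mul])
    (fun r w v => by rw [nrm_of, len_mul, pow_add])

lemma ctrl_mulR (f : K M) : Ctrl fun v => (ctrl_right v).lin f :=
  ctrl_shift f ctrl_right (fun w v u h => by rw [of_ne_zero h, deg_mul, add_comm])
    (fun r w v => by rw [nrm_of, len_mul, pow_add, mul_comm])

lemma K.summable_norm {ι : Type} [Weighted ι] (f : K ι) : Summable fun i => ‖f i‖ := by
  refine tsum_enorm_ne_top_iff_summable_norm.1 (ne_top_of_le_ne_top (f.nrm_ne_top 1) ?_)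
  simp [nrm, wsum]

open Classical in
lemma K.summable_mul (f g : K M) (u : M) :
    Summable fun p : M × M => if p.1 * p.2 = u then f p.1 * g p.2 else 0 := by
  refine Summable.of_norm_bounded
    (summable_mul_of_summable_norm f.summable_norm g.summable_norm).norm fun p => ?_
  split_ifs
  · exact le_rfl
  · simpa using mul_nonneg (norm_nonneg _) (norm_nonneg _)

open Classical in
lemma K.mulL_apply (f g : K M) (u : M) :
    (∑' p : M × M, if p.1 * p.2 = u then f p.1 * g p.2 else 0) = (ctrl_mulL g).lin f u := by
  rw [(f.summable_mul g u).tsum_prod, (ctrl_mulL g).lin_apply]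
  refine tsum_congr fun w => ?_
  rw [(ctrl_left w).lin_apply, ← tsum_mul_left]
  refine tsum_congr fun v => ?_
  by_cases h : u = w * v <;> simp [K.of_apply, h, eq_comm (a := w * v)]

open Classical in
lemma K.mulR_apply (f g : K M) (u : M) :
    (∑' p : M × M, if p.1 * p.2 = u then f p.1 * g p.2 else 0) = (ctrl_mulR f).lin g u := by
  rw [(f.summable_mul g u).tsum_prod, (ctrl_mulR f).lin_apply]
  refine (Summable.tsum_comm (f := fun b a => if a * b = u then f a * g b else 0) ?_).trans ?_
  · exact (f.summable_mul g u).prod_symm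
  refine tsum_congr fun v => ?_
  rw [(ctrl_right v).lin_apply, ← tsum_mul_left]
  refine tsum_congr fun w => ?_
  by_cases h : u = w * v <;> simp [K.of_apply, h, eq_comm (a := w * v), mul_comm]

open Classical in
/-- The product, `(f g)_u = ∑_{a b = u} f_a g_b`. -/
instance : Mul (K M) where
  mul f g := ⟨fun u => ∑' p : M × M, if p.1 * p.2 = u then f p.1 * g p.2 else 0, by
    rw [show (fun u => ∑' p : M × M, if p.1 * p.2 = u then f p.1 * g p.2 else 0) = _ from
      funext (K.mulL_apply f g)]
    exact ((ctrl_mulL g).lin f).2⟩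

instance : One (K M) where
  one := K.of 1

namespace K

lemma mul_eq_left (f g : K M) : f * g = (ctrl_mulL g).lin f := K.ext (K.mulL_apply f g)
lemma mul_eq_right (f g : K M) : f * g = (ctrl_mulR f).lin g := K.ext (K.mulR_apply f g)
lemma one_def : (1 : K M) = K.of 1 := rfl

lemma of_mul_of (a b : M) : (K.of a * K.of b : K M) = K.of (a * b) := by
  rw [mul_eq_left, Ctrl.lin_of, Ctrl.lin_of]

/-- Multiplication on the right by `g`. -/
def mulR (g : K M) : K M →ₗ[ℂ] K M where
  toFun f := f * g
  map_add' f f' := by simp only [mul_eq_left, map_add]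
  map_smul' a f := by simp only [mul_eq_left, map_smul, RingHom.id_apply]

/-- Multiplication on the left by `f`. -/
def mulL (f : K M) : K M →ₗ[ℂ] K M where
  toFun g := f * g
  map_add' g g' := by simp only [mul_eq_right, map_add]
  map_smul' a g := by simp only [mul_eq_right, map_smul, RingHom.id_apply]

lemma mulR_cont (g : K M) : Continuous (mulR g) := by
  have : mulR g = (ctrl_mulL g).lin := LinearMap.ext fun f => mul_eq_left f g
  rw [this]; exact Ctrl.continuous _

lemma mulL_cont (f : K M) : Continuous (mulL f) := by
  have : mulL f = (ctrl_mulR f).lin := LinearMap.ext fun g => mul_eq_right f g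
  rw [this]; exact Ctrl.continuous _

lemma assoc (f g k : K M) : f * g * k = f * (g * k) := by
  refine lin_ext (L := mulR k ∘ₗ mulR g) (L' := mulR (g * k))
    ((mulR_cont k).comp (mulR_cont g)) (mulR_cont _) (fun a => ?_) f
  refine lin_ext (L := mulR k ∘ₗ mulL (of a)) (L' := mulL (of a) ∘ₗ mulR k)
    ((mulR_cont k).comp (mulL_cont _)) ((mulL_cont _).comp (mulR_cont k)) (fun b => ?_) g
  refine lin_ext (L := mulL (of a * of b)) (L' := mulL (of a) ∘ₗ mulL (of b))
    (mulL_cont _) ((mulL_cont _).comp (mulL_cont _)) (fun c => ?_) k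
  change of a * of b * of c = of a * (of b * of c)
  simp only [of_mul_of, mul_assoc]

instance : Ring (K M) where
  left_distrib f g k := map_add (mulL f) g k
  right_distrib f g k := map_add (mulR k) f g
  zero_mul f := map_zero (mulR f)
  mul_zero f := map_zero (mulL f)
  mul_assoc := assoc
  one_mul f := lin_ext (L := mulL 1) (L' := LinearMap.id) (mulL_cont _) continuous_id
    (fun a => (of_mul_of 1 a).trans (by rw [one_mul]; rfl)) f
  mul_one f := lin_ext (L := mulR 1) (L' := LinearMap.id) (mulR_cont _) continuous_id
    (fun a => (of_mul_of a 1).trans (by rw [mul_one]; rfl)) f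
  zsmul := zsmulRec
  neg_add_cancel := neg_add_cancel

instance : Algebra ℂ (K M) :=
  Algebra.ofModule (fun a f g => map_smul (mulR g) a f) (fun a f g => map_smul (mulL f) a g)

/-- Monomials as a monoid homomorphism. -/
def ofHom : M →* K M where
  toFun := of
  map_one' := rfl
  map_mul' a b := (of_mul_of a b).symm

end K

/-! ### Continuous homomorphisms -/

/-- A continuous linear map, multiplicative on monomials, is multiplicative. -/
lemma K.mul_of_word {N : Type} [Monoid N] [WeightedMonoid N] {L : K M →ₗ[ℂ] K N}
    (h : Continuous L) (y : M →* K N) (hy : ∀ w, L (of w) = y w) (f g : K M) :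
    L (f * g) = L f * L g := by
  refine lin_ext (L := L ∘ₗ mulR g) (L' := mulR (L g) ∘ₗ L)
    (h.comp (mulR_cont _)) ((mulR_cont _).comp h) (fun a => ?_) f
  refine lin_ext (L := L ∘ₗ mulL (of a)) (L' := mulL (L (of a)) ∘ₗ L)
    (h.comp (mulL_cont _)) ((mulL_cont _).comp h) (fun b => ?_) g
  change L (of a * of b) = L (of a) * L (of b)
  rw [of_mul_of, hy, hy, hy, map_mul]

/-- The continuous extension of a multiplicative family. -/
def homOfWord {N : Type} [Monoid N] [WeightedMonoid N] (y : M →* K N) (hy : Ctrl y) :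
    K M →ₐ[ℂ] K N :=
  AlgHom.ofLinearMap hy.lin ((hy.lin_of 1).trans y.map_one)
    (K.mul_of_word hy.continuous y hy.lin_of)

end Conv

/-! ### The algebras `E(𝔥; X)` -/

section Words
variable {H X : Type}

/-- The generators in `H` commute among themselves. -/
inductive CommRel (H X : Type) : FreeMonoid (H ⊕ X) → FreeMonoid (H ⊕ X) → Prop
  | comm (h h' : H) : CommRel H X
      (FreeMonoid.of (Sum.inl h) * FreeMonoid.of (Sum.inl h'))
      (FreeMonoid.of (Sum.inl h') * FreeMonoid.of (Sum.inl h))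

/-- Monomials in the commuting variables `H` and the non-commuting variables `X`. -/
abbrev Word (H X : Type) : Type := PresentedMonoid (CommRel H X)

namespace Word

/-- A generator as a monomial. -/
abbrev gen (g : H ⊕ X) : Word H X := PresentedMonoid.of (CommRel H X) g

/-- Evaluation of monomials. -/
def lift {N : Type} [Monoid N] (y : H ⊕ X → N)
    (hy : ∀ h h', y (Sum.inl h) * y (Sum.inl h') = y (Sum.inl h') * y (Sum.inl h)) :
    Word H X →* N :=
  PresentedMonoid.lift y (by rintro _ _ ⟨h, h'⟩; simpa using hy h h')

@[simp] lemma lift_gen {N : Type} [Monoid N] (y : H ⊕ X → N)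
    (hy : ∀ h h', y (Sum.inl h) * y (Sum.inl h') = y (Sum.inl h') * y (Sum.inl h)) (g : H ⊕ X) :
    lift y hy (gen g) = y g := PresentedMonoid.lift_of _ _

lemma induction {p : Word H X → Prop} (one : p 1) (mul : ∀ g w, p w → p (gen g * w))
    (w : Word H X) : p w := by
  obtain ⟨a, rfl⟩ := PresentedMonoid.surjective_mk w
  induction a using FreeMonoid.inductionOn' with
  | one => exact one
  | of_mul g a ih => rw [map_mul]; exact mul g _ ih

/-- The number of letters. -/
def lenHom : Word H X →* Multiplicative ℕ :=
  lift (fun _ => Multiplicative.ofAdd 1) (fun _ _ => mul_comm _ _)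

/-- The number of letters from `X`. -/
def degHom : Word H X →* Multiplicative ℕ :=
  lift (Sum.elim (fun _ => Multiplicative.ofAdd 0) (fun _ => Multiplicative.ofAdd 1))
    (fun _ _ => mul_comm _ _)

instance : WeightedMonoid (Word H X) where
  len w := (lenHom w).toAdd
  deg w := (degHom w).toAdd
  len_mul a b := by rw [map_mul, toAdd_mul]
  deg_mul a b := by rw [map_mul, toAdd_mul]
  len_one := by rw [map_one, toAdd_one]
  deg_one := by rw [map_one, toAdd_one]

lemma len_gen (g : H ⊕ X) : len (gen g) = 1 := by
  change (lenHom (gen g)).toAdd = 1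
  rw [lenHom, lift_gen]; rfl
lemma deg_inl (h : H) : deg (gen (Sum.inl h) : Word H X) = 0 := by
  change (degHom (gen _)).toAdd = 0
  rw [degHom, lift_gen]; rfl
lemma deg_inr (x : X) : deg (gen (Sum.inr x) : Word H X) = 1 := by
  change (degHom (gen _)).toAdd = 1
  rw [degHom, lift_gen]; rfl

end Word

/-- The topological algebra `E(𝔥; X)` where `𝔥` and `X` have bases `H` and `X`. For the norm on
`𝔥 ⊕ X` which is `ℓ¹` with respect to these bases, the induced cross norm `‖·‖_r` on the algebra of
polynomials is the `ℓ¹`-norm of the coefficients of the monomials, weighted by `r ^ length`. -/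
abbrev EAlg (H X : Type) : Type := K (Word H X)

/-- The generators in `𝔥`. -/
def EAlg.h (i : H) : EAlg H X := K.of (Word.gen (Sum.inl i))
/-- The generators in `X`. -/
def EAlg.x (j : X) : EAlg H X := K.of (Word.gen (Sum.inr j))

end Words

section Eval
variable {N : Type} [Monoid N] [WeightedMonoid N]

lemma nrm_mul_le (r : ℝ≥0) (f g : K N) : nrm r (f * g) ≤ nrm r f * nrm r g := by
  rw [K.mul_eq_left]
  refine (wsum_tsum_le _ f _).trans ?_
  rw [nrm, wsum, ← ENNReal.tsum_mul_right]
  refine ENNReal.tsum_le_tsum fun w => ?_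
  rw [mul_assoc]
  gcongr
  refine (wsum_tsum_le _ g _).trans ?_
  rw [nrm, wsum, ← ENNReal.tsum_mul_left]
  refine ENNReal.tsum_le_tsum fun v => ?_
  rw [wsum_of, len_mul, pow_add, ENNReal.coe_mul, mul_left_comm]

lemma deg_mul_le {f g : K N} {m n : ℕ} (hf : ∀ u, f u ≠ 0 → deg u ≤ m)
    (hg : ∀ u, g u ≠ 0 → deg u ≤ n) (u : N) (hu : (f * g) u ≠ 0) : deg u ≤ m + n := by
  classical
  by_contra hlt
  refine hu ((tsum_congr fun p => ?_).trans tsum_zero)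
  split_ifs with h
  · by_contra hne
    obtain ⟨h1, h2⟩ := mul_ne_zero_iff.1 hne
    have := hf _ h1
    have := hg _ h2
    rw [← h, deg_mul] at hlt
    omega
  · rfl

variable {H X : Type} [Finite H] [Finite X]

lemma ctrl_lift (y : H ⊕ X → K N)
    (hy : ∀ h h', y (Sum.inl h) * y (Sum.inl h') = y (Sum.inl h') * y (Sum.inl h))
    (hdeg : ∀ g u, y g u ≠ 0 → deg u ≤ deg (Word.gen g)) : Ctrl (Word.lift y hy) := by
  refine ⟨⟨0, fun w => ?_⟩, fun r => ?_⟩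
  · induction w using Word.induction with
    | one =>
      intro u hu
      rw [map_one] at hu
      rw [of_ne_zero hu, deg_one]; exact Nat.zero_le _
    | mul g w ih =>
      intro u hu
      rw [map_mul, Word.lift_gen] at hu
      rw [deg_mul, add_zero]
      exact deg_mul_le (hdeg g) ih u hu
  · obtain ⟨R, hR⟩ := (Set.finite_range fun g => (nrm r (y g)).toNNReal).bddAbove
    refine ⟨fun _ => 1, fun _ => R, fun w => ?_⟩
    have hg : ∀ g, nrm r (y g) ≤ R := fun g => by
      rw [← ENNReal.coe_toNNReal ((y g).nrm_ne_top r)]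
      exact ENNReal.coe_le_coe.2 (hR ⟨g, rfl⟩)
    rw [wt, one_mul]
    induction w using Word.induction with
    | one => rw [map_one, len_one, K.one_def, nrm_of, len_one, pow_zero, pow_zero]
    | mul g w ih =>
      rw [map_mul, Word.lift_gen, len_mul, Word.len_gen, pow_add, pow_one, ENNReal.coe_mul]
      exact (nrm_mul_le _ _ _).trans (mul_le_mul' (hg g) ih)

/-- The continuous algebra homomorphism determined by the images of the generators. -/
def evalHom (y : H ⊕ X → K N)
    (hy : ∀ h h', y (Sum.inl h) * y (Sum.inl h') = y (Sum.inl h') * y (Sum.inl h))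
    (hdeg : ∀ g u, y g u ≠ 0 → deg u ≤ deg (Word.gen g)) : EAlg H X →ₐ[ℂ] K N :=
  homOfWord (Word.lift y hy) (ctrl_lift y hy hdeg)

lemma evalHom_cont (y : H ⊕ X → K N) (hy) (hdeg) : Continuous (evalHom y hy hdeg) :=
  (ctrl_lift y hy hdeg).continuous

lemma evalHom_gen (y : H ⊕ X → K N) (hy) (hdeg) (g : H ⊕ X) :
    evalHom y hy hdeg (K.of (Word.gen g)) = y g :=
  ((ctrl_lift y hy hdeg).lin_of _).trans (Word.lift_gen _ _ _)

end Eval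

section Exp
variable {M : Type} [Monoid M] [WeightedMonoid M]

instance : Weighted ℕ where
  len n := n
  deg _ := 0

/-- The exponential series `∑ (cⁿ/n!) zⁿ`. -/
def expSeries (c : ℂ) : K ℕ := ⟨fun n => c ^ n / n.factorial, ⟨0, fun _ _ => le_rfl⟩, fun r => by
  have h : Summable fun n : ℕ => ‖c ^ n / n.factorial * (r : ℂ) ^ n‖ := by
    refine (Real.summable_pow_div_factorial (‖c‖ * r)).congr fun n => ?_
    simp [mul_pow]; ring
  have := tsum_enorm_ne_top_iff_summable_norm.2 h
  simp only [enorm_mul, enorm_pow] at this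
  have e : ‖((r : ℝ) : ℂ)‖ₑ = r := by
    rw [enorm_eq_nnnorm]; congr 1; ext; simp
  rw [e] at this
  simp only [nrm, wsum, ENNReal.coe_pow]
  exact this⟩

lemma expSeries_apply (c : ℂ) (n : ℕ) : expSeries c n = c ^ n / n.factorial := rfl

lemma deg_pow {w : M} (hw : deg w = 0) (n : ℕ) : deg (w ^ n) = 0 := by
  induction n with
  | zero => rw [pow_zero, deg_one]
  | succ n ih => rw [pow_succ, deg_mul, ih, hw]

lemma ctrl_pow (w : M) (hw : deg w = 0) : Ctrl fun n : ℕ => K.of (w ^ n) := by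
  have hl : ∀ n, len (w ^ n) = len w * n := fun n => by
    induction n with
    | zero => rw [pow_zero, len_one, mul_zero]
    | succ n ih => rw [pow_succ, len_mul, ih]; ring
  refine ⟨⟨0, fun n u hu => ?_⟩, fun r => ⟨fun _ => 1, fun _ => r ^ len w, fun n => ?_⟩⟩
  · rw [of_ne_zero hu, deg_pow hw]; exact Nat.zero_le _
  · rw [nrm_of, hl, wt, one_mul, pow_mul]; rfl

/-- The exponential `e^{c w} = ∑ (cⁿ/n!) wⁿ` of a multiple of a monomial `w` of `X`-degree `0`. -/
def eExp (c : ℂ) (w : M) (hw : deg w = 0) : K M := (ctrl_pow w hw).lin (expSeries c)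

lemma eExp_hasSum (c : ℂ) (w : M) (hw : deg w = 0) :
    HasSum (fun n : ℕ => (c ^ n / n.factorial) • (K.of w : K M) ^ n) (eExp c w hw) := by
  have := (K.hasSum_of (expSeries c)).map (ctrl_pow w hw).lin (ctrl_pow w hw).continuous
  rw [eExp]
  convert this using 2 with n
  rw [Function.comp_apply, map_smul, Ctrl.lin_of, expSeries_apply]
  congr 1
  exact (map_pow K.ofHom w n).symm

lemma eExp_functional (c : ℂ) (w : M) (hw : deg w = 0) {Λ : K M →ₗ[ℂ] ℂ} (hΛ : Continuous Λ) :
    HasSum (fun n : ℕ => c ^ n / n.factorial * Λ (K.of (w ^ n))) (Λ (eExp c w hw)) := by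
  have := K.hasSum_functional (Λ := Λ ∘ₗ (ctrl_pow w hw).lin)
    (hΛ.comp (ctrl_pow w hw).continuous) (expSeries c)
  rw [eExp]
  simpa only [LinearMap.comp_apply, Ctrl.lin_of, expSeries_apply] using this

lemma eExp_comm (c : ℂ) (w : M) (hw : deg w = 0) (v : M) (h : v * w = w * v) :
    K.of v * eExp c w hw = eExp c w hw * K.of v := by
  refine K.lin_ext (L := K.mulL (K.of v) ∘ₗ (ctrl_pow w hw).lin)
    (L' := K.mulR (K.of v) ∘ₗ (ctrl_pow w hw).lin)
    ((K.mulL_cont _).comp (ctrl_pow w hw).continuous)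
    ((K.mulR_cont _).comp (ctrl_pow w hw).continuous) (fun n => ?_) (expSeries c)
  simp only [LinearMap.comp_apply, Ctrl.lin_of]
  change K.of v * K.of (w ^ n) = K.of (w ^ n) * K.of v
  rw [K.of_mul_of, K.of_mul_of, (Commute.pow_right h n).eq]

lemma eExp_deg (c : ℂ) (w : M) (hw : deg w = 0) (u : M) (hu : eExp c w hw u ≠ 0) : deg u ≤ 0 := by
  by_contra hlt
  refine hu ((tsum_congr fun n => ?_).trans tsum_zero)
  by_contra hne
  rw [of_ne_zero (mul_ne_zero_iff.1 hne).2, deg_pow hw] at hlt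
  exact hlt le_rfl

end Exp

/-! ### Topological algebras given by generators and relations -/

section Quot
variable {M : Type} [Monoid M] [WeightedMonoid M]

/-- The closed two-sided ideal generated by `S`. -/
def closedIdeal (S : Set (K M)) : TwoSidedIdeal (K M) :=
  sInf {I | S ⊆ I ∧ IsClosed (I : Set (K M))}

/-- The quotient by the closed two-sided ideal generated by `S`. -/
def TopQuot (S : Set (K M)) : Type := (closedIdeal S).ringCon.Quotient

namespace TopQuot
variable {S : Set (K M)}

instance : Ring (TopQuot S) := inferInstanceAs (Ring (closedIdeal S).ringCon.Quotient)
instance : Algebra ℂ (TopQuot S) := inferInstanceAs (Algebra ℂ (closedIdeal S).ringCon.Quotient)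

/-- The projection. -/
def mk : K M →ₐ[ℂ] TopQuot S :=
  { (closedIdeal S).ringCon.mk' with commutes' := fun _ => rfl }

lemma mk_surjective : Function.Surjective (mk (S := S)) := fun q => Quotient.inductionOn' q
  fun a => ⟨a, rfl⟩

/-- The quotient topology. -/
instance : TopologicalSpace (TopQuot S) := TopologicalSpace.coinduced mk inferInstance

lemma continuous_mk : Continuous (mk (S := S)) := continuous_coinduced_rng

lemma continuous_iff {Y : Type} [TopologicalSpace Y] {f : TopQuot S → Y} :
    Continuous f ↔ Continuous (f ∘ mk) := continuous_coinduced_dom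

lemma mem_closedIdeal_iff {a : K M} :
    a ∈ closedIdeal S ↔ ∀ I : TwoSidedIdeal (K M), S ⊆ I → IsClosed (I : Set (K M)) → a ∈ I := by
  simp only [closedIdeal, TwoSidedIdeal.mem_sInf, Set.mem_ofPred_eq, and_imp]

lemma mk_eq_zero_iff {a : K M} : (mk a : TopQuot S) = 0 ↔ a ∈ closedIdeal S := by
  rw [TwoSidedIdeal.mem_iff]
  exact (RingCon.eq _)

lemma mk_rel {a : K M} (h : a ∈ S) : (mk a : TopQuot S) = 0 :=
  mk_eq_zero_iff.2 (mem_closedIdeal_iff.2 fun _ hI _ => hI h)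

lemma isClosed_ker : IsClosed {a : K M | (mk a : TopQuot S) = 0} := by
  have : {a : K M | (mk a : TopQuot S) = 0} =
      ⋂ I : {I : TwoSidedIdeal (K M) // S ⊆ I ∧ IsClosed (I : Set (K M))}, (I.1 : Set (K M)) := by
    ext a
    simp only [Set.mem_ofPred_eq, mk_eq_zero_iff, mem_closedIdeal_iff, Set.mem_iInter,
      Subtype.forall, and_imp, SetLike.mem_coe]
  rw [this]
  exact isClosed_iInter fun I => I.2.2

/-- A homomorphism with closed kernel which respects the relations descends to the quotient. -/
def lift {R : Type} [Ring R] [Algebra ℂ R] (φ : K M →ₐ[ℂ] R) (hc : IsClosed {a | φ a = 0})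
    (hS : ∀ s ∈ S, φ s = 0) : TopQuot S →ₐ[ℂ] R :=
  { RingCon.lift (closedIdeal S).ringCon φ.toRingHom (fun a b hab => by
      rw [RingCon.ker_apply]
      have h1 : a - b ∈ closedIdeal S := (TwoSidedIdeal.rel_iff _ _ _).1 hab
      have h2 := mem_closedIdeal_iff.1 h1 (TwoSidedIdeal.ker φ)
        (fun s hs => (TwoSidedIdeal.mem_ker φ).2 (hS s hs))
        (by
          have : ((TwoSidedIdeal.ker φ : TwoSidedIdeal (K M)) : Set (K M)) = {a | φ a = 0} := by
            ext a; exact TwoSidedIdeal.mem_ker φ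
          rwa [this])
      have h3 := (TwoSidedIdeal.mem_ker φ).1 h2
      rw [map_sub, sub_eq_zero] at h3
      exact h3) with
    commutes' := fun a => φ.commutes a }

lemma lift_mk {R : Type} [Ring R] [Algebra ℂ R] (φ : K M →ₐ[ℂ] R) (hc) (hS) (a : K M) :
    lift (S := S) φ hc hS (mk a) = φ a := rfl

end TopQuot
end Quot

/-! ### The topological bialgebras -/

/-- Data for a topological bialgebra with generators `h` and `x ∈ X`, relations `[h, x] = a_x x` and
coproduct `Δ(h) = h ⊗ 1 + 1 ⊗ h`, `Δ(x) = x ⊗ 1 + e^{c_x h} ⊗ x`. -/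
structure Datum where
  X : Type
  fin : Finite X
  a : X → ℂ
  c : X → ℂ

instance (D : Datum) : Finite D.X := D.fin

/-- The relations `[h, x] = a_x x`. -/
def rel₁ (D : Datum) : Set (EAlg Unit D.X) :=
  {e | ∃ x, e = EAlg.h () * EAlg.x x - EAlg.x x * EAlg.h () - D.a x • EAlg.x x}

/-- The topological algebra `E(h; X) / ([h, x] = a_x x)`. -/
abbrev Bialg (D : Datum) : Type := TopQuot (rel₁ D)

/-- The relations of two copies of the algebra (indexed by `false` and `true`), together with the
relation that the two copies commute with each other. -/
def rel₂ (D : Datum) : Set (EAlg Bool (Bool × D.X)) :=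
  {e | ∃ i x, e = EAlg.h i * EAlg.x (i, x) - EAlg.x (i, x) * EAlg.h i - D.a x • EAlg.x (i, x)} ∪
  {e | ∃ i x, e = EAlg.h (!i) * EAlg.x (i, x) - EAlg.x (i, x) * EAlg.h (!i)} ∪
  {e | ∃ x y, e = EAlg.x (false, x) * EAlg.x (true, y) - EAlg.x (true, y) * EAlg.x (false, x)}

/-- The completed tensor product of `Bialg D` with itself. -/
abbrev Bialg₂ (D : Datum) : Type := TopQuot (rel₂ D)

namespace Bialg
variable (D : Datum)

/-- The generator `h`. -/
def h : Bialg D := TopQuot.mk (EAlg.h ())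
/-- The generators `x ∈ X`. -/
def x (j : D.X) : Bialg D := TopQuot.mk (EAlg.x j)
/-- The exponential `e^{c h}`. -/
def expH (c : ℂ) : Bialg D := TopQuot.mk (eExp c (Word.gen (Sum.inl ())) (Word.deg_inl _))

end Bialg

namespace Bialg₂
variable (D : Datum)

/-- `h ⊗ 1` for `i = false`, `1 ⊗ h` for `i = true`. -/
def h (i : Bool) : Bialg₂ D := TopQuot.mk (EAlg.h i)
/-- `x ⊗ 1` for `i = false`, `1 ⊗ x` for `i = true`. -/
def x (i : Bool) (j : D.X) : Bialg₂ D := TopQuot.mk (EAlg.x (i, j))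
/-- `e^{c h} ⊗ 1` for `i = false`, `1 ⊗ e^{c h}` for `i = true`. -/
def expH (c : ℂ) (i : Bool) : Bialg₂ D :=
  TopQuot.mk (eExp c (Word.gen (Sum.inl i)) (Word.deg_inl _))
/-- `e^{κ h ⊗ h}`. -/
def expHH (κ : ℂ) : Bialg₂ D :=
  TopQuot.mk (eExp κ (Word.gen (Sum.inl false) * Word.gen (Sum.inl true))
    (by rw [deg_mul, Word.deg_inl, Word.deg_inl]))

end Bialg₂

section Coproduct
variable (D : Datum)

/-- The values of the coproduct on generators. -/
def coprodGen : Unit ⊕ D.X → EAlg Bool (Bool × D.X)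
  | Sum.inl _ => EAlg.h false + EAlg.h true
  | Sum.inr j => EAlg.x (false, j) +
      eExp (D.c j) (Word.gen (Sum.inl false)) (Word.deg_inl _) * EAlg.x (true, j)

lemma coprodGen_deg (g : Unit ⊕ D.X) (u : Word Bool (Bool × D.X)) (hu : coprodGen D g u ≠ 0) :
    deg u ≤ deg (Word.gen g) := by
  rcases g with _ | j
  · rw [Word.deg_inl]
    by_cases h : EAlg.h (X := Bool × D.X) false u = 0
    · have h2 : EAlg.h (X := Bool × D.X) true u ≠ 0 := fun h3 => hu (by
        change EAlg.h false u + EAlg.h true u = 0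
        rw [h, h3, add_zero])
      rw [of_ne_zero h2, Word.deg_inl]
    · rw [of_ne_zero h, Word.deg_inl]
  · rw [Word.deg_inr]
    by_cases h : EAlg.x (H := Bool) (false, j) u = 0
    · have h2 : (eExp (D.c j) (Word.gen (Sum.inl false)) (Word.deg_inl _) *
          EAlg.x (true, j) : EAlg Bool (Bool × D.X)) u ≠ 0 := fun h3 => hu (by
        change EAlg.x (false, j) u + (_ * EAlg.x (true, j) : EAlg Bool (Bool × D.X)) u = 0
        rw [h, h3, add_zero])
      refine (deg_mul_le (eExp_deg _ _ _) (n := 1) (fun v hv => ?_) u h2).trans (by omega)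
      rw [of_ne_zero hv, Word.deg_inr]
    · rw [of_ne_zero h, Word.deg_inr]

/-- The coproduct on `E(h; X)`. -/
def coprodE : EAlg Unit D.X →ₐ[ℂ] EAlg Bool (Bool × D.X) :=
  evalHom (coprodGen D) (fun _ _ => rfl) (coprodGen_deg D)

lemma coprodE_cont : Continuous (coprodE D) := evalHom_cont _ _ _

lemma Bialg₂.comm_expH (c : ℂ) (i j : Bool) :
    Bialg₂.h D i * Bialg₂.expH D c j = Bialg₂.expH D c j * Bialg₂.h D i := by
  have := eExp_comm c (Word.gen (Sum.inl j) : Word Bool (Bool × D.X)) (Word.deg_inl _)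
    (Word.gen (Sum.inl i)) (PresentedMonoid.mk_eq_mk_of_rel (CommRel.comm i j))
  have := congrArg (TopQuot.mk (S := rel₂ D)) this
  rwa [map_mul, map_mul] at this

lemma Bialg₂.rel_same (i : Bool) (j : D.X) :
    Bialg₂.h D i * Bialg₂.x D i j - Bialg₂.x D i j * Bialg₂.h D i - D.a j • Bialg₂.x D i j = 0 := by
  have := TopQuot.mk_rel (S := rel₂ D) (Or.inl (Or.inl ⟨i, j, rfl⟩))
  rwa [map_sub, map_sub, map_smul, map_mul, map_mul] at this

lemma Bialg₂.rel_diff (i : Bool) (j : D.X) :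
    Bialg₂.h D (!i) * Bialg₂.x D i j - Bialg₂.x D i j * Bialg₂.h D (!i) = 0 := by
  have := TopQuot.mk_rel (S := rel₂ D) (Or.inl (Or.inr ⟨i, j, rfl⟩))
  rwa [map_sub, map_mul, map_mul] at this

lemma mk_coprodE_h : (TopQuot.mk (S := rel₂ D)).comp (coprodE D) (EAlg.h ()) =
    Bialg₂.h D false + Bialg₂.h D true := by
  rw [AlgHom.comp_apply, EAlg.h, coprodE, evalHom_gen, coprodGen, map_add]; rfl

lemma mk_coprodE_x (j : D.X) : (TopQuot.mk (S := rel₂ D)).comp (coprodE D) (EAlg.x j) =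
    Bialg₂.x D false j + Bialg₂.expH D (D.c j) false * Bialg₂.x D true j := by
  rw [AlgHom.comp_apply, EAlg.x, coprodE, evalHom_gen, coprodGen, map_add, map_mul]; rfl

lemma coprodE_rel (s : EAlg Unit D.X) (hs : s ∈ rel₁ D) :
    (TopQuot.mk (S := rel₂ D)).comp (coprodE D) s = 0 := by
  obtain ⟨j, rfl⟩ := hs
  rw [map_sub, map_sub, map_smul, map_mul, map_mul, mk_coprodE_h, mk_coprodE_x]
  have r1 := Bialg₂.rel_same D false j
  have r2 := Bialg₂.rel_diff D false j
  have r3 := Bialg₂.comm_expH D (D.c j) false false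
  have r4 := Bialg₂.rel_diff D true j
  have r5 := Bialg₂.comm_expH D (D.c j) true false
  have r6 := Bialg₂.rel_same D true j
  simp only [Bool.not_false, Bool.not_true] at r2 r4
  generalize Bialg₂.h D false = H1 at *
  generalize Bialg₂.h D true = H2 at *
  generalize Bialg₂.x D false j = X1 at *
  generalize Bialg₂.x D true j = X2 at *
  generalize Bialg₂.expH D (D.c j) false = E at *
  have : (H1 + H2) * (X1 + E * X2) - (X1 + E * X2) * (H1 + H2) - D.a j • (X1 + E * X2) =
      (H1 * X1 - X1 * H1 - D.a j • X1) + (H2 * X1 - X1 * H2) + (H1 * E - E * H1) * X2 +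
      E * (H1 * X2 - X2 * H1) + (H2 * E - E * H2) * X2 + E * (H2 * X2 - X2 * H2 - D.a j • X2) := by
    simp only [smul_add, mul_sub, mul_smul_comm]
    noncomm_ring
  rw [this, r1, r2, r3, r4, r5, r6]
  simp

/-- The coproduct. -/
def coprod : Bialg D →ₐ[ℂ] Bialg₂ D :=
  TopQuot.lift ((TopQuot.mk (S := rel₂ D)).comp (coprodE D))
    (TopQuot.isClosed_ker.preimage (coprodE_cont D)) (coprodE_rel D)

lemma coprod_cont : Continuous (coprod D) :=
  TopQuot.continuous_iff.2 (TopQuot.continuous_mk.comp (coprodE_cont D))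

lemma coprod_h : coprod D (Bialg.h D) = Bialg₂.h D false + Bialg₂.h D true :=
  (TopQuot.lift_mk _ _ _ _).trans (mk_coprodE_h D)

lemma coprod_x (j : D.X) : coprod D (Bialg.x D j) =
    Bialg₂.x D false j + Bialg₂.expH D (D.c j) false * Bialg₂.x D true j :=
  (TopQuot.lift_mk _ _ _ _).trans (mk_coprodE_x D j)

end Coproduct

section Counit

lemma Word.eq_one_of_len {H X : Type} {w : Word H X} (h : len w = 0) : w = 1 := by
  induction w using Word.induction with
  | one => rfl
  | mul g w ih => rw [len_mul, Word.len_gen] at h; omega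

lemma coef_one_mul {H X : Type} (f g : EAlg H X) : (f * g) 1 = f 1 * g 1 := by
  have e : ∀ a b : Word H X, (K.of (a * b) : EAlg H X) 1 = K.of a 1 * K.of b 1 := fun a b => by
    simp only [K.of_apply]
    by_cases h : (1 : Word H X) = a * b
    · have := congrArg len h
      rw [len_mul, len_one] at this
      have ha := Word.eq_one_of_len (w := a) (by omega)
      have hb := Word.eq_one_of_len (w := b) (by omega)
      simp [ha, hb]
    · by_cases ha : 1 = a
      · by_cases hb : 1 = b
        · exact absurd (by rw [← ha, ← hb, one_mul]) h
        · simp [h, hb]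
      · simp [h, ha]
  refine K.functional_ext (Λ := K.coef 1 ∘ₗ K.mulR g) (Λ' := LinearMap.mulRight ℂ (g 1) ∘ₗ K.coef 1)
    ((K.coef_cont 1).comp (K.mulR_cont g)) ((continuous_mul_const (g 1)).comp (K.coef_cont 1))
    (fun a => ?_) f
  refine K.functional_ext (Λ := K.coef 1 ∘ₗ K.mulL (K.of a))
    (Λ' := LinearMap.mulLeft ℂ (K.of a 1) ∘ₗ K.coef 1)
    ((K.coef_cont 1).comp (K.mulL_cont _)) ((continuous_const_mul _).comp (K.coef_cont 1))
    (fun b => ?_) g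
  change (K.of a * K.of b : EAlg H X) 1 = _
  rw [K.of_mul_of]
  exact e a b

/-- The counit on `E(h; X)`: the constant coefficient. -/
def counitE (H X : Type) : EAlg H X →ₐ[ℂ] ℂ :=
  AlgHom.ofLinearMap (K.coef 1) (by
    change K.of 1 1 = (1 : ℂ); simp [K.of_apply]) coef_one_mul

lemma counitE_gen {H X : Type} (g : H ⊕ X) : counitE H X (K.of (Word.gen g)) = 0 := by
  change K.of (Word.gen g) 1 = (0 : ℂ)
  by_contra h
  have := congrArg len (of_ne_zero h)
  rw [len_one, Word.len_gen] at this
  omega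

variable (D : Datum)

/-- The counit, which vanishes on all generators. -/
def counit : Bialg D →ₐ[ℂ] ℂ :=
  TopQuot.lift (counitE Unit D.X)
    (isClosed_singleton.preimage (K.coef_cont (1 : Word Unit D.X)))
    (by
      rintro _ ⟨j, rfl⟩
      have h1 : counitE Unit D.X (EAlg.x j) = 0 := counitE_gen _
      rw [map_sub, map_sub, map_smul, map_mul, map_mul, h1]; simp)

lemma counit_cont : Continuous (counit D) :=
  TopQuot.continuous_iff.2 (K.coef_cont (1 : Word Unit D.X))

lemma counit_h : counit D (Bialg.h D) = 0 := counitE_gen _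
lemma counit_x (j : D.X) : counit D (Bialg.x D j) = 0 := counitE_gen _

end Counit

section SubA

/-- No generators apart from `h`. -/
def Datum.empty : Datum := ⟨Empty, inferInstance, Empty.elim, Empty.elim⟩

/-- The topological Hopf algebra `A = E(h; 0)` (there are no relations). -/
abbrev AlgA : Type := Bialg Datum.empty

variable (D : Datum)

/-- The homomorphism `E(h; 0) → E(h; X)`. -/
def inclE : EAlg Unit Datum.empty.X →ₐ[ℂ] EAlg Unit D.X :=
  evalHom (Sum.elim (fun i => EAlg.h i) Empty.elim) (fun _ _ => rfl) (by
    rintro (i | i) u hu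
    · rw [of_ne_zero hu, Word.deg_inl, Word.deg_inl]
    · exact i.elim)

lemma inclE_cont : Continuous (inclE D) := evalHom_cont _ _ _

/-- The homomorphism `A → Bialg D` which sends `h` to `h`. -/
def inclA : AlgA →ₐ[ℂ] Bialg D :=
  TopQuot.lift ((TopQuot.mk (S := rel₁ D)).comp (inclE D))
    (TopQuot.isClosed_ker.preimage (inclE_cont D)) (by rintro _ ⟨j, _⟩; exact j.elim)

lemma inclA_cont : Continuous (inclA D) :=
  TopQuot.continuous_iff.2 (TopQuot.continuous_mk.comp (inclE_cont D))

lemma inclE_h : inclE D (EAlg.h ()) = EAlg.h () := by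
  rw [EAlg.h, inclE, evalHom_gen]; rfl

lemma inclA_h : inclA D (Bialg.h _) = Bialg.h D :=
  (TopQuot.lift_mk _ _ _ _).trans (congrArg TopQuot.mk (inclE_h D))

end SubA

/-! ### Continuous representations -/

section WeakExt
variable {V W : Type} [AddCommGroup V] [Module ℂ V] [AddCommGroup W] [Module ℂ W]

/-- A representation of a topological algebra is continuous if all functions `a ↦ φ(a.v)` are. -/
def WeakCont {R : Type} [Ring R] [Algebra ℂ R] [TopologicalSpace R]
    (ρ : R →ₐ[ℂ] Module.End ℂ V) : Prop :=
  ∀ (v : V) (φ : Module.Dual ℂ V), Continuous fun a => φ (ρ a v)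

lemma dual_ext {v w : V} (h : ∀ φ : Module.Dual ℂ V, φ v = φ w) : v = w := by
  rw [← sub_eq_zero, ← Module.forall_dual_apply_eq_zero_iff ℂ]
  intro φ
  rw [map_sub, h, sub_self]

/-- The function `a ↦ φ(a.v)`. -/
def matCoef {R : Type} [Ring R] [Algebra ℂ R] (ρ : R →ₐ[ℂ] Module.End ℂ V) (v : V)
    (φ : Module.Dual ℂ V) : R →ₗ[ℂ] ℂ :=
  φ ∘ₗ LinearMap.applyₗ v ∘ₗ ρ.toLinearMap

variable {M : Type} [Monoid M] [WeightedMonoid M]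

/-- `v` has a well-defined orbit under the extension of `ρ₀` to series. -/
def Good (ρ₀ : M →* Module.End ℂ V) (v : V) : Prop :=
  (∀ φ : Module.Dual ℂ V, Growth fun w => φ (ρ₀ w v)) ∧
    ∀ f : K M, ∃ s : V, ∀ φ : Module.Dual ℂ V, φ s = ∑' w, f w * φ (ρ₀ w v)

variable {ρ₀ : M →* Module.End ℂ V}

lemma Growth.add {ι : Type} [Weighted ι] {γ γ' : ι → ℂ} (h : Growth γ) (h' : Growth γ') :
    Growth fun i => γ i + γ' i := by
  obtain ⟨c, r, h⟩ := h
  obtain ⟨c', r', h'⟩ := h'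
  refine ⟨c + c', r + r', fun i => (enorm_add_le _ _).trans ((add_le_add (h i) (h' i)).trans ?_)⟩
  rw [← ENNReal.coe_add]
  refine ENNReal.coe_le_coe.2 ?_
  simp only [wt, Pi.add_apply, add_mul]
  gcongr
  · exact le_self_add
  · exact le_add_self

lemma Growth.smul {ι : Type} [Weighted ι] {γ : ι → ℂ} (a : ℂ) (h : Growth γ) :
    Growth fun i => a * γ i := by
  obtain ⟨c, r, h⟩ := h
  refine ⟨fun n => ‖a‖₊ * c n, r, fun i => ?_⟩
  rw [enorm_mul, wt, mul_assoc, ENNReal.coe_mul]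
  exact mul_le_mul' le_rfl (h i)

lemma Good.add {v w : V} (hv : Good ρ₀ v) (hw : Good ρ₀ w) : Good ρ₀ (v + w) := by
  refine ⟨fun φ => by simpa only [map_add] using (hv.1 φ).add (hw.1 φ), fun f => ?_⟩
  obtain ⟨s, hs⟩ := hv.2 f
  obtain ⟨t, ht⟩ := hw.2 f
  refine ⟨s + t, fun φ => ?_⟩
  rw [map_add, hs, ht, ← ((hv.1 φ).summable f).tsum_add ((hw.1 φ).summable f)]
  simp only [map_add, mul_add]

lemma Good.smul {v : V} (a : ℂ) (hv : Good ρ₀ v) : Good ρ₀ (a • v) := by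
  refine ⟨fun φ => by simpa only [map_smul, smul_eq_mul] using (hv.1 φ).smul a, fun f => ?_⟩
  obtain ⟨s, hs⟩ := hv.2 f
  refine ⟨a • s, fun φ => ?_⟩
  rw [map_smul, hs, smul_eq_mul, ← tsum_mul_left]
  simp only [map_smul, smul_eq_mul, mul_left_comm]

/-- The extension of a representation of monomials to a linear action of series. -/
def weakLin (hG : ∀ v, Good ρ₀ v) : K M →ₗ[ℂ] Module.End ℂ V where
  toFun f :=
    { toFun := fun v => ((hG v).2 f).choose
      map_add' := fun v w => dual_ext fun φ => by
        rw [map_add, ((hG _).2 f).choose_spec, ((hG _).2 f).choose_spec,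
          ((hG _).2 f).choose_spec,
          ← (((hG v).1 φ).summable f).tsum_add (((hG w).1 φ).summable f)]
        simp only [map_add, mul_add]
      map_smul' := fun a v => dual_ext fun φ => by
        rw [RingHom.id_apply, map_smul, ((hG _).2 f).choose_spec, ((hG _).2 f).choose_spec,
          smul_eq_mul, ← tsum_mul_left]
        simp only [map_smul, smul_eq_mul, mul_left_comm] }
  map_add' f g := LinearMap.ext fun v => dual_ext fun φ => by
    rw [LinearMap.add_apply, map_add]
    simp only [LinearMap.coe_mk, AddHom.coe_mk]
    rw [((hG _).2 _).choose_spec, ((hG _).2 _).choose_spec, ((hG _).2 _).choose_spec,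
      ← (((hG v).1 φ).summable f).tsum_add (((hG v).1 φ).summable g)]
    simp only [K.add_apply, add_mul]
  map_smul' a f := LinearMap.ext fun v => dual_ext fun φ => by
    rw [RingHom.id_apply, LinearMap.smul_apply, map_smul]
    simp only [LinearMap.coe_mk, AddHom.coe_mk]
    rw [((hG _).2 _).choose_spec, ((hG _).2 _).choose_spec, smul_eq_mul, ← tsum_mul_left]
    simp only [K.smul_apply, mul_assoc]

lemma weakLin_spec (hG : ∀ v, Good ρ₀ v) (f : K M) (v : V) (φ : Module.Dual ℂ V) :
    φ (weakLin hG f v) = ∑' w, f w * φ (ρ₀ w v) := ((hG v).2 f).choose_spec φ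

lemma weakLin_of (hG : ∀ v, Good ρ₀ v) (w : M) : weakLin hG (K.of w) = ρ₀ w :=
  LinearMap.ext fun v => dual_ext fun φ => by
    rw [weakLin_spec, tsum_eq_single w (fun j hj => by simp [K.of_apply, hj])]
    simp [K.of_apply]

/-- `a ↦ φ(a.v)` for the extended action. -/
def weakCoef (hG : ∀ v, Good ρ₀ v) (v : V) (φ : Module.Dual ℂ V) : K M →ₗ[ℂ] ℂ :=
  φ ∘ₗ LinearMap.applyₗ v ∘ₗ weakLin hG

lemma weakCoef_cont (hG : ∀ v, Good ρ₀ v) (v : V) (φ : Module.Dual ℂ V) :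
    Continuous (weakCoef hG v φ) :=
  ((hG v).1 φ).continuous fun f => weakLin_spec hG f v φ

lemma weakLin_mul (hG : ∀ v, Good ρ₀ v) (f g : K M) :
    weakLin hG (f * g) = weakLin hG f * weakLin hG g :=
  LinearMap.ext fun v => dual_ext fun φ => by
    refine K.functional_ext (Λ := weakCoef hG v φ ∘ₗ K.mulR g)
      (Λ' := weakCoef hG (weakLin hG g v) φ) ((weakCoef_cont hG v φ).comp (K.mulR_cont g))
      (weakCoef_cont _ _ _) (fun a => ?_) f
    change φ (weakLin hG (K.of a * g) v) = φ (weakLin hG (K.of a) (weakLin hG g v))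
    rw [weakLin_of]
    refine K.functional_ext (Λ := weakCoef hG v φ ∘ₗ K.mulL (K.of a))
      (Λ' := weakCoef hG v (φ ∘ₗ ρ₀ a)) ((weakCoef_cont hG v φ).comp (K.mulL_cont _))
      (weakCoef_cont _ _ _) (fun b => ?_) g
    change φ (weakLin hG (K.of a * K.of b) v) = φ (ρ₀ a (weakLin hG (K.of b) v))
    rw [K.of_mul_of, weakLin_of, weakLin_of, map_mul]
    rfl

/-- The extension of a representation of monomials to a representation of the algebra. -/
def weakExt (hG : ∀ v, Good ρ₀ v) : K M →ₐ[ℂ] Module.End ℂ V :=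
  AlgHom.ofLinearMap (weakLin hG) ((weakLin_of hG 1).trans (map_one ρ₀)) (weakLin_mul hG)

lemma weakExt_of (hG : ∀ v, Good ρ₀ v) (w : M) : weakExt hG (K.of w) = ρ₀ w := weakLin_of hG w

lemma weakExt_cont (hG : ∀ v, Good ρ₀ v) : WeakCont (weakExt hG) := weakCoef_cont hG

lemma WeakCont.comp {R S : Type} [Ring R] [Algebra ℂ R] [TopologicalSpace R] [Ring S]
    [Algebra ℂ S] [TopologicalSpace S] {ρ : R →ₐ[ℂ] Module.End ℂ V} (h : WeakCont ρ)
    {f : S →ₐ[ℂ] R} (hf : Continuous f) : WeakCont (ρ.comp f) :=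
  fun v φ => (h v φ).comp hf

lemma WeakCont.isClosed_ker {R : Type} [Ring R] [Algebra ℂ R] [TopologicalSpace R]
    {ρ : R →ₐ[ℂ] Module.End ℂ V} (h : WeakCont ρ) : IsClosed {a | ρ a = 0} := by
  have : {a | ρ a = 0} = ⋂ (v : V) (φ : Module.Dual ℂ V), {a | φ (ρ a v) = 0} := by
    ext a
    simp only [Set.mem_ofPred_eq, Set.mem_iInter]
    refine ⟨fun h v φ => by rw [h]; simp, fun h => LinearMap.ext fun v => dual_ext fun φ => ?_⟩
    rw [h v φ]; simp
  rw [this]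
  exact isClosed_iInter fun v => isClosed_iInter fun φ => isClosed_singleton.preimage (h v φ)

/-- A linear map which intertwines the action of the generators is an intertwiner. -/
lemma intertwine {H X : Type} {ρ : EAlg H X →ₐ[ℂ] Module.End ℂ V}
    {ρ' : EAlg H X →ₐ[ℂ] Module.End ℂ W} (hρ : WeakCont ρ) (hρ' : WeakCont ρ') (f : V →ₗ[ℂ] W)
    (hf : ∀ g v, f (ρ (K.of (Word.gen g)) v) = ρ' (K.of (Word.gen g)) (f v)) (a : EAlg H X)
    (v : V) : f (ρ a v) = ρ' a (f v) := by
  refine dual_ext fun φ => ?_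
  refine K.functional_ext (Λ := matCoef ρ v (φ ∘ₗ f)) (Λ' := matCoef ρ' (f v) φ)
    (hρ v (φ ∘ₗ f)) (hρ' (f v) φ) (fun w => ?_) a
  change φ (f (ρ (K.of w) v)) = φ (ρ' (K.of w) (f v))
  congr 1
  induction w using Word.induction with
  | one => rw [← K.one_def, map_one, map_one]; rfl
  | mul g w ih =>
    rw [← K.of_mul_of, map_mul, map_mul, Module.End.mul_apply, Module.End.mul_apply, hf, ih]

end WeakExt

section Weights
variable {H X : Type} {V : Type} [AddCommGroup V] [Module ℂ V]

/-- The `X`-letters of a monomial. -/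
def Word.xpart : Word H X →* FreeMonoid X :=
  Word.lift (Sum.elim (fun _ => 1) FreeMonoid.of)
    (fun _ _ => by rw [Sum.elim_inl, Sum.elim_inl])

lemma Word.xpart_gen (g : H ⊕ X) :
    Word.xpart (Word.gen g) = Sum.elim (fun _ => 1) FreeMonoid.of g := by
  rw [Word.xpart, Word.lift_gen]

lemma Word.length_xpart (w : Word H X) : (Word.xpart w).toList.length = deg w := by
  induction w using Word.induction with
  | one => rw [map_one, deg_one]; rfl
  | mul g w ih =>
    rw [map_mul, deg_mul, Word.xpart_gen, FreeMonoid.toList_mul,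
      List.length_append, ih]
    rcases g with i | j
    · rw [Word.deg_inl]; rfl
    · rw [Word.deg_inr]; rfl

variable [Finite H] [Finite X]

lemma exists_nnbound {J : Type} [Finite J] (l : J → ℂ) : ∃ B : ℝ≥0, ∀ j, ‖l j‖₊ ≤ B := by
  obtain ⟨B, hB⟩ := (Set.finite_range fun j => ‖l j‖₊).bddAbove
  exact ⟨B, fun j => hB ⟨j, rfl⟩⟩

/-- Joint eigenvectors of the `h ∈ H` have well-defined orbits, as each `x ∈ X` shifts weights. -/
lemma good_of_weight (T : H ⊕ X → Module.End ℂ V)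
    (hT : ∀ h h', T (Sum.inl h) * T (Sum.inl h') = T (Sum.inl h') * T (Sum.inl h))
    (α : X → H → ℂ) (hα : ∀ h x v, T (Sum.inl h) (T (Sum.inr x) v) =
      T (Sum.inr x) (T (Sum.inl h) v) + α x h • T (Sum.inr x) v)
    (v : V) (hv : ∀ h, ∃ l : ℂ, T (Sum.inl h) v = l • v) : Good (Word.lift T hT) v := by
  classical
  choose l hl using hv
  obtain ⟨L, hL⟩ := exists_nnbound l
  obtain ⟨A, hA⟩ := exists_nnbound fun p : X × H => α p.1 p.2
  let ρX : FreeMonoid X →* Module.End ℂ V := FreeMonoid.lift fun x => T (Sum.inr x)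
  have step : ∀ (m : FreeMonoid X) (h : H), ∃ μ : ℂ, T (Sum.inl h) (ρX m v) = μ • ρX m v ∧
      ‖μ‖₊ ≤ L + m.toList.length * A := by
    intro m h
    induction m using FreeMonoid.inductionOn' with
    | one => exact ⟨l h, by rw [map_one]; exact hl h, (hL h).trans (by simp)⟩
    | of_mul x m ih =>
      obtain ⟨μ, h1, h2⟩ := ih
      refine ⟨μ + α x h, ?_, ?_⟩
      · rw [map_mul, Module.End.mul_apply, show ρX (FreeMonoid.of x) = T (Sum.inr x) from
          FreeMonoid.lift_eval_of _ _, hα, h1, map_smul, add_smul]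
      · refine (nnnorm_add_le _ _).trans ((add_le_add h2 (hA (x, h))).trans (le_of_eq ?_))
        rw [FreeMonoid.toList_mul, List.length_append]
        simp; ring
  let R : ℕ → ℝ≥0 := fun n => 1 + L + n * A
  have Rmono : ∀ {m n}, m ≤ n → R m ≤ R n := fun h => by
    simp only [R]; gcongr
  have key : ∀ w : Word H X, ∃ z : ℂ, Word.lift T hT w v = z • ρX (Word.xpart w) v ∧
      ‖z‖₊ ≤ R (deg w) ^ len w := by
    intro w
    induction w using Word.induction with
    | one => exact ⟨1, by rw [map_one, map_one, map_one, one_smul], by simp [len_one]⟩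
    | mul g w ih =>
      obtain ⟨z, h1, h2⟩ := ih
      rw [map_mul, Module.End.mul_apply, h1, map_smul, Word.lift_gen, deg_mul, len_mul,
        Word.len_gen, map_mul, Word.xpart_gen]
      rcases g with i | j
      · obtain ⟨μ, h3, h4⟩ := step (Word.xpart w) i
        refine ⟨z * μ, ?_, ?_⟩
        · rw [h3, smul_smul]; simp
        · rw [nnnorm_mul, Word.deg_inl, zero_add, add_comm, pow_succ]
          rw [Word.length_xpart] at h4
          exact mul_le_mul' h2 (h4.trans (by simp only [R]; rw [add_assoc]; exact le_add_self))
      · refine ⟨z, ?_, ?_⟩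
        · rw [Sum.elim_inr, map_mul, Module.End.mul_apply, show ρX (FreeMonoid.of j) =
            T (Sum.inr j) from FreeMonoid.lift_eval_of _ _]
        · rw [add_comm 1, pow_succ]
          refine h2.trans (le_trans (pow_le_pow_left₀ zero_le (Rmono (Nat.le_add_left (deg w) (deg (Word.gen (Sum.inr j) : Word H X)))) _) ?_)
          refine le_mul_of_one_le_right zero_le ?_
          simp only [R]; rw [add_assoc]; exact le_self_add
  choose z hz1 hz2 using key
  have fin : ∀ n, {m : FreeMonoid X | m.toList.length ≤ n}.Finite := fun n =>
    List.finite_length_le X n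
  have growth : ∀ p : FreeMonoid X → ℂ, Growth fun w => z w * p (Word.xpart w) := by
    intro p
    have hb : ∀ n, ∃ B : ℝ≥0, ∀ m : FreeMonoid X, m.toList.length ≤ n → ‖p m‖₊ ≤ B := by
      intro n
      obtain ⟨B, hB⟩ := ((fin n).image fun m => ‖p m‖₊).bddAbove
      exact ⟨B, fun m hm => hB ⟨m, hm, rfl⟩⟩
    choose B hB using hb
    refine ⟨B, R, fun w => ?_⟩
    rw [enorm_mul, wt, mul_comm, ENNReal.coe_mul]
    exact mul_le_mul' (ENNReal.coe_le_coe.2 (hB _ _ (Word.length_xpart w).le))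
      (ENNReal.coe_le_coe.2 (hz2 w))
  refine ⟨fun φ => ?_, fun f => ?_⟩
  · simpa only [hz1, map_smul, smul_eq_mul] using growth fun m => φ (ρX m v)
  · obtain ⟨N, hN⟩ := f.deg_le
    refine ⟨∑ m ∈ (fin N).toFinset,
      (∑' w, f w * (z w * if Word.xpart w = m then 1 else 0)) • ρX m v, fun φ => ?_⟩
    simp only [map_sum, map_smul, smul_eq_mul, ← tsum_mul_right]
    rw [← Summable.tsum_finsetSum]
    · refine tsum_congr fun w => ?_
      by_cases hw : f w = 0
      · simp [hw]
      · rw [Finset.sum_eq_single (Word.xpart w)]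
        · rw [hz1, map_smul, smul_eq_mul]; simp [mul_assoc]
        · intro m _ hm
          simp [hm.symm]
        · intro h
          refine absurd ((fin N).mem_toFinset.2 ?_) h
          exact (Word.length_xpart w).le.trans (hN w hw)
    · intro m _
      exact ((growth fun m' => if m' = m then 1 else 0).summable f).mul_right _

/-- The joint eigenvectors of the `h ∈ H` span. -/
lemma good_of_span (T : H ⊕ X → Module.End ℂ V)
    (hT : ∀ h h', T (Sum.inl h) * T (Sum.inl h') = T (Sum.inl h') * T (Sum.inl h))
    (α : X → H → ℂ) (hα : ∀ h x v, T (Sum.inl h) (T (Sum.inr x) v) =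
      T (Sum.inr x) (T (Sum.inl h) v) + α x h • T (Sum.inr x) v)
    (hs : Submodule.span ℂ {v : V | ∀ h, ∃ l : ℂ, T (Sum.inl h) v = l • v} = ⊤) (v : V) :
    Good (Word.lift T hT) v := by
  have hv : v ∈ Submodule.span ℂ {v : V | ∀ h, ∃ l : ℂ, T (Sum.inl h) v = l • v} := by
    rw [hs]; trivial
  induction hv using Submodule.span_induction with
  | mem v hv => exact good_of_weight T hT α hα v hv
  | zero => exact good_of_weight T hT α hα 0 (fun h => ⟨0, by simp⟩)
  | add v w _ _ hv hw => exact hv.add hw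
  | smul a v _ hv => exact hv.smul a

end Weights

/-! ### Semisimplicity over `A = E(h; 0)` -/

section Semisimple
variable {V : Type} [AddCommGroup V] [Module ℂ V]

/-- Semisimplicity of a representation of an algebra. -/
def IsSemisimpleRep {R : Type} [Ring R] [Algebra ℂ R] (ρ : R →ₐ[ℂ] Module.End ℂ V) : Prop :=
  @IsSemisimpleModule R _ V _ (Module.compHom V ρ.toRingHom)

/-- The span of the eigenvectors. -/
def eigSpan (T : Module.End ℂ V) : Submodule ℂ V := Submodule.span ℂ {v | ∃ l : ℂ, T v = l • v}

lemma AlgA.mk_gen (g : Unit ⊕ Datum.empty.X) :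
    (TopQuot.mk (K.of (Word.gen g)) : AlgA) = Bialg.h _ := by
  rcases g with _ | j
  · rfl
  · exact j.elim

lemma AlgA.comm (a : AlgA) : a * Bialg.h _ = Bialg.h _ * a := by
  obtain ⟨a, rfl⟩ := TopQuot.mk_surjective a
  change TopQuot.mk a * TopQuot.mk (EAlg.h ()) = TopQuot.mk (EAlg.h ()) * TopQuot.mk a
  rw [← map_mul, ← map_mul]
  congr 1
  refine K.lin_ext (L := K.mulR (EAlg.h ())) (L' := K.mulL (EAlg.h ())) (K.mulR_cont _)
    (K.mulL_cont _) (fun w => ?_) a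
  change K.of w * K.of _ = K.of _ * K.of w
  rw [K.of_mul_of, K.of_mul_of]
  congr 1
  induction w using Word.induction with
  | one => rw [one_mul, mul_one]
  | mul g w ih =>
    rcases g with u | j
    · rw [mul_assoc, ih]
    · exact j.elim

lemma exists_eigenvector (T : Module.End ℂ V) (S : Submodule ℂ V) (hS : ∀ v ∈ S, T v ∈ S) :
    ∀ (n : ℕ) (p : Polynomial ℂ), p.natDegree = n → p ≠ 0 → ∀ v ∈ S, v ≠ 0 →
      Polynomial.aeval T p v = 0 → ∃ w ∈ S, w ≠ 0 ∧ ∃ l : ℂ, T w = l • w := by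
  have hp : ∀ (q : Polynomial ℂ) (v : V), v ∈ S → Polynomial.aeval T q v ∈ S := by
    intro q v hv
    induction q using Polynomial.induction_on' with
    | add p q hp hq => rw [map_add]; exact S.add_mem hp hq
    | monomial n a =>
      rw [Polynomial.aeval_monomial]
      refine S.smul_mem a ?_
      induction n with
      | zero => exact hv
      | succ n ih => rw [pow_succ']; exact hS _ ih
  intro n
  induction n with
  | zero =>
    intro p hd h0 v hv hv0 h
    rw [Polynomial.natDegree_eq_zero] at hd
    obtain ⟨c, rfl⟩ := hd
    rw [Polynomial.aeval_C, Module.algebraMap_end_apply] at h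
    rcases smul_eq_zero.1 h with h | h
    · exact absurd (by rw [h, Polynomial.C_0]) h0
    · exact absurd h hv0
  | succ n ih =>
    intro p hd h0 v hv hv0 h
    obtain ⟨l, hl⟩ := IsAlgClosed.exists_root p (by
      rw [Polynomial.degree_eq_natDegree h0, hd]; exact_mod_cast Nat.succ_ne_zero n)
    obtain ⟨q, rfl⟩ := Polynomial.dvd_iff_isRoot.2 hl
    have hq : q ≠ 0 := right_ne_zero_of_mul h0
    by_cases hqv : Polynomial.aeval T q v = 0
    · refine ih q ?_ hq v hv hv0 hqv
      rw [Polynomial.natDegree_mul (Polynomial.X_sub_C_ne_zero l) hq,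
        Polynomial.natDegree_X_sub_C] at hd
      omega
    · refine ⟨_, hp q v hv, hqv, l, ?_⟩
      rw [map_mul, Module.End.mul_apply, map_sub, Polynomial.aeval_X, Polynomial.aeval_C,
        LinearMap.sub_apply, Module.algebraMap_end_apply, sub_eq_zero] at h
      exact h

lemma exists_poly (T : Module.End ℂ V) (v : V)
    (h : ∀ φ : Module.Dual ℂ V, Summable fun n : ℕ => (1 / n.factorial : ℂ) * φ ((T ^ n) v)) :
    ∃ p : Polynomial ℂ, p ≠ 0 ∧ Polynomial.aeval T p v = 0 := by
  by_contra! hc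
  let L : Polynomial ℂ →ₗ[ℂ] V := LinearMap.applyₗ v ∘ₗ (Polynomial.aeval T).toLinearMap
  have hL : LinearMap.ker L = ⊥ := by
    rw [LinearMap.ker_eq_bot']
    intro p hp
    by_contra h0
    exact hc p h0 hp
  obtain ⟨g, hg⟩ := L.exists_leftInverse_of_injective hL
  let ψ : Polynomial ℂ →ₗ[ℂ] ℂ :=
    (Polynomial.basisMonomials ℂ).constr ℂ fun n => (n.factorial : ℂ)
  have hψ : ∀ n, (ψ ∘ₗ g) ((T ^ n) v) = n.factorial := fun n => by
    have h1 : (T ^ n) v = L (Polynomial.monomial n 1) := by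
      simp [L, Polynomial.aeval_monomial]
    rw [h1, LinearMap.comp_apply, show g (L (Polynomial.monomial n 1)) = Polynomial.monomial n 1
      from LinearMap.congr_fun hg _]
    have := (Polynomial.basisMonomials ℂ).constr_basis ℂ (fun n => (n.factorial : ℂ)) n
    rwa [Polynomial.coe_basisMonomials] at this
  have := h (ψ ∘ₗ g)
  simp only [hψ] at this
  have e : (fun n : ℕ => (1 / n.factorial : ℂ) * n.factorial) = fun _ => (1 : ℂ) := by
    funext n
    have : (n.factorial : ℂ) ≠ 0 := by exact_mod_cast n.factorial_ne_zero
    field_simp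
  rw [e, summable_const_iff] at this
  exact one_ne_zero this

lemma summable_orbit {σ : AlgA →ₐ[ℂ] Module.End ℂ V} (hσ : WeakCont σ) (v : V)
    (φ : Module.Dual ℂ V) :
    Summable fun n : ℕ => (1 / n.factorial : ℂ) * φ (((σ (Bialg.h _)) ^ n) v) := by
  have := (eExp_functional 1 (Word.gen (Sum.inl ()) : Word Unit Datum.empty.X) (Word.deg_inl _)
    (Λ := matCoef (σ.comp TopQuot.mk) v φ) ((hσ.comp TopQuot.continuous_mk) v φ)).summable
  refine this.congr fun n => ?_
  rw [one_pow]
  congr 1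
  change φ (σ (TopQuot.mk (K.ofHom (Word.gen (Sum.inl ()) ^ n))) v) = _
  rw [map_pow, map_pow, map_pow]
  rfl

/-- An eigenvector of `h` spans an invariant line. -/
lemma eig_line {σ : AlgA →ₐ[ℂ] Module.End ℂ V} (hσ : WeakCont σ) {v : V} {l : ℂ}
    (hv : σ (Bialg.h _) v = l • v) (a : AlgA) : σ a v ∈ Submodule.span ℂ {v} := by
  by_contra hmem
  obtain ⟨φ, h1, h2⟩ := Submodule.exists_le_ker_of_notMem hmem
  refine h1 ?_
  obtain ⟨a, rfl⟩ := TopQuot.mk_surjective a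
  refine K.functional_ext (Λ := matCoef (σ.comp TopQuot.mk) v φ) (Λ' := 0)
    ((hσ.comp TopQuot.continuous_mk) v φ) continuous_const (fun w => ?_) a
  refine h2 (?_ : (σ (TopQuot.mk (K.of w))) v ∈ Submodule.span ℂ {v})
  induction w using Word.induction with
  | one => rw [← K.one_def, map_one, map_one]; exact Submodule.mem_span_singleton_self v
  | mul g w ih =>
    rw [← K.of_mul_of, map_mul, map_mul, AlgA.mk_gen, Module.End.mul_apply]
    obtain ⟨c, hc⟩ := Submodule.mem_span_singleton.1 ih
    rw [← hc, map_smul, hv, smul_smul]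
    exact Submodule.smul_mem _ _ (Submodule.mem_span_singleton_self v)

lemma eigSpan_of_semisimple {σ : AlgA →ₐ[ℂ] Module.End ℂ V} (hσ : WeakCont σ)
    (hs : IsSemisimpleRep σ) : eigSpan (σ (Bialg.h _)) = ⊤ := by
  let : Module AlgA V := Module.compHom V σ.toRingHom
  have hs : IsSemisimpleModule AlgA V := hs
  have smul_def : ∀ (a : AlgA) (v : V), a • v = σ a v := fun _ _ => rfl
  set T := σ (Bialg.h _) with hT
  have hcomm : ∀ (a : AlgA) (v : V), T (σ a v) = σ a (T v) := fun a v => by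
    rw [hT, ← Module.End.mul_apply, ← Module.End.mul_apply, ← map_mul, ← map_mul, AlgA.comm]
  let toC : Submodule AlgA V → Submodule ℂ V := fun S =>
    { S.toAddSubmonoid with
      smul_mem' := fun c v hv => by
        have := S.smul_mem (algebraMap ℂ AlgA c) hv
        rwa [smul_def, AlgHom.commutes, Module.algebraMap_end_apply] at this }
  let E : ℂ → Submodule AlgA V := fun l =>
    { carrier := {v | T v = l • v}
      add_mem' := fun {a b} ha hb => by
        have ha : T a = l • a := ha
        have hb : T b = l • b := hb
        change T (a + b) = l • (a + b)
        rw [map_add, ha, hb, smul_add]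
      zero_mem' := by change T 0 = l • 0; simp
      smul_mem' := fun a v hv => by
        have hv : T v = l • v := hv
        change T (σ a v) = l • σ a v
        rw [hcomm, hv, map_smul] }
  let F : Submodule AlgA V :=
    { (eigSpan T).toAddSubmonoid with
      smul_mem' := fun a v hv => by
        change σ a v ∈ eigSpan T
        replace hv : v ∈ Submodule.span ℂ {v | ∃ l : ℂ, T v = l • v} := hv
        induction hv using Submodule.span_induction with
        | mem v hv =>
          obtain ⟨l, hl⟩ := hv
          exact Submodule.subset_span ⟨l, by rw [hcomm, hl, map_smul]⟩
        | zero => rw [map_zero]; exact Submodule.zero_mem _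
        | add v w _ _ hv hw => rw [map_add]; exact Submodule.add_mem _ hv hw
        | smul c v _ hv => rw [map_smul]; exact Submodule.smul_mem _ c hv }
  have hF : F = ⊤ := by
    rw [eq_top_iff, ← IsSemisimpleModule.sSup_simples_eq_top AlgA V]
    refine sSup_le fun S hS => ?_
    have hS : IsAtom S := isSimpleModule_iff_isAtom.1 hS
    obtain ⟨v, hvS, hv0⟩ := S.ne_bot_iff.1 hS.1
    obtain ⟨p, hp0, hp⟩ := exists_poly T v fun φ => summable_orbit hσ v φ
    obtain ⟨w, hwS, hw0, l, hl⟩ := exists_eigenvector T (toC S)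
      (fun v hv => S.smul_mem (Bialg.h _) hv) _ p rfl hp0 v hvS hv0 hp
    have hle : S ≤ E l := by
      rcases hS.le_iff.1 (inf_le_left : S ⊓ E l ≤ S) with h | h
      · have : w ∈ S ⊓ E l := ⟨hwS, hl⟩
        rw [h] at this
        exact absurd ((Submodule.mem_bot AlgA).1 this) hw0
      · exact inf_eq_left.1 h
    intro u hu
    exact Submodule.subset_span ⟨l, hle hu⟩
  rw [eq_top_iff]
  intro v _
  have : v ∈ F := by rw [hF]; trivial
  exact this

lemma semisimple_of_eigSpan {σ : AlgA →ₐ[ℂ] Module.End ℂ V} (hσ : WeakCont σ)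
    (hs : eigSpan (σ (Bialg.h _)) = ⊤) : IsSemisimpleRep σ := by
  let : Module AlgA V := Module.compHom V σ.toRingHom
  change IsSemisimpleModule AlgA V
  have smul_def : ∀ (a : AlgA) (v : V), a • v = σ a v := fun _ _ => rfl
  have hC : ∀ (c : ℂ) (v : V), (algebraMap ℂ AlgA c) • v = c • v := fun c v => by
    rw [smul_def, AlgHom.commutes, Module.algebraMap_end_apply]
  refine isSemisimpleModule_of_isSemisimpleModule_submodule'
    (p := fun v : {v : V | ∃ l : ℂ, σ (Bialg.h _) v = l • v} => Submodule.span AlgA {v.1})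
    (fun ⟨v, l, hl⟩ => ?_) ?_
  · by_cases h0 : v = 0
    · subst h0
      have : Subsingleton (Submodule.span AlgA {(0 : V)}) := by
        rw [Submodule.span_zero_singleton]; infer_instance
      exact (isSemisimpleModule_iff AlgA _).2 Subsingleton.instComplementedLattice
    · have : IsSimpleModule AlgA (Submodule.span AlgA {v}) := by
        rw [isSimpleModule_iff_isAtom]
        refine ⟨fun h => h0 (Submodule.span_singleton_eq_bot.1 h), fun S hS => ?_⟩
        by_contra hne
        obtain ⟨w, hwS, hw0⟩ := S.ne_bot_iff.1 hne
        obtain ⟨a, ha⟩ := Submodule.mem_span_singleton.1 (hS.le hwS)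
        obtain ⟨c, hc⟩ := Submodule.mem_span_singleton.1 (eig_line hσ hl a)
        rw [← smul_def, ha] at hc
        have hc0 : c ≠ 0 := fun h => hw0 (by rw [← hc, h, zero_smul])
        refine hS.not_ge ?_
        rw [Submodule.span_singleton_le_iff_mem]
        have : v = (algebraMap ℂ AlgA c⁻¹) • w := by
          rw [hC, ← hc, smul_smul, inv_mul_cancel₀ hc0, one_smul]
        rw [this]
        exact S.smul_mem _ hwS
      infer_instance
  · rw [eq_top_iff]
    intro v _
    have hv : v ∈ eigSpan (σ (Bialg.h _)) := by rw [hs]; trivial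
    rw [eigSpan] at hv
    induction hv using Submodule.span_induction with
    | mem v hv =>
      exact (le_iSup (fun v : {v : V | ∃ l : ℂ, σ (Bialg.h _) v = l • v} =>
        Submodule.span AlgA {v.1}) ⟨v, hv⟩) (Submodule.mem_span_singleton_self v)
    | zero => exact Submodule.zero_mem _
    | add v w _ _ hv hw => exact Submodule.add_mem _ (hv trivial) (hw trivial)
    | smul c v _ hv => rw [← hC]; exact Submodule.smul_mem _ _ (hv trivial)

end Semisimple

/-! ### Actions on tensor products -/

section TensorAct
open TensorProduct

/-- An intertwiner of the generators is an intertwiner. -/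
lemma Bialg.intertwine {D : Datum} {V W : Type} [AddCommGroup V] [Module ℂ V] [AddCommGroup W]
    [Module ℂ W] {ρ : Bialg D →ₐ[ℂ] Module.End ℂ V} {σ : Bialg D →ₐ[ℂ] Module.End ℂ W}
    (hρ : WeakCont ρ) (hσ : WeakCont σ) (f : V →ₗ[ℂ] W)
    (hh : ∀ v, f (ρ (Bialg.h D) v) = σ (Bialg.h D) (f v))
    (hx : ∀ j v, f (ρ (Bialg.x D j) v) = σ (Bialg.x D j) (f v)) (a : Bialg D) (v : V) :
    f (ρ a v) = σ a (f v) := by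
  obtain ⟨a, rfl⟩ := TopQuot.mk_surjective a
  refine FreeBoson.intertwine (hρ.comp TopQuot.continuous_mk) (hσ.comp TopQuot.continuous_mk) f
    (fun g v => ?_) a v
  rcases g with _ | j
  · exact hh v
  · exact hx j v

lemma eExp_act {M : Type} [Monoid M] [WeightedMonoid M] {V : Type} [AddCommGroup V] [Module ℂ V]
    {ρ : K M →ₐ[ℂ] Module.End ℂ V} (hρ : WeakCont ρ) (c : ℂ) (w : M) (hw : deg w = 0) {v : V}
    {l : ℂ} (hv : ρ (K.of w) v = l • v) : ρ (eExp c w hw) v = Complex.exp (c * l) • v := by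
  refine dual_ext fun φ => ?_
  have h1 := eExp_functional c w hw (Λ := matCoef ρ v φ) (hρ v φ)
  have h2 : HasSum (fun n : ℕ => (c * l) ^ n / n.factorial) (Complex.exp (c * l)) := by
    rw [Complex.exp_eq_exp_ℂ]
    exact NormedSpace.expSeries_div_hasSum_exp (c * l)
  have h3 := h2.mul_right (φ v)
  rw [map_smul, smul_eq_mul]
  refine h1.unique (h3.congr_fun ?_)
  intro n
  have h4 : ρ (K.of (w ^ n)) v = l ^ n • v := by
    change ρ (K.ofHom (w ^ n)) v = _
    rw [map_pow, map_pow]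
    induction n with
    | zero => simp
    | succ n ih =>
      rw [pow_succ', Module.End.mul_apply, ih, map_smul, pow_succ, mul_smul]
      congr 1
  change _ * φ (ρ (K.of (w ^ n)) v) = _
  rw [h4, map_smul, smul_eq_mul]
  ring

lemma Bialg.rel (D : Datum) (j : D.X) : Bialg.h D * Bialg.x D j =
    Bialg.x D j * Bialg.h D + D.a j • Bialg.x D j := by
  have := TopQuot.mk_rel (S := rel₁ D) ⟨j, rfl⟩
  rw [map_sub, map_sub, map_smul, map_mul, map_mul, sub_sub, sub_eq_zero] at this
  exact this

variable {D : Datum} {V W : Type} [AddCommGroup V] [Module ℂ V] [AddCommGroup W] [Module ℂ W]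
  (ρ : Bialg D →ₐ[ℂ] Module.End ℂ V) (σ : Bialg D →ₐ[ℂ] Module.End ℂ W)

/-- The action of `Bialg D` on the first or second factor of a tensor product. -/
def leg : Bool → Bialg D →ₐ[ℂ] Module.End ℂ (V ⊗[ℂ] W)
  | false => (Module.End.rTensorAlgHom ℂ V W).comp ρ
  | true => (Module.End.lTensorAlgHom ℂ W V).comp σ

lemma leg_false (a : Bialg D) (v : V) (w : W) : leg ρ σ false a (v ⊗ₜ w) = ρ a v ⊗ₜ w := rfl
lemma leg_true (a : Bialg D) (v : V) (w : W) : leg ρ σ true a (v ⊗ₜ w) = v ⊗ₜ σ a w := rfl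

lemma leg_comm (a b : Bialg D) :
    leg ρ σ false a * leg ρ σ true b = leg ρ σ true b * leg ρ σ false a :=
  TensorProduct.ext' fun v w => by
    rw [Module.End.mul_apply, Module.End.mul_apply, leg_true, leg_false, leg_false, leg_true]

/-- The action of the generators of `Bialg₂ D` on a tensor product. -/
def legGen : Bool ⊕ Bool × D.X → Module.End ℂ (V ⊗[ℂ] W)
  | Sum.inl i => leg ρ σ i (Bialg.h D)
  | Sum.inr (i, j) => leg ρ σ i (Bialg.x D j)

lemma legGen_comm (i i' : Bool) : legGen ρ σ (Sum.inl i) * legGen ρ σ (Sum.inl i') =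
    legGen ρ σ (Sum.inl i') * legGen ρ σ (Sum.inl i) := by
  cases i <;> cases i' <;> simp only [legGen, leg_comm]

lemma legGen_rel (i' : Bool) (p : Bool × D.X) :
    legGen ρ σ (Sum.inl i') * legGen ρ σ (Sum.inr p) =
    legGen ρ σ (Sum.inr p) * legGen ρ σ (Sum.inl i') +
      (if i' = p.1 then D.a p.2 else 0) • legGen ρ σ (Sum.inr p) := by
  obtain ⟨i, j⟩ := p
  have rel : ∀ i, leg ρ σ i (Bialg.h D) * leg ρ σ i (Bialg.x D j) =
      leg ρ σ i (Bialg.x D j) * leg ρ σ i (Bialg.h D) + D.a j • leg ρ σ i (Bialg.x D j) :=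
    fun i => by rw [← map_mul, Bialg.rel, map_add, map_mul, map_smul]
  cases i <;> cases i'
  · rw [if_pos rfl]; exact rel _
  · rw [if_neg Bool.true_eq_false.mp, zero_smul, add_zero]; exact (leg_comm ρ σ _ _).symm
  · rw [if_neg Bool.false_eq_true.mp, zero_smul, add_zero]; exact leg_comm ρ σ _ _
  · rw [if_pos rfl]; exact rel _

lemma eigSpan_tensor {P : V ⊗[ℂ] W → Prop} {T : Module.End ℂ V} {T' : Module.End ℂ W}
    (hT : eigSpan T = ⊤) (hT' : eigSpan T' = ⊤) (zero : P 0) (add : ∀ x y, P x → P y → P (x + y))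
    (tmul : ∀ v w (l m : ℂ), T v = l • v → T' w = m • w → P (v ⊗ₜ w))
    (smul : ∀ (c : ℂ) x, P x → P (c • x)) (x : V ⊗[ℂ] W) : P x := by
  induction x using TensorProduct.induction_on with
  | zero => exact zero
  | add x y hx hy => exact add x y hx hy
  | tmul v w =>
    have hv : v ∈ eigSpan T := by rw [hT]; trivial
    have hw : w ∈ eigSpan T' := by rw [hT']; trivial
    rw [eigSpan] at hv hw
    induction hv using Submodule.span_induction with
    | mem v hv =>
      obtain ⟨l, hl⟩ := hv
      induction hw using Submodule.span_induction with
      | mem w hw => obtain ⟨m, hm⟩ := hw; exact tmul v w l m hl hm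
      | zero => rw [tmul_zero]; exact zero
      | add w w' _ _ hw hw' => rw [tmul_add]; exact add _ _ hw hw'
      | smul c w _ hw => rw [tmul_smul]; exact smul c _ hw
    | zero => rw [zero_tmul]; exact zero
    | add v v' _ _ hv hv' => rw [add_tmul]; exact add _ _ hv hv'
    | smul c v _ hv => rw [← smul_tmul']; exact smul c _ hv

/-- Linear maps out of tensor products are determined by the tensors of eigenvectors. -/
lemma tensor_ext {U : Type} [AddCommGroup U] [Module ℂ U] {T : Module.End ℂ V}
    {T' : Module.End ℂ W} (hT : eigSpan T = ⊤) (hT' : eigSpan T' = ⊤) {f g : V ⊗[ℂ] W →ₗ[ℂ] U}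
    (h : ∀ v w (l m : ℂ), T v = l • v → T' w = m • w → f (v ⊗ₜ w) = g (v ⊗ₜ w)) : f = g :=
  LinearMap.ext fun x => eigSpan_tensor (P := fun x => f x = g x) hT hT'
    (by rw [map_zero, map_zero]) (fun x y hx hy => by rw [map_add, map_add, hx, hy]) h
    (fun c x hx => by rw [map_smul, map_smul, hx]) x

variable {ρ σ}

lemma legGen_span (hρ : eigSpan (ρ (Bialg.h D)) = ⊤) (hσ : eigSpan (σ (Bialg.h D)) = ⊤) :
    Submodule.span ℂ {x : V ⊗[ℂ] W | ∀ i, ∃ l : ℂ,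
    legGen ρ σ (Sum.inl i) x = l • x} = ⊤ := by
  rw [eq_top_iff]
  intro x _
  refine eigSpan_tensor hρ hσ (Submodule.zero_mem _) (fun _ _ => Submodule.add_mem _)
    (fun v w l m hv hw => Submodule.subset_span fun i => ?_)
    (fun c _ => Submodule.smul_mem _ c) x
  cases i
  · exact ⟨l, by rw [legGen, leg_false, hv, smul_tmul']⟩
  · exact ⟨m, by rw [legGen, leg_true, hw, tmul_smul]⟩

lemma legGen_good (hρ : eigSpan (ρ (Bialg.h D)) = ⊤) (hσ : eigSpan (σ (Bialg.h D)) = ⊤)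
    (x : V ⊗[ℂ] W) : Good (Word.lift (legGen ρ σ) (legGen_comm ρ σ)) x := by
  refine good_of_span (legGen ρ σ) (legGen_comm ρ σ) (fun p i' => if i' = p.1 then D.a p.2 else 0)
    (fun i' p v => ?_) (legGen_span hρ hσ) x
  rw [← Module.End.mul_apply, legGen_rel, LinearMap.add_apply, Module.End.mul_apply,
    LinearMap.smul_apply]

variable (hρ : eigSpan (ρ (Bialg.h D)) = ⊤) (hσ : eigSpan (σ (Bialg.h D)) = ⊤)

lemma legGen_ext_gen (g : Bool ⊕ Bool × D.X) :
    weakExt (legGen_good hρ hσ) (K.of (Word.gen g)) = legGen ρ σ g :=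
  (weakExt_of _ _).trans (Word.lift_gen _ _ _)

lemma legGen_ext_rel (s : EAlg Bool (Bool × D.X)) (hs : s ∈ rel₂ D) :
    weakExt (legGen_good hρ hσ) s = 0 := by
  have hh : ∀ i, weakExt (legGen_good hρ hσ) (EAlg.h i) = leg ρ σ i (Bialg.h D) := fun i =>
    legGen_ext_gen hρ hσ _
  have hx : ∀ p, weakExt (legGen_good hρ hσ) (EAlg.x p) = legGen ρ σ (Sum.inr p) := fun p =>
    legGen_ext_gen hρ hσ _
  rcases hs with (⟨i, j, rfl⟩ | ⟨i, j, rfl⟩) | ⟨j, j', rfl⟩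
  · rw [map_sub, map_sub, map_smul, map_mul, map_mul, hh, hx]
    have := legGen_rel ρ σ i (i, j)
    rw [if_pos rfl] at this
    rw [sub_sub, sub_eq_zero]
    exact this
  · rw [map_sub, map_mul, map_mul, hh, hx]
    have := legGen_rel ρ σ (!i) (i, j)
    rw [if_neg (by simp), zero_smul, add_zero] at this
    rw [sub_eq_zero]
    exact this
  · rw [map_sub, map_mul, map_mul, hx, hx, sub_eq_zero]
    exact leg_comm ρ σ _ _

/-- The action of the completed tensor square of `Bialg D` on a tensor product. -/
def tensorAct : Bialg₂ D →ₐ[ℂ] Module.End ℂ (V ⊗[ℂ] W) :=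
  TopQuot.lift (weakExt (legGen_good hρ hσ)) (weakExt_cont (legGen_good hρ hσ)).isClosed_ker
    (legGen_ext_rel hρ hσ)

lemma tensorAct_cont : WeakCont (tensorAct hρ hσ) := fun v φ =>
  TopQuot.continuous_iff.2 (weakExt_cont (legGen_good hρ hσ) v φ)

lemma tensorAct_h (i : Bool) : tensorAct hρ hσ (Bialg₂.h D i) = leg ρ σ i (Bialg.h D) :=
  (TopQuot.lift_mk _ _ _ _).trans (legGen_ext_gen hρ hσ _)

lemma tensorAct_x (i : Bool) (j : D.X) :
    tensorAct hρ hσ (Bialg₂.x D i j) = leg ρ σ i (Bialg.x D j) :=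
  (TopQuot.lift_mk _ _ _ _).trans (legGen_ext_gen hρ hσ _)

lemma tensorAct_expH (c : ℂ) {v : V} {l : ℂ} (hv : ρ (Bialg.h D) v = l • v) (w : W) :
    tensorAct hρ hσ (Bialg₂.expH D c false) (v ⊗ₜ w) = Complex.exp (c * l) • v ⊗ₜ w := by
  refine eExp_act (weakExt_cont (legGen_good hρ hσ)) c _ _ ?_
  rw [legGen_ext_gen hρ hσ, legGen, leg_false, hv, smul_tmul']

lemma tensorAct_expHH (κ : ℂ) {v : V} {l : ℂ} (hv : ρ (Bialg.h D) v = l • v) {w : W} {m : ℂ}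
    (hw : σ (Bialg.h D) w = m • w) :
    tensorAct hρ hσ (Bialg₂.expHH D κ) (v ⊗ₜ w) = Complex.exp (κ * (l * m)) • v ⊗ₜ w := by
  refine eExp_act (weakExt_cont (legGen_good hρ hσ)) κ _ _ ?_
  rw [← K.of_mul_of, map_mul, legGen_ext_gen hρ hσ, legGen_ext_gen hρ hσ, legGen, legGen,
    Module.End.mul_apply, leg_true, hw, tmul_smul, map_smul, leg_false, hv, ← smul_tmul',
    smul_smul, mul_comm]

/-- The tensor product of representations. -/
def tensorRep : Bialg D →ₐ[ℂ] Module.End ℂ (V ⊗[ℂ] W) := (tensorAct hρ hσ).comp (coprod D)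

lemma tensorRep_cont : WeakCont (tensorRep hρ hσ) := (tensorAct_cont hρ hσ).comp (coprod_cont D)

lemma tensorRep_h (v : V) (w : W) : tensorRep hρ hσ (Bialg.h D) (v ⊗ₜ w) =
    ρ (Bialg.h D) v ⊗ₜ w + v ⊗ₜ σ (Bialg.h D) w := by
  rw [tensorRep, AlgHom.comp_apply, coprod_h, map_add, tensorAct_h, tensorAct_h]; rfl

lemma tensorRep_h_eig {v : V} {w : W} {l m : ℂ} (hv : ρ (Bialg.h D) v = l • v)
    (hw : σ (Bialg.h D) w = m • w) :
    tensorRep hρ hσ (Bialg.h D) (v ⊗ₜ w) = (l + m) • v ⊗ₜ w := by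
  rw [tensorRep_h, hv, hw, tmul_smul, ← smul_tmul', add_smul]

lemma tensorRep_x (j : D.X) {v : V} {l : ℂ} (hv : ρ (Bialg.h D) v = l • v) (w : W) :
    tensorRep hρ hσ (Bialg.x D j) (v ⊗ₜ w) =
      ρ (Bialg.x D j) v ⊗ₜ w + Complex.exp (D.c j * l) • v ⊗ₜ σ (Bialg.x D j) w := by
  rw [tensorRep, AlgHom.comp_apply, coprod_x, map_add, map_mul, tensorAct_x, tensorAct_x,
    LinearMap.add_apply, Module.End.mul_apply, leg_true, leg_false, tensorAct_expH hρ hσ _ hv]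

lemma tensorRep_span : eigSpan (tensorRep hρ hσ (Bialg.h D)) = ⊤ := by
  rw [eq_top_iff]
  intro x _
  exact eigSpan_tensor (P := fun x => x ∈ eigSpan (tensorRep hρ hσ (Bialg.h D))) hρ hσ
    (Submodule.zero_mem _) (fun _ _ => Submodule.add_mem _)
    (fun v w l m hv hw => Submodule.subset_span ⟨l + m, tensorRep_h_eig hρ hσ hv hw⟩)
    (fun c _ => Submodule.smul_mem _ c) x

end TensorAct

/-! ### The category of representations -/

open CategoryTheory MonoidalCategory Limits

/-- Representations of the topological algebra `Bialg D` on complex vector spaces, which are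
continuous and semisimple as representations of `A = E(h; 0)`. -/
structure Rep (D : Datum) where
  V : ModuleCat.{0} ℂ
  ρ : Bialg D →ₐ[ℂ] Module.End ℂ V
  cont : WeakCont ρ
  ss : IsSemisimpleRep (ρ.comp (inclA D))

namespace Rep
variable {D : Datum}

lemma span (X : Rep D) : eigSpan (X.ρ (Bialg.h D)) = ⊤ := by
  have := eigSpan_of_semisimple (X.cont.comp (inclA_cont D)) X.ss
  rwa [AlgHom.comp_apply, inclA_h] at this

/-- A representation from a diagonalisable action of `h`. -/
def ofSpan (V : ModuleCat.{0} ℂ) (ρ : Bialg D →ₐ[ℂ] Module.End ℂ V) (cont : WeakCont ρ)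
    (span : eigSpan (ρ (Bialg.h D)) = ⊤) : Rep D :=
  ⟨V, ρ, cont, semisimple_of_eigSpan (cont.comp (inclA_cont D))
    (by rwa [AlgHom.comp_apply, inclA_h])⟩

/-- Intertwiners. -/
@[ext] structure Hom (X Y : Rep D) where
  hom : X.V ⟶ Y.V
  comm : ∀ (a : Bialg D) (v : X.V), hom.hom (X.ρ a v) = Y.ρ a (hom.hom v)

instance : Category (Rep D) where
  Hom X Y := Hom X Y
  id X := ⟨𝟙 X.V, fun _ _ => rfl⟩
  comp f g := ⟨f.hom ≫ g.hom, fun a v => by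
    change g.hom.hom (f.hom.hom _) = _
    rw [f.comm, g.comm]; rfl⟩

@[ext] lemma hom_ext {X Y : Rep D} {f g : X ⟶ Y} (h : f.hom = g.hom) : f = g := Hom.ext h
@[simp] lemma id_hom (X : Rep D) : (𝟙 X : X ⟶ X).hom = 𝟙 X.V := rfl
@[simp] lemma comp_hom {X Y Z : Rep D} (f : X ⟶ Y) (g : Y ⟶ Z) : (f ≫ g).hom = f.hom ≫ g.hom := rfl

/-- The underlying vector space. -/
def forget (D : Datum) : Rep D ⥤ ModuleCat.{0} ℂ where
  obj X := X.V
  map f := f.hom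

instance : (forget D).Faithful := ⟨fun h => hom_ext h⟩

/-- A linear map which intertwines the action of the generators. -/
def mkHom {X Y : Rep D} (f : X.V ⟶ Y.V)
    (hh : f.hom ∘ₗ X.ρ (Bialg.h D) = Y.ρ (Bialg.h D) ∘ₗ f.hom)
    (hx : ∀ j, f.hom ∘ₗ X.ρ (Bialg.x D j) = Y.ρ (Bialg.x D j) ∘ₗ f.hom) : X ⟶ Y :=
  ⟨f, fun a v => Bialg.intertwine X.cont Y.cont f.hom (fun v => LinearMap.congr_fun hh v)
    (fun j v => LinearMap.congr_fun (hx j) v) a v⟩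

/-- An intertwiner which is a linear isomorphism. -/
def mkIso {X Y : Rep D} (e : X.V ≅ Y.V) (f : X ⟶ Y) (hf : f.hom = e.hom) : X ≅ Y where
  hom := f
  inv := ⟨e.inv, fun a v => by
    have h := f.comm a (e.inv.hom v)
    rw [hf] at h
    have h1 : ∀ w, e.hom.hom (e.inv.hom w) = w := fun w => by
      rw [← ModuleCat.comp_apply, e.inv_hom_id]; rfl
    have h2 : ∀ w, e.inv.hom (e.hom.hom w) = w := fun w => by
      rw [← ModuleCat.comp_apply, e.hom_inv_id]; rfl
    rw [h1] at h
    rw [← h, h2]⟩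
  hom_inv_id := hom_ext ((congrArg (· ≫ e.inv) hf).trans e.hom_inv_id)
  inv_hom_id := hom_ext ((congrArg (e.inv ≫ ·) hf).trans e.inv_hom_id)

lemma eig_hom {X Y : Rep D} (f : X ⟶ Y) {v : X.V} {l : ℂ} (hv : X.ρ (Bialg.h D) v = l • v) :
    Y.ρ (Bialg.h D) (f.hom.hom v) = l • f.hom.hom v := by
  rw [← f.comm, hv, map_smul]

section Monoidal
open TensorProduct

lemma tensor_ext₃ {V W U Z : Type} [AddCommGroup V] [Module ℂ V] [AddCommGroup W] [Module ℂ W]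
    [AddCommGroup U] [Module ℂ U] [AddCommGroup Z] [Module ℂ Z] {T : Module.End ℂ V}
    {T' : Module.End ℂ W} {T'' : Module.End ℂ U} (hT : eigSpan T = ⊤) (hT' : eigSpan T' = ⊤)
    (hT'' : eigSpan T'' = ⊤) {f g : (V ⊗[ℂ] W) ⊗[ℂ] U →ₗ[ℂ] Z}
    (h : ∀ v w u (l m n : ℂ), T v = l • v → T' w = m • w → T'' u = n • u →
      f ((v ⊗ₜ w) ⊗ₜ u) = g ((v ⊗ₜ w) ⊗ₜ u)) : f = g := by
  refine TensorProduct.ext (tensor_ext hT hT' fun v w l m hv hw => ?_)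
  refine LinearMap.ext_on hT'' fun u hu => ?_
  obtain ⟨n, hn⟩ := hu
  exact h v w u l m n hv hw hn

lemma tensorRep_assoc_h {D : Datum} {V W U : Type} [AddCommGroup V] [Module ℂ V] [AddCommGroup W]
    [Module ℂ W] [AddCommGroup U] [Module ℂ U] {ρ : Bialg D →ₐ[ℂ] Module.End ℂ V}
    {σ : Bialg D →ₐ[ℂ] Module.End ℂ W} {τ : Bialg D →ₐ[ℂ] Module.End ℂ U}
    (hρ : eigSpan (ρ (Bialg.h D)) = ⊤) (hσ : eigSpan (σ (Bialg.h D)) = ⊤)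
    (hτ : eigSpan (τ (Bialg.h D)) = ⊤) :
    (TensorProduct.assoc ℂ V W U).toLinearMap ∘ₗ
      tensorRep (tensorRep_span hρ hσ) hτ (Bialg.h D) =
    tensorRep hρ (tensorRep_span hσ hτ) (Bialg.h D) ∘ₗ
      (TensorProduct.assoc ℂ V W U).toLinearMap :=
  tensor_ext₃ hρ hσ hτ fun u v w l m n hu hv hw => by
    simp only [LinearMap.comp_apply, LinearEquiv.coe_coe, TensorProduct.assoc_tmul]
    rw [tensorRep_h_eig (tensorRep_span hρ hσ) hτ (tensorRep_h_eig hρ hσ hu hv) hw,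
      tensorRep_h_eig hρ (tensorRep_span hσ hτ) hu (tensorRep_h_eig hσ hτ hv hw), map_smul,
      TensorProduct.assoc_tmul, add_assoc]

lemma tensorRep_assoc_x {D : Datum} {V W U : Type} [AddCommGroup V] [Module ℂ V] [AddCommGroup W]
    [Module ℂ W] [AddCommGroup U] [Module ℂ U] {ρ : Bialg D →ₐ[ℂ] Module.End ℂ V}
    {σ : Bialg D →ₐ[ℂ] Module.End ℂ W} {τ : Bialg D →ₐ[ℂ] Module.End ℂ U}
    (hρ : eigSpan (ρ (Bialg.h D)) = ⊤) (hσ : eigSpan (σ (Bialg.h D)) = ⊤)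
    (hτ : eigSpan (τ (Bialg.h D)) = ⊤) (j : D.X) :
    (TensorProduct.assoc ℂ V W U).toLinearMap ∘ₗ
      tensorRep (tensorRep_span hρ hσ) hτ (Bialg.x D j) =
    tensorRep hρ (tensorRep_span hσ hτ) (Bialg.x D j) ∘ₗ
      (TensorProduct.assoc ℂ V W U).toLinearMap :=
  tensor_ext₃ hρ hσ hτ fun u v w l m n hu hv hw => by
    simp only [LinearMap.comp_apply, LinearEquiv.coe_coe, TensorProduct.assoc_tmul]
    rw [tensorRep_x (tensorRep_span hρ hσ) hτ j (tensorRep_h_eig hρ hσ hu hv),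
      tensorRep_x hρ hσ j hu, tensorRep_x hρ (tensorRep_span hσ hτ) j hu,
      tensorRep_x hσ hτ j hv]
    simp only [add_tmul, tmul_add, tmul_smul, smul_add, map_add, map_smul, ← smul_tmul',
      TensorProduct.assoc_tmul, mul_add, Complex.exp_add, mul_smul, add_assoc]

/-- The one-dimensional representation given by the counit. -/
def unitRep (D : Datum) : Bialg D →ₐ[ℂ] Module.End ℂ ℂ := (Algebra.ofId ℂ _).comp (counit D)

lemma unitRep_apply {D : Datum} (a : Bialg D) (v : ℂ) : unitRep D a v = counit D a * v := rfl

lemma unitRep_cont (D : Datum) : WeakCont (unitRep D) := fun v φ => by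
  have : (fun a => φ (unitRep D a v)) = fun a => counit D a * φ v := by
    funext a
    rw [unitRep_apply, ← smul_eq_mul, map_smul, smul_eq_mul]
  rw [this]
  exact (counit_cont D).mul continuous_const

lemma unitRep_h {D : Datum} (v : ℂ) : unitRep D (Bialg.h D) v = (0 : ℂ) • v := by
  rw [unitRep_apply, counit_h, smul_eq_mul]

lemma unitRep_x {D : Datum} (j : D.X) (v : ℂ) : unitRep D (Bialg.x D j) v = 0 := by
  rw [unitRep_apply, counit_x, zero_mul]

lemma unitRep_span (D : Datum) : eigSpan (unitRep D (Bialg.h D)) = ⊤ := by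
  rw [eq_top_iff]
  intro v _
  exact Submodule.subset_span ⟨0, unitRep_h v⟩

section Unitors
variable {V : Type} [AddCommGroup V] [Module ℂ V] {σ : Bialg D →ₐ[ℂ] Module.End ℂ V}
  (hσ : eigSpan (σ (Bialg.h D)) = ⊤)

lemma tensorRep_left_h : (TensorProduct.lid ℂ V).toLinearMap ∘ₗ
      tensorRep (unitRep_span D) hσ (Bialg.h D) =
    σ (Bialg.h D) ∘ₗ (TensorProduct.lid ℂ V).toLinearMap :=
  tensor_ext (unitRep_span D) hσ fun u v l m _ hv => by
    simp only [LinearMap.comp_apply, LinearEquiv.coe_coe]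
    rw [tensorRep_h_eig (unitRep_span D) hσ (unitRep_h u) hv, map_smul, TensorProduct.lid_tmul,
      map_smul, hv, zero_add, smul_comm]

lemma tensorRep_left_x (j : D.X) : (TensorProduct.lid ℂ V).toLinearMap ∘ₗ
      tensorRep (unitRep_span D) hσ (Bialg.x D j) =
    σ (Bialg.x D j) ∘ₗ (TensorProduct.lid ℂ V).toLinearMap :=
  tensor_ext (unitRep_span D) hσ fun u v l m _ hv => by
    simp only [LinearMap.comp_apply, LinearEquiv.coe_coe]
    rw [tensorRep_x (unitRep_span D) hσ j (unitRep_h u), unitRep_x, zero_tmul, zero_add, mul_zero,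
      Complex.exp_zero, one_smul, TensorProduct.lid_tmul, TensorProduct.lid_tmul, map_smul]

lemma tensorRep_right_h : (TensorProduct.rid ℂ V).toLinearMap ∘ₗ
      tensorRep hσ (unitRep_span D) (Bialg.h D) =
    σ (Bialg.h D) ∘ₗ (TensorProduct.rid ℂ V).toLinearMap :=
  tensor_ext hσ (unitRep_span D) fun v u m l hv _ => by
    simp only [LinearMap.comp_apply, LinearEquiv.coe_coe]
    rw [tensorRep_h_eig hσ (unitRep_span D) hv (unitRep_h u), map_smul, TensorProduct.rid_tmul,
      map_smul, hv, add_zero, smul_comm]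

lemma tensorRep_right_x (j : D.X) : (TensorProduct.rid ℂ V).toLinearMap ∘ₗ
      tensorRep hσ (unitRep_span D) (Bialg.x D j) =
    σ (Bialg.x D j) ∘ₗ (TensorProduct.rid ℂ V).toLinearMap :=
  tensor_ext hσ (unitRep_span D) fun v u m l hv _ => by
    simp only [LinearMap.comp_apply, LinearEquiv.coe_coe]
    rw [tensorRep_x hσ (unitRep_span D) j hv, unitRep_x, tmul_zero, smul_zero, add_zero,
      TensorProduct.rid_tmul, TensorProduct.rid_tmul, map_smul]

end Unitors

/-- The unit: the one-dimensional representation given by the counit. -/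
def unit (D : Datum) : Rep D :=
  ofSpan (ModuleCat.of ℂ ℂ) (unitRep D) (unitRep_cont D) (unitRep_span D)

/-- The tensor product via the coproduct. -/
def tensor (X Y : Rep D) : Rep D :=
  ofSpan (X.V ⊗ Y.V) (tensorRep X.span Y.span) (tensorRep_cont _ _) (tensorRep_span _ _)

lemma tensor_h (X Y : Rep D) {v : X.V} {w : Y.V} {l m : ℂ} (hv : X.ρ (Bialg.h D) v = l • v)
    (hw : Y.ρ (Bialg.h D) w = m • w) :
    (tensor X Y).ρ (Bialg.h D) (v ⊗ₜ[ℂ] w) = (l + m) • v ⊗ₜ[ℂ] w :=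
  tensorRep_h_eig X.span Y.span hv hw

lemma tensor_x (X Y : Rep D) (j : D.X) {v : X.V} {l : ℂ} (hv : X.ρ (Bialg.h D) v = l • v)
    (w : Y.V) : (tensor X Y).ρ (Bialg.x D j) (v ⊗ₜ[ℂ] w) =
      X.ρ (Bialg.x D j) v ⊗ₜ[ℂ] w + Complex.exp (D.c j * l) • v ⊗ₜ[ℂ] Y.ρ (Bialg.x D j) w :=
  tensorRep_x X.span Y.span j hv w

/-- The tensor product of intertwiners. -/
def tensorMap {X Y X' Y' : Rep D} (f : X ⟶ X') (g : Y ⟶ Y') : tensor X Y ⟶ tensor X' Y' :=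
  mkHom (f.hom ⊗ₘ g.hom)
    (tensor_ext X.span Y.span fun v w l m hv hw => by
      change (f.hom ⊗ₘ g.hom).hom ((tensor X Y).ρ (Bialg.h D) (v ⊗ₜ[ℂ] w)) =
        (tensor X' Y').ρ (Bialg.h D) (f.hom.hom v ⊗ₜ[ℂ] g.hom.hom w)
      rw [tensor_h X Y hv hw, tensor_h X' Y' (eig_hom f hv) (eig_hom g hw), map_smul]
      rfl)
    (fun j => tensor_ext X.span Y.span fun v w l m hv hw => by
      change (f.hom ⊗ₘ g.hom).hom ((tensor X Y).ρ (Bialg.x D j) (v ⊗ₜ[ℂ] w)) =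
        (tensor X' Y').ρ (Bialg.x D j) (f.hom.hom v ⊗ₜ[ℂ] g.hom.hom w)
      rw [tensor_x X Y j hv, tensor_x X' Y' j (eig_hom f hv), ← f.comm, ← g.comm, map_add,
        map_smul]
      rfl)

/-- The associator of vector spaces. -/
def assocHom (X Y Z : Rep D) : tensor (tensor X Y) Z ⟶ tensor X (tensor Y Z) :=
  mkHom (α_ X.V Y.V Z.V).hom (tensorRep_assoc_h X.span Y.span Z.span)
    (tensorRep_assoc_x X.span Y.span Z.span)

/-- The left unitor of vector spaces. -/
def leftHom (X : Rep D) : tensor (unit D) X ⟶ X :=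
  mkHom (λ_ X.V).hom (tensorRep_left_h X.span) (tensorRep_left_x X.span)

/-- The right unitor of vector spaces. -/
def rightHom (X : Rep D) : tensor X (unit D) ⟶ X :=
  mkHom (ρ_ X.V).hom (tensorRep_right_h X.span) (tensorRep_right_x X.span)

instance : MonoidalCategoryStruct (Rep D) where
  tensorObj X Y := tensor X Y
  tensorUnit := unit D
  tensorHom f g := tensorMap f g
  whiskerLeft X _ _ f := tensorMap (𝟙 X) f
  whiskerRight f Y := tensorMap f (𝟙 Y)
  associator X Y Z := mkIso (α_ X.V Y.V Z.V) (assocHom X Y Z) rfl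
  leftUnitor X := mkIso (λ_ X.V) (leftHom X) rfl
  rightUnitor X := mkIso (ρ_ X.V) (rightHom X) rfl

/-- The monoidal structure is the one of vector spaces. -/
def forgetData (D : Datum) : Monoidal.InducingFunctorData (forget D) where
  μIso X Y := Iso.refl _
  εIso := Iso.refl _
  whiskerLeft_eq X _ _ f := by
    change 𝟙 X.V ⊗ₘ f.hom = 𝟙 _ ≫ (X.V ◁ f.hom) ≫ 𝟙 _
    rw [id_tensorHom, Category.comp_id, Category.id_comp]
  whiskerRight_eq f Y := by
    change f.hom ⊗ₘ 𝟙 Y.V = 𝟙 _ ≫ (f.hom ▷ Y.V) ≫ 𝟙 _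
    rw [tensorHom_id, Category.comp_id, Category.id_comp]
  tensorHom_eq f g := by
    change f.hom ⊗ₘ g.hom = 𝟙 _ ≫ (f.hom ⊗ₘ g.hom) ≫ 𝟙 _
    rw [Category.comp_id, Category.id_comp]
  associator_eq X Y Z := by
    change (α_ X.V Y.V Z.V).hom = ((𝟙 _ ≫ (𝟙 _ ⊗ₘ 𝟙 _)) ≫ (α_ X.V Y.V Z.V).hom ≫
      (𝟙 _ ⊗ₘ 𝟙 _) ≫ 𝟙 _)
    simp
  leftUnitor_eq X := by
    change (λ_ X.V).hom = (𝟙 _ ≫ (𝟙 _ ⊗ₘ 𝟙 _)) ≫ (λ_ X.V).hom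
    simp
  rightUnitor_eq X := by
    change (ρ_ X.V).hom = (𝟙 _ ≫ (𝟙 _ ⊗ₘ 𝟙 _)) ≫ (ρ_ X.V).hom
    simp

instance : MonoidalCategory (Rep D) := Monoidal.induced (forget D) (forgetData D)

end Monoidal
end Rep

namespace Rep
variable {D : Datum}

/-! ### Additive structure -/

section Additive
variable {X Y : Rep D}

instance : Zero (X ⟶ Y) := ⟨⟨0, fun a _ => (map_zero (Y.ρ a)).symm⟩⟩
instance : Add (X ⟶ Y) := ⟨fun f g => ⟨f.hom + g.hom, fun a v =>
  (congrArg₂ (· + ·) (f.comm a v) (g.comm a v)).trans (map_add (Y.ρ a) _ _).symm⟩⟩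
instance : Neg (X ⟶ Y) := ⟨fun f => ⟨-f.hom, fun a v =>
  (congrArg (fun v => -v) (f.comm a v)).trans (map_neg (Y.ρ a) _).symm⟩⟩

lemma zero_hom : (0 : X ⟶ Y).hom = 0 := rfl
lemma add_hom (f g : X ⟶ Y) : (f + g).hom = f.hom + g.hom := rfl
lemma neg_hom (f : X ⟶ Y) : (-f).hom = -f.hom := rfl

instance : AddCommGroup (X ⟶ Y) where
  add_assoc f g h := hom_ext (add_assoc _ _ _)
  zero_add f := hom_ext (zero_add _)
  add_zero f := hom_ext (add_zero _)
  nsmul := nsmulRec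
  zsmul := zsmulRec
  neg_add_cancel f := hom_ext (neg_add_cancel _)
  add_comm f g := hom_ext (add_comm _ _)

instance : Preadditive (Rep D) where
  add_comp _ _ _ f f' g := hom_ext (Preadditive.add_comp _ _ _ f.hom f'.hom g.hom)
  comp_add _ _ _ f g g' := hom_ext (Preadditive.comp_add _ _ _ f.hom g.hom g'.hom)

instance : MonoidalPreadditive (Rep D) where
  whiskerLeft_zero {X Y Z} := hom_ext (by
    change 𝟙 X.V ⊗ₘ (0 : Y.V ⟶ Z.V) = 0
    rw [id_tensorHom, MonoidalPreadditive.whiskerLeft_zero])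
  zero_whiskerRight {X Y Z} := hom_ext (by
    change (0 : Y.V ⟶ Z.V) ⊗ₘ 𝟙 X.V = 0
    rw [tensorHom_id, MonoidalPreadditive.zero_whiskerRight])
  whiskerLeft_add {X Y Z} f g := hom_ext (by
    change 𝟙 X.V ⊗ₘ (f.hom + g.hom) = (𝟙 X.V ⊗ₘ f.hom) + (𝟙 X.V ⊗ₘ g.hom)
    rw [id_tensorHom, MonoidalPreadditive.whiskerLeft_add, id_tensorHom, id_tensorHom])
  add_whiskerRight {X Y Z} f g := hom_ext (by
    change (f.hom + g.hom) ⊗ₘ 𝟙 X.V = (f.hom ⊗ₘ 𝟙 X.V) + (g.hom ⊗ₘ 𝟙 X.V)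
    rw [tensorHom_id, MonoidalPreadditive.add_whiskerRight, tensorHom_id, tensorHom_id])

section Sum
variable (X Y : Rep D)

/-- The direct sum of representations, as an algebra homomorphism. -/
def sumRep : Bialg D →ₐ[ℂ] Module.End ℂ (X.V × Y.V) :=
  AlgHom.ofLinearMap
    { toFun := fun a => (X.ρ a).prodMap (Y.ρ a)
      map_add' := fun a b => by
        rw [map_add, map_add]; exact LinearMap.ext fun v => rfl
      map_smul' := fun c a => by
        rw [map_smul, map_smul]; exact LinearMap.ext fun v => rfl }
    (by
      change (X.ρ 1).prodMap (Y.ρ 1) = 1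
      rw [map_one, map_one]; rfl)
    (fun a b => by
      change (X.ρ (a * b)).prodMap (Y.ρ (a * b)) = _
      rw [map_mul, map_mul]; rfl)

lemma sumRep_apply (a : Bialg D) (v : X.V × Y.V) : sumRep X Y a v = (X.ρ a v.1, Y.ρ a v.2) := rfl

lemma sumRep_cont : WeakCont (sumRep X Y) := fun v φ => by
  have : (fun a => φ (sumRep X Y a v)) = fun a =>
      (φ ∘ₗ LinearMap.inl ℂ X.V Y.V) (X.ρ a v.1) + (φ ∘ₗ LinearMap.inr ℂ X.V Y.V) (Y.ρ a v.2) := by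
    funext a
    rw [LinearMap.comp_apply, LinearMap.comp_apply, ← map_add, sumRep_apply]
    simp
  rw [this]
  exact (X.cont _ _).add (Y.cont _ _)

lemma sumRep_span : eigSpan (sumRep X Y (Bialg.h D)) = ⊤ := by
  rw [eq_top_iff]
  rintro ⟨v, w⟩ -
  have hv : v ∈ eigSpan (X.ρ (Bialg.h D)) := by rw [X.span]; trivial
  have hw : w ∈ eigSpan (Y.ρ (Bialg.h D)) := by rw [Y.span]; trivial
  have h1 : eigSpan (X.ρ (Bialg.h D)) ≤
      (eigSpan (sumRep X Y (Bialg.h D))).comap (LinearMap.inl ℂ X.V Y.V) :=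
    Submodule.span_le.2 fun v ⟨l, hl⟩ => Submodule.subset_span ⟨l, by
      rw [LinearMap.inl_apply, sumRep_apply, hl, map_zero, Prod.smul_mk, smul_zero]⟩
  have h2 : eigSpan (Y.ρ (Bialg.h D)) ≤
      (eigSpan (sumRep X Y (Bialg.h D))).comap (LinearMap.inr ℂ X.V Y.V) :=
    Submodule.span_le.2 fun v ⟨l, hl⟩ => Submodule.subset_span ⟨l, by
      rw [LinearMap.inr_apply, sumRep_apply, hl, map_zero, Prod.smul_mk, smul_zero]⟩
  have := Submodule.add_mem (eigSpan (sumRep X Y (Bialg.h D))) (Submodule.mem_comap.1 (h1 hv))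
    (Submodule.mem_comap.1 (h2 hw))
  rwa [LinearMap.inl_apply, LinearMap.inr_apply, Prod.mk_add_mk, add_zero, zero_add] at this

/-- The direct sum of representations. -/
def sum : Rep D := ofSpan (ModuleCat.of ℂ (X.V × Y.V)) (sumRep X Y) (sumRep_cont X Y)
  (sumRep_span X Y)

/-- The direct sum as a bicone. -/
def sumBicone : BinaryBicone X Y where
  pt := sum X Y
  fst := ⟨ModuleCat.ofHom (LinearMap.fst ℂ X.V Y.V), fun _ _ => rfl⟩
  snd := ⟨ModuleCat.ofHom (LinearMap.snd ℂ X.V Y.V), fun _ _ => rfl⟩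
  inl := ⟨ModuleCat.ofHom (LinearMap.inl ℂ X.V Y.V), fun a _ =>
    Prod.ext rfl (map_zero (Y.ρ a)).symm⟩
  inr := ⟨ModuleCat.ofHom (LinearMap.inr ℂ X.V Y.V), fun a _ =>
    Prod.ext (map_zero (X.ρ a)).symm rfl⟩
  inl_fst := rfl
  inl_snd := rfl
  inr_fst := rfl
  inr_snd := rfl

lemma sumBicone_total : (sumBicone X Y).fst ≫ (sumBicone X Y).inl +
    (sumBicone X Y).snd ≫ (sumBicone X Y).inr = 𝟙 (sumBicone X Y).pt :=
  hom_ext (ModuleCat.hom_ext (LinearMap.ext fun v => by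
    change ((v : X.V × Y.V).1, (0 : Y.V)) + ((0 : X.V), (v : X.V × Y.V).2) = v
    rw [Prod.mk_add_mk, add_zero, zero_add]; rfl))

end Sum

instance : HasBinaryBiproducts (Rep D) :=
  ⟨fun X Y => hasBinaryBiproduct_of_total (sumBicone X Y) (sumBicone_total X Y)⟩

end Additive

/-! ### The braiding -/

section Braiding
open TensorProduct

variable {V W U : Type} [AddCommGroup V] [Module ℂ V] [AddCommGroup W] [Module ℂ W]
  [AddCommGroup U] [Module ℂ U] {ρ : Bialg D →ₐ[ℂ] Module.End ℂ V}
  {σ : Bialg D →ₐ[ℂ] Module.End ℂ W} {τ : Bialg D →ₐ[ℂ] Module.End ℂ U}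
  (hρ : eigSpan (ρ (Bialg.h D)) = ⊤) (hσ : eigSpan (σ (Bialg.h D)) = ⊤)
  (hτ : eigSpan (τ (Bialg.h D)) = ⊤)

/-- The action of `e^{κ h ⊗ h}` followed by the flip. -/
def braidLin (κ : ℂ) : V ⊗[ℂ] W →ₗ[ℂ] W ⊗[ℂ] V :=
  (TensorProduct.comm ℂ V W).toLinearMap ∘ₗ tensorAct hρ hσ (Bialg₂.expHH D κ)

lemma braidLin_eig (κ : ℂ) {v : V} {w : W} {l m : ℂ} (hv : ρ (Bialg.h D) v = l • v)
    (hw : σ (Bialg.h D) w = m • w) :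
    braidLin hρ hσ κ (v ⊗ₜ w) = Complex.exp (κ * (l * m)) • w ⊗ₜ v := by
  rw [braidLin, LinearMap.comp_apply, tensorAct_expHH hρ hσ κ hv hw, map_smul]; rfl

lemma braidLin_inv (κ : ℂ) : braidLin hσ hρ (-κ) ∘ₗ braidLin hρ hσ κ = LinearMap.id :=
  tensor_ext hρ hσ fun v w l m hv hw => by
    rw [LinearMap.comp_apply, braidLin_eig hρ hσ κ hv hw, map_smul, braidLin_eig hσ hρ _ hw hv,
      smul_smul, ← Complex.exp_add, mul_comm m l, neg_mul, add_neg_cancel, Complex.exp_zero,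
      one_smul, LinearMap.id_apply]

lemma braidLin_h (κ : ℂ) : braidLin hρ hσ κ ∘ₗ tensorRep hρ hσ (Bialg.h D) =
    tensorRep hσ hρ (Bialg.h D) ∘ₗ braidLin hρ hσ κ :=
  tensor_ext hρ hσ fun v w l m hv hw => by
    rw [LinearMap.comp_apply, LinearMap.comp_apply, tensorRep_h_eig hρ hσ hv hw, map_smul,
      braidLin_eig hρ hσ κ hv hw, map_smul, tensorRep_h_eig hσ hρ hw hv, add_comm m l, smul_comm]

lemma braidLin_fwd (κ : ℂ) : (TensorProduct.assoc ℂ W U V).toLinearMap ∘ₗ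
      braidLin hρ (tensorRep_span hσ hτ) κ ∘ₗ (TensorProduct.assoc ℂ V W U).toLinearMap =
    (TensorProduct.map LinearMap.id (braidLin hρ hτ κ) ∘ₗ
      (TensorProduct.assoc ℂ W V U).toLinearMap) ∘ₗ
      TensorProduct.map (braidLin hρ hσ κ) LinearMap.id :=
  tensor_ext₃ hρ hσ hτ fun u v w l m n hu hv hw => by
    simp only [LinearMap.comp_apply, LinearEquiv.coe_coe, TensorProduct.assoc_tmul,
      TensorProduct.map_tmul, LinearMap.id_apply]
    rw [braidLin_eig hρ (tensorRep_span hσ hτ) κ hu (tensorRep_h_eig hσ hτ hv hw),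
      braidLin_eig hρ hσ κ hu hv]
    simp only [← smul_tmul', map_smul, TensorProduct.assoc_tmul, TensorProduct.map_tmul,
      LinearMap.id_apply]
    rw [braidLin_eig hρ hτ κ hu hw, tmul_smul, smul_smul, ← Complex.exp_add]
    congr 2
    ring

lemma braidLin_rev (κ : ℂ) : (TensorProduct.assoc ℂ U V W).symm.toLinearMap ∘ₗ
      braidLin (tensorRep_span hρ hσ) hτ κ ∘ₗ (TensorProduct.assoc ℂ V W U).symm.toLinearMap =
    (TensorProduct.map (braidLin hρ hτ κ) LinearMap.id ∘ₗ
      (TensorProduct.assoc ℂ V U W).symm.toLinearMap) ∘ₗ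
      TensorProduct.map LinearMap.id (braidLin hσ hτ κ) := by
  rw [← LinearMap.cancel_right (g := (TensorProduct.assoc ℂ V W U).toLinearMap)
    (TensorProduct.assoc ℂ V W U).surjective]
  refine tensor_ext₃ hρ hσ hτ fun u v w l m n hu hv hw => ?_
  simp only [LinearMap.comp_apply, LinearEquiv.coe_coe, TensorProduct.assoc_tmul,
    TensorProduct.map_tmul, LinearMap.id_apply, TensorProduct.assoc_symm_tmul]
  rw [braidLin_eig (tensorRep_span hρ hσ) hτ κ (tensorRep_h_eig hρ hσ hu hv) hw,
    braidLin_eig hσ hτ κ hv hw]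
  simp only [tmul_smul, map_smul, TensorProduct.assoc_symm_tmul, TensorProduct.map_tmul,
    LinearMap.id_apply]
  rw [braidLin_eig hρ hτ κ hu hw, ← smul_tmul', smul_smul, ← Complex.exp_add]
  congr 2
  ring

end Braiding
end Rep

/-- The category `C` of semisimple representations of `A = E(h; 0)`, with `R = e^{κ h ⊗ h}`. -/
def Cat (_κ : ℂ) : Type 1 := Rep Datum.empty

namespace Cat
variable (κ : ℂ)

instance : Category (Cat κ) := inferInstanceAs (Category (Rep Datum.empty))
instance : MonoidalCategory (Cat κ) := inferInstanceAs (MonoidalCategory (Rep Datum.empty))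
instance : Preadditive (Cat κ) := inferInstanceAs (Preadditive (Rep Datum.empty))
instance : MonoidalPreadditive (Cat κ) := inferInstanceAs (MonoidalPreadditive (Rep Datum.empty))
instance : HasBinaryBiproducts (Cat κ) := inferInstanceAs (HasBinaryBiproducts (Rep Datum.empty))

variable {κ}

/-- The action of `R` followed by the flip. -/
def braidHom (X Y : Rep Datum.empty) : Rep.tensor X Y ⟶ Rep.tensor Y X :=
  Rep.mkHom (ModuleCat.ofHom (Rep.braidLin X.span Y.span κ)) (Rep.braidLin_h X.span Y.span κ)
    (fun j => j.elim)

variable (κ) in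
/-- The underlying linear isomorphism of the braiding. -/
def braidLinIso (X Y : Rep Datum.empty) : (Rep.tensor X Y).V ≅ (Rep.tensor Y X).V where
  hom := ModuleCat.ofHom (Rep.braidLin X.span Y.span κ)
  inv := ModuleCat.ofHom (Rep.braidLin Y.span X.span (-κ))
  hom_inv_id := ModuleCat.hom_ext (Rep.braidLin_inv X.span Y.span κ)
  inv_hom_id := ModuleCat.hom_ext (by
    have := Rep.braidLin_inv Y.span X.span (-κ)
    rwa [neg_neg] at this)

/-- The braiding `τ ∘ R`. -/
def braid (X Y : Rep Datum.empty) : Rep.tensor X Y ≅ Rep.tensor Y X :=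
  Rep.mkIso (braidLinIso κ X Y) (braidHom X Y) rfl

lemma braid_natural {X X' Y Y' : Rep Datum.empty} (f : X ⟶ X') (g : Y ⟶ Y') :
    Rep.tensorMap f g ≫ braidHom (κ := κ) X' Y' = braidHom (κ := κ) X Y ≫ Rep.tensorMap g f :=
  Rep.hom_ext (ModuleCat.hom_ext (tensor_ext X.span Y.span fun v w l m hv hw => by
    change Rep.braidLin X'.span Y'.span κ (TensorProduct.tmul ℂ (f.hom.hom v) (g.hom.hom w)) =
      TensorProduct.map g.hom.hom f.hom.hom
        (Rep.braidLin X.span Y.span κ (TensorProduct.tmul ℂ v w))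
    rw [Rep.braidLin_eig X.span Y.span κ hv hw,
      Rep.braidLin_eig X'.span Y'.span κ (Rep.eig_hom f hv) (Rep.eig_hom g hw), map_smul]
    rfl))

instance : BraidedCategory (Cat κ) where
  braiding X Y := braid (κ := κ) X Y
  braiding_naturality_right X _ _ f := braid_natural (𝟙 X) f
  braiding_naturality_left f Z := braid_natural f (𝟙 Z)
  hexagon_forward X Y Z := Rep.hom_ext (ModuleCat.hom_ext
    (Rep.braidLin_fwd (Rep.span X) (Rep.span Y) (Rep.span Z) κ))
  hexagon_reverse X Y Z := Rep.hom_ext (ModuleCat.hom_ext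
    (Rep.braidLin_rev (Rep.span X) (Rep.span Y) (Rep.span Z) κ))

/-- The action of the generators on `ℂ_α`. -/
def charGen (α : ℂ) : Unit ⊕ Datum.empty.X → Module.End ℂ ℂ
  | Sum.inl _ => algebraMap ℂ _ α
  | Sum.inr j => j.elim

lemma charGen_good (α : ℂ) (v : ℂ) : Good (Word.lift (charGen α) fun _ _ => rfl) v :=
  good_of_weight (charGen α) (fun _ _ => rfl) (fun j => j.elim) (fun _ j => j.elim) v
    (fun _ => ⟨α, rfl⟩)

/-- The action of `A` on `ℂ_α`. -/
def charRep (α : ℂ) : AlgA →ₐ[ℂ] Module.End ℂ ℂ :=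
  TopQuot.lift (weakExt (charGen_good α)) (weakExt_cont (charGen_good α)).isClosed_ker
    (by rintro _ ⟨j, _⟩; exact j.elim)

lemma charRep_cont (α : ℂ) : WeakCont (charRep α) := fun v φ =>
  TopQuot.continuous_iff.2 (weakExt_cont (charGen_good α) v φ)

lemma charRep_h (α : ℂ) : charRep α (Bialg.h _) = algebraMap ℂ _ α :=
  (TopQuot.lift_mk _ _ _ _).trans ((weakExt_of _ _).trans (Word.lift_gen _ _ _))

/-- The one-dimensional representation `ℂ_α` on which `h` acts by `α`. -/
def char (α : ℂ) : Cat κ :=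
  Rep.ofSpan (ModuleCat.of ℂ ℂ) (charRep α) (charRep_cont α) (by
    rw [eq_top_iff]
    intro v _
    exact Submodule.subset_span ⟨α, by rw [charRep_h]; rfl⟩)

end Cat

/-! ### Shuffles in monoidal categories -/

section Shuffle
universe v u
variable {C : Type u} [Category.{v} C] [MonoidalCategory C]

/-- The morphism which moves `s` past `X` using `b`. -/
def shuf (t : C) {s X : C} (b : s ⊗ X ⟶ X ⊗ s) (Y : C) :
    (t ⊗ s) ⊗ (X ⊗ Y) ⟶ (t ⊗ X) ⊗ (s ⊗ Y) :=
  (α_ t s (X ⊗ Y)).hom ≫ t ◁ (α_ s X Y).inv ≫ t ◁ (b ▷ Y) ≫ t ◁ (α_ X s Y).hom ≫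
    (α_ t X (s ⊗ Y)).inv

/-- Moving a tensor product past an object. -/
def bTensor {p q X : C} (bp : p ⊗ X ⟶ X ⊗ p) (bq : q ⊗ X ⟶ X ⊗ q) :
    (p ⊗ q) ⊗ X ⟶ X ⊗ (p ⊗ q) :=
  (α_ p q X).hom ≫ p ◁ bq ≫ (α_ p X q).inv ≫ bp ▷ q ≫ (α_ X p q).hom

/-- Moving an object past a tensor product. -/
def bObj {p X Y : C} (bX : p ⊗ X ⟶ X ⊗ p) (bY : p ⊗ Y ⟶ Y ⊗ p) :
    p ⊗ (X ⊗ Y) ⟶ (X ⊗ Y) ⊗ p :=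
  (α_ p X Y).inv ≫ bX ▷ Y ≫ (α_ X p Y).hom ≫ X ◁ bY ≫ (α_ X Y p).inv

lemma shuf_left {t t' s s' X : C} {b : s ⊗ X ⟶ X ⊗ s} {b' : s' ⊗ X ⟶ X ⊗ s'} (f : t ⟶ t')
    (g : s ⟶ s') (h : g ▷ X ≫ b' = b ≫ X ◁ g) (Y : C) :
    (f ⊗ₘ g) ▷ (X ⊗ Y) ≫ shuf t' b' Y = shuf t b Y ≫ (f ▷ X ⊗ₘ g ▷ Y) := by
  simp only [shuf, MonoidalCategory.tensorHom_def]
  calc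
    _ = 𝟙 _ ⊗≫ f ▷ ((s ⊗ X) ⊗ Y) ⊗≫ t' ◁ ((g ▷ X ≫ b') ▷ Y) ⊗≫ 𝟙 _ := by monoidal
    _ = 𝟙 _ ⊗≫ (f ▷ ((s ⊗ X) ⊗ Y) ≫ t' ◁ (b ▷ Y)) ⊗≫ t' ◁ X ◁ g ▷ Y ⊗≫ 𝟙 _ := by
      rw [h]; monoidal
    _ = _ := by rw [← whisker_exchange]; monoidal

lemma shuf_right {t s X X' Y Y' : C} {b : s ⊗ X ⟶ X ⊗ s} {b' : s ⊗ X' ⟶ X' ⊗ s} (f : X ⟶ X')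
    (g : Y ⟶ Y') (h : s ◁ f ≫ b' = b ≫ f ▷ s) :
    (t ⊗ s) ◁ (f ⊗ₘ g) ≫ shuf t b' Y' = shuf t b Y ≫ (t ◁ f ⊗ₘ s ◁ g) := by
  simp only [shuf, MonoidalCategory.tensorHom_def']
  calc
    _ = 𝟙 _ ⊗≫ (t ⊗ s ⊗ X) ◁ g ⊗≫ t ◁ ((s ◁ f ≫ b') ▷ Y') ⊗≫ 𝟙 _ := by monoidal
    _ = 𝟙 _ ⊗≫ t ◁ ((s ⊗ X) ◁ g ≫ b ▷ Y') ⊗≫ t ◁ f ▷ s ▷ Y' ⊗≫ 𝟙 _ := by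
      rw [h]; monoidal
    _ = _ := by rw [whisker_exchange]; monoidal

lemma shuf_mul {t₁ t₂ t₃ t₄ X : C} (c : t₂ ⊗ t₃ ⟶ t₃ ⊗ t₂) (b₂ : t₂ ⊗ X ⟶ X ⊗ t₂)
    (b₄ : t₄ ⊗ X ⟶ X ⊗ t₄) (Y : C) :
    shuf t₁ c t₄ ▷ (X ⊗ Y) ≫ shuf (t₁ ⊗ t₃) (bTensor b₂ b₄) Y ≫
      ((α_ t₁ t₃ X).hom ⊗ₘ (α_ t₂ t₄ Y).hom) =
    (α_ (t₁ ⊗ t₂) (t₃ ⊗ t₄) (X ⊗ Y)).hom ≫ (t₁ ⊗ t₂) ◁ shuf t₃ b₄ Y ≫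
      shuf t₁ (bObj c b₂) (t₄ ⊗ Y) := by
  simp only [shuf, bTensor, bObj, MonoidalCategory.tensorHom_def]
  calc
    _ = 𝟙 _ ⊗≫ t₁ ◁ (c ▷ (t₄ ⊗ X) ≫ (t₃ ⊗ t₂) ◁ b₄) ▷ Y ⊗≫
        t₁ ◁ t₃ ◁ b₂ ▷ t₄ ▷ Y ⊗≫ 𝟙 _ := by monoidal
    _ = _ := by rw [← whisker_exchange]; monoidal

lemma shuf_assoc {p q r X Y : C} (bq : q ⊗ X ⟶ X ⊗ q) (br : r ⊗ X ⟶ X ⊗ r)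
    (br' : r ⊗ Y ⟶ Y ⊗ r) (Z : C) :
    shuf (p ⊗ q) (bObj br br') Z ≫ shuf p bq Y ▷ (r ⊗ Z) ≫
      (α_ (p ⊗ X) (q ⊗ Y) (r ⊗ Z)).hom =
    (α_ p q r).hom ▷ ((X ⊗ Y) ⊗ Z) ≫ (p ⊗ (q ⊗ r)) ◁ (α_ X Y Z).hom ≫
      shuf p (bTensor bq br) (Y ⊗ Z) ≫ (p ⊗ X) ◁ shuf q br' Z := by
  simp only [shuf, bTensor, bObj]
  calc
    _ = 𝟙 _ ⊗≫ p ◁ q ◁ br ▷ Y ▷ Z ⊗≫ p ◁ ((q ⊗ X) ◁ br' ≫ bq ▷ (Y ⊗ r)) ▷ Z ⊗≫ 𝟙 _ := by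
      monoidal
    _ = _ := by rw [whisker_exchange]; monoidal

end Shuffle

section Cats
universe v u
variable {C : Type u} [Category.{v} C] [MonoidalCategory C]

/-- The half-braiding as a morphism of `C`. -/
abbrev hb (F : Center C) (X : C) : F.1 ⊗ X ⟶ X ⊗ F.1 := (F.2.β X).hom

lemma hb_obj (F : Center C) (X Y : C) : hb F (X ⊗ Y) = bObj (hb F X) (hb F Y) := F.2.monoidal X Y

lemma hb_unit (F : Center C) : hb F (𝟙_ C) = (ρ_ F.1).hom ≫ (λ_ F.1).inv := by
  have h := congrArg Center.Hom.f (braiding_tensorUnit_right F)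
  rw [Center.comp_f, Center.rightUnitor_hom_f, Center.leftUnitor_inv_f] at h
  exact h

lemma hb_nat (F : Center C) {X Y : C} (f : X ⟶ Y) : F.1 ◁ f ≫ hb F Y = hb F X ≫ f ▷ F.1 :=
  F.2.naturality f

/-! ### The category `C_F` -/

section Pert

/-- Objects of `C_F`: pairs of an object `X` and a morphism `F ⊗ X ⟶ X`. -/
structure Pert (F : Center C) where
  X : C
  m : F.1 ⊗ X ⟶ X

namespace Pert
variable {F : Center C}

/-- Morphisms of `C_F`. -/
@[ext] structure Hom (M N : Pert F) where
  hom : M.X ⟶ N.X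
  comm : M.m ≫ hom = F.1 ◁ hom ≫ N.m

instance : Category (Pert F) where
  Hom M N := Hom M N
  id M := ⟨𝟙 M.X, by simp⟩
  comp f g := ⟨f.hom ≫ g.hom, by
    rw [← Category.assoc, f.comm, Category.assoc, g.comm, MonoidalCategory.whiskerLeft_comp,
      Category.assoc]⟩

@[ext] lemma hom_ext {M N : Pert F} {f g : M ⟶ N} (h : f.hom = g.hom) : f = g := Hom.ext h
@[simp] lemma id_hom (M : Pert F) : (𝟙 M : M ⟶ M).hom = 𝟙 M.X := rfl
@[simp] lemma comp_hom {M N P : Pert F} (f : M ⟶ N) (g : N ⟶ P) :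
    (f ≫ g).hom = f.hom ≫ g.hom := rfl

variable (F) in
/-- The forgetful functor `C_F ⥤ C`. -/
def forget : Pert F ⥤ C where
  obj M := M.X
  map f := f.hom

instance : (forget F).Faithful := ⟨fun h => hom_ext h⟩

/-- Isomorphisms of `C_F`. -/
def mkIso {M N : Pert F} (e : M.X ≅ N.X) (h : M.m ≫ e.hom = F.1 ◁ e.hom ≫ N.m) : M ≅ N where
  hom := ⟨e.hom, h⟩
  inv := ⟨e.inv, by
    rw [← cancel_mono e.hom, Category.assoc, Category.assoc, e.inv_hom_id, h,
      ← MonoidalCategory.whiskerLeft_comp_assoc, e.inv_hom_id]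
    simp⟩
  hom_inv_id := hom_ext e.hom_inv_id
  inv_hom_id := hom_ext e.inv_hom_id

variable [Preadditive C]

/-- The morphism `(m ⊗ id + (id ⊗ n) ∘ α ∘ (φ_{F,X} ⊗ id)) ∘ α⁻¹` which defines the tensor product
of `C_F`. -/
def tp (F : Center C) {X Y : C} (m : F.1 ⊗ X ⟶ X) (n : F.1 ⊗ Y ⟶ Y) : F.1 ⊗ (X ⊗ Y) ⟶ X ⊗ Y :=
  (α_ F.1 X Y).inv ≫ (m ▷ Y + hb F X ▷ Y ≫ (α_ X F.1 Y).hom ≫ X ◁ n)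

/-- The tensor product. -/
def tensor (M N : Pert F) : Pert F := ⟨M.X ⊗ N.X, tp F M.m N.m⟩

variable [MonoidalPreadditive C]

/-- The tensor product of morphisms. -/
def tensorMap {M N M' N' : Pert F} (f : M ⟶ M') (g : N ⟶ N') : tensor M N ⟶ tensor M' N' :=
  ⟨f.hom ⊗ₘ g.hom, by
    change tp F M.m N.m ≫ (f.hom ⊗ₘ g.hom) = F.1 ◁ (f.hom ⊗ₘ g.hom) ≫ tp F M'.m N'.m
    have h1 : (α_ F.1 M.X N.X).inv ≫ M.m ▷ N.X ≫ (f.hom ⊗ₘ g.hom) =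
        F.1 ◁ (f.hom ⊗ₘ g.hom) ≫ (α_ F.1 M'.X N'.X).inv ≫ M'.m ▷ N'.X := by
      simp only [MonoidalCategory.tensorHom_def]
      calc
        _ = 𝟙 _ ⊗≫ (M.m ≫ f.hom) ▷ N.X ⊗≫ M'.X ◁ g.hom := by monoidal
        _ = 𝟙 _ ⊗≫ (F.1 ◁ f.hom) ▷ N.X ⊗≫ (M'.m ▷ N.X ≫ M'.X ◁ g.hom) := by
          rw [f.comm]; monoidal
        _ = _ := by rw [← whisker_exchange]; monoidal
    have h2 : (α_ F.1 M.X N.X).inv ≫ hb F M.X ▷ N.X ≫ (α_ M.X F.1 N.X).hom ≫ M.X ◁ N.m ≫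
          (f.hom ⊗ₘ g.hom) =
        F.1 ◁ (f.hom ⊗ₘ g.hom) ≫ (α_ F.1 M'.X N'.X).inv ≫ hb F M'.X ▷ N'.X ≫
          (α_ M'.X F.1 N'.X).hom ≫ M'.X ◁ N'.m := by
      simp only [MonoidalCategory.tensorHom_def]
      calc
        _ = 𝟙 _ ⊗≫ hb F M.X ▷ N.X ⊗≫ (M.X ◁ N.m ≫ f.hom ▷ N.X) ⊗≫ M'.X ◁ g.hom := by monoidal
        _ = 𝟙 _ ⊗≫ (hb F M.X ≫ f.hom ▷ F.1) ▷ N.X ⊗≫ M'.X ◁ (N.m ≫ g.hom) := by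
          rw [whisker_exchange]; monoidal
        _ = 𝟙 _ ⊗≫ F.1 ◁ f.hom ▷ N.X ⊗≫ (hb F M'.X ▷ N.X ≫ (M'.X ⊗ F.1) ◁ g.hom) ⊗≫
            M'.X ◁ N'.m := by rw [← hb_nat, g.comm]; monoidal
        _ = _ := by rw [← whisker_exchange]; monoidal
    simp only [tp, Preadditive.comp_add, Preadditive.add_comp, Category.assoc]
    rw [h1, h2]⟩

/-- The unit object. -/
def unit (F : Center C) : Pert F := ⟨𝟙_ C, 0⟩

/-- The associator of `C`. -/
def assocIso (M N P : Pert F) : tensor (tensor M N) P ≅ tensor M (tensor N P) :=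
  mkIso (α_ M.X N.X P.X) (by
    change tp F (tp F M.m N.m) P.m ≫ _ = _ ≫ tp F M.m (tp F N.m P.m)
    have h1 : (α_ F.1 (M.X ⊗ N.X) P.X).inv ≫ (α_ F.1 M.X N.X).inv ▷ P.X ≫ M.m ▷ N.X ▷ P.X ≫
          (α_ M.X N.X P.X).hom =
        F.1 ◁ (α_ M.X N.X P.X).hom ≫ (α_ F.1 M.X (N.X ⊗ P.X)).inv ≫ M.m ▷ (N.X ⊗ P.X) := by
      monoidal
    have h2 : (α_ F.1 (M.X ⊗ N.X) P.X).inv ≫ (α_ F.1 M.X N.X).inv ▷ P.X ≫ hb F M.X ▷ N.X ▷ P.X ≫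
          (α_ M.X F.1 N.X).hom ▷ P.X ≫ (M.X ◁ N.m) ▷ P.X ≫ (α_ M.X N.X P.X).hom =
        F.1 ◁ (α_ M.X N.X P.X).hom ≫ (α_ F.1 M.X (N.X ⊗ P.X)).inv ≫ hb F M.X ▷ (N.X ⊗ P.X) ≫
          (α_ M.X F.1 (N.X ⊗ P.X)).hom ≫ M.X ◁ (α_ F.1 N.X P.X).inv ≫ M.X ◁ (N.m ▷ P.X) := by
      monoidal
    have h3 : (α_ F.1 (M.X ⊗ N.X) P.X).inv ≫ hb F (M.X ⊗ N.X) ▷ P.X ≫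
          (α_ (M.X ⊗ N.X) F.1 P.X).hom ≫ (M.X ⊗ N.X) ◁ P.m ≫ (α_ M.X N.X P.X).hom =
        F.1 ◁ (α_ M.X N.X P.X).hom ≫ (α_ F.1 M.X (N.X ⊗ P.X)).inv ≫ hb F M.X ▷ (N.X ⊗ P.X) ≫
          (α_ M.X F.1 (N.X ⊗ P.X)).hom ≫ M.X ◁ (α_ F.1 N.X P.X).inv ≫
            M.X ◁ (hb F N.X ▷ P.X) ≫ M.X ◁ (α_ N.X F.1 P.X).hom ≫ M.X ◁ (N.X ◁ P.m) := by
      rw [hb_obj, bObj]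
      monoidal
    simp only [tp, Preadditive.comp_add, Preadditive.add_comp, Category.assoc, comp_whiskerRight,
      MonoidalPreadditive.add_whiskerRight, MonoidalPreadditive.whiskerLeft_add,
      MonoidalCategory.whiskerLeft_comp]
    rw [h1, h2, h3, add_assoc]
    exact ((Preadditive.comp_add _ _ _ _ _ _).trans
      (congrArg _ (Preadditive.comp_add _ _ _ _ _ _))).symm)

/-- The left unitor of `C`. -/
def leftIso (M : Pert F) : tensor (unit F) M ≅ M :=
  mkIso (λ_ M.X) (by
    change tp F (0 : F.1 ⊗ 𝟙_ C ⟶ 𝟙_ C) M.m ≫ _ = _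
    simp only [tp, MonoidalPreadditive.zero_whiskerRight, zero_add, hb_unit]
    monoidal)

/-- The right unitor of `C`. -/
def rightIso (M : Pert F) : tensor M (unit F) ≅ M :=
  mkIso (ρ_ M.X) (by
    change tp F M.m (0 : F.1 ⊗ 𝟙_ C ⟶ 𝟙_ C) ≫ _ = _
    simp only [tp, MonoidalPreadditive.whiskerLeft_zero, Limits.comp_zero, add_zero]
    monoidal)

instance : MonoidalCategoryStruct (Pert F) where
  tensorObj M N := tensor M N
  tensorUnit := unit F
  tensorHom f g := tensorMap f g
  whiskerLeft M _ _ f := tensorMap (𝟙 M) f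
  whiskerRight f N := tensorMap f (𝟙 N)
  associator M N P := assocIso M N P
  leftUnitor M := leftIso M
  rightUnitor M := rightIso M

/-- The monoidal structure is the one of `C`. -/
def forgetData (F : Center C) : Monoidal.InducingFunctorData (forget F) where
  μIso X Y := Iso.refl _
  εIso := Iso.refl _
  whiskerLeft_eq M _ _ f := by
    change 𝟙 M.X ⊗ₘ f.hom = 𝟙 _ ≫ (M.X ◁ f.hom) ≫ 𝟙 _
    rw [id_tensorHom, Category.comp_id, Category.id_comp]
  whiskerRight_eq f N := by
    change f.hom ⊗ₘ 𝟙 N.X = 𝟙 _ ≫ (f.hom ▷ N.X) ≫ 𝟙 _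
    rw [tensorHom_id, Category.comp_id, Category.id_comp]
  tensorHom_eq f g := by
    change f.hom ⊗ₘ g.hom = 𝟙 _ ≫ (f.hom ⊗ₘ g.hom) ≫ 𝟙 _
    rw [Category.comp_id, Category.id_comp]
  associator_eq M N P := by
    change (α_ M.X N.X P.X).hom = ((𝟙 _ ≫ (𝟙 _ ⊗ₘ 𝟙 _)) ≫ (α_ M.X N.X P.X).hom ≫
      (𝟙 _ ⊗ₘ 𝟙 _) ≫ 𝟙 _)
    simp
  leftUnitor_eq M := by
    change (λ_ M.X).hom = (𝟙 _ ≫ (𝟙 _ ⊗ₘ 𝟙 _)) ≫ (λ_ M.X).hom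
    simp
  rightUnitor_eq M := by
    change (ρ_ M.X).hom = (𝟙 _ ≫ (𝟙 _ ⊗ₘ 𝟙 _)) ≫ (ρ_ M.X).hom
    simp

instance : MonoidalCategory (Pert F) := Monoidal.induced (forget F) (forgetData F)

end Pert
end Pert

/-! ### Modules over a bialgebra in the centre -/

section Mod
open MonObj ComonObj

section Bimon
variable (T : Center C) [BimonObj T]

/-- The underlying morphism of the multiplication. -/
def mulF : T.1 ⊗ T.1 ⟶ T.1 := (μ[T] : T ⊗ T ⟶ T).f
/-- The underlying morphism of the unit. -/
def oneF : 𝟙_ C ⟶ T.1 := (η[T] : 𝟙_ (Center C) ⟶ T).f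
/-- The underlying morphism of the comultiplication. -/
def comulF : T.1 ⟶ T.1 ⊗ T.1 := (Δ[T] : T ⟶ T ⊗ T).f
/-- The underlying morphism of the counit. -/
def counitF : T.1 ⟶ 𝟙_ C := (ε[T] : T ⟶ 𝟙_ (Center C)).f

lemma mulF_comm (U : C) :
    mulF T ▷ U ≫ hb T U = bTensor (hb T U) (hb T U) ≫ U ◁ mulF T := by
  have h := (μ[T] : T ⊗ T ⟶ T).comm U
  rw [Center.tensor_β] at h
  exact h

lemma oneF_comm (U : C) :
    oneF T ▷ U ≫ hb T U = ((λ_ U).hom ≫ (ρ_ U).inv) ≫ U ◁ oneF T := by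
  have h := (η[T] : 𝟙_ (Center C) ⟶ T).comm U
  rw [Center.tensorUnit_β] at h
  exact h

lemma comulF_comm (U : C) :
    comulF T ▷ U ≫ bTensor (hb T U) (hb T U) = hb T U ≫ U ◁ comulF T := by
  have h := (Δ[T] : T ⟶ T ⊗ T).comm U
  rw [Center.tensor_β] at h
  exact h

lemma counitF_comm (U : C) :
    counitF T ▷ U ≫ (λ_ U).hom ≫ (ρ_ U).inv = hb T U ≫ U ◁ counitF T := by
  have h := (ε[T] : T ⟶ 𝟙_ (Center C)).comm U
  rw [Center.tensorUnit_β] at h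
  exact h

lemma mulF_comulF : mulF T ≫ comulF T =
    (comulF T ⊗ₘ comulF T) ≫ shuf T.1 (hb T T.1) T.1 ≫ (mulF T ⊗ₘ mulF T) := by
  have h := congrArg Center.Hom.f (BimonObj.mul_comul T)
  simp only [tensorμ, Center.comp_f, Center.tensor_f, Center.whiskerLeft_f, Center.whiskerRight_f,
    Center.associator_hom_f, Center.associator_inv_f] at h
  exact h

lemma oneF_comulF : oneF T ≫ comulF T = (λ_ (𝟙_ C)).inv ≫ (oneF T ⊗ₘ oneF T) := by
  have h := congrArg Center.Hom.f (BimonObj.one_comul T)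
  simp only [MonObj.tensorObj.one_def, Center.comp_f, Center.tensor_f, Center.leftUnitor_inv_f] at h
  exact h

lemma mulF_counitF : mulF T ≫ counitF T = (counitF T ⊗ₘ counitF T) ≫ (λ_ (𝟙_ C)).hom := by
  have h := congrArg Center.Hom.f (BimonObj.mul_counit T)
  rw [Comon.tensorObj_counit, Center.comp_f, Center.comp_f, Center.tensor_f,
    Center.leftUnitor_hom_f] at h
  exact h

lemma oneF_counitF : oneF T ≫ counitF T = 𝟙 (𝟙_ C) :=
  congrArg Center.Hom.f (BimonObj.one_counit T)

lemma comulF_assoc : comulF T ≫ comulF T ▷ T.1 ≫ (α_ T.1 T.1 T.1).hom =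
    comulF T ≫ T.1 ◁ comulF T := by
  have h := congrArg Center.Hom.f (ComonObj.comul_assoc T).symm
  simp only [Center.comp_f, Center.whiskerLeft_f, Center.whiskerRight_f,
    Center.associator_hom_f] at h
  exact h

lemma counitF_comulF : comulF T ≫ counitF T ▷ T.1 = (λ_ T.1).inv := by
  have h := congrArg Center.Hom.f (ComonObj.counit_comul T)
  simp only [Center.comp_f, Center.whiskerRight_f, Center.leftUnitor_inv_f] at h
  exact h

lemma comulF_counitF : comulF T ≫ T.1 ◁ counitF T = (ρ_ T.1).inv := by
  have h := congrArg Center.Hom.f (ComonObj.comul_counit T)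
  simp only [Center.comp_f, Center.whiskerLeft_f, Center.rightUnitor_inv_f] at h
  exact h

end Bimon

/-- Modules in `C` over (the underlying algebra in `C` of) a bialgebra in the centre of `C`. -/
structure TMod (T : Center C) [BimonObj T] where
  X : C
  act : T.1 ⊗ X ⟶ X
  one_act : oneF T ▷ X ≫ act = (λ_ X).hom
  mul_act : mulF T ▷ X ≫ act = (α_ T.1 T.1 X).hom ≫ T.1 ◁ act ≫ act

namespace TMod
variable {T : Center C} [BimonObj T]

/-- Morphisms of modules. -/
@[ext] structure Hom (M N : TMod T) where
  hom : M.X ⟶ N.X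
  comm : M.act ≫ hom = T.1 ◁ hom ≫ N.act

instance : Category (TMod T) where
  Hom M N := Hom M N
  id M := ⟨𝟙 M.X, by simp⟩
  comp f g := ⟨f.hom ≫ g.hom, by
    rw [← Category.assoc, f.comm, Category.assoc, g.comm, MonoidalCategory.whiskerLeft_comp,
      Category.assoc]⟩

@[ext] lemma hom_ext {M N : TMod T} {f g : M ⟶ N} (h : f.hom = g.hom) : f = g := Hom.ext h
@[simp] lemma id_hom (M : TMod T) : (𝟙 M : M ⟶ M).hom = 𝟙 M.X := rfl
@[simp] lemma comp_hom {M N P : TMod T} (f : M ⟶ N) (g : N ⟶ P) :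
    (f ≫ g).hom = f.hom ≫ g.hom := rfl

variable (T) in
/-- The forgetful functor. -/
def forget : TMod T ⥤ C where
  obj M := M.X
  map f := f.hom

instance : (forget T).Faithful := ⟨fun h => hom_ext h⟩

/-- Isomorphisms of modules. -/
def mkIso {M N : TMod T} (e : M.X ≅ N.X) (h : M.act ≫ e.hom = T.1 ◁ e.hom ≫ N.act) : M ≅ N where
  hom := ⟨e.hom, h⟩
  inv := ⟨e.inv, by
    rw [← cancel_mono e.hom, Category.assoc, Category.assoc, e.inv_hom_id, h,
      ← MonoidalCategory.whiskerLeft_comp_assoc, e.inv_hom_id]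
    simp⟩
  hom_inv_id := hom_ext e.hom_inv_id
  inv_hom_id := hom_ext e.inv_hom_id

/-- The action `(m ⊗ n) ∘ (id ⊗ φ_{T,X} ⊗ id) ∘ (Δ ⊗ id)` on a tensor product. -/
def tact (T : Center C) [BimonObj T] {X Y : C} (m : T.1 ⊗ X ⟶ X) (n : T.1 ⊗ Y ⟶ Y) :
    T.1 ⊗ (X ⊗ Y) ⟶ X ⊗ Y :=
  comulF T ▷ (X ⊗ Y) ≫ shuf T.1 (hb T X) Y ≫ (m ⊗ₘ n)

lemma tact_one {X Y : C} {m : T.1 ⊗ X ⟶ X} {n : T.1 ⊗ Y ⟶ Y}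
    (hm : oneF T ▷ X ≫ m = (λ_ X).hom) (hn : oneF T ▷ Y ≫ n = (λ_ Y).hom) :
    oneF T ▷ (X ⊗ Y) ≫ tact T m n = (λ_ (X ⊗ Y)).hom := by
  rw [tact, ← comp_whiskerRight_assoc, oneF_comulF, comp_whiskerRight_assoc,
    ← Category.assoc ((oneF T ⊗ₘ oneF T) ▷ (X ⊗ Y)), shuf_left _ _ (oneF_comm T X), Category.assoc,
    tensorHom_comp_tensorHom, hm, hn, shuf]
  simp only [MonoidalCategory.tensorHom_def]
  monoidal

lemma tact_mul {X Y : C} {m : T.1 ⊗ X ⟶ X} {n : T.1 ⊗ Y ⟶ Y}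
    (hm : mulF T ▷ X ≫ m = (α_ T.1 T.1 X).hom ≫ T.1 ◁ m ≫ m)
    (hn : mulF T ▷ Y ≫ n = (α_ T.1 T.1 Y).hom ≫ T.1 ◁ n ≫ n) :
    mulF T ▷ (X ⊗ Y) ≫ tact T m n =
      (α_ T.1 T.1 (X ⊗ Y)).hom ≫ T.1 ◁ tact T m n ≫ tact T m n := by
  have e1 : mulF T ▷ (X ⊗ Y) ≫ tact T m n =
      (comulF T ⊗ₘ comulF T) ▷ (X ⊗ Y) ≫ (shuf T.1 (hb T T.1) T.1 ▷ (X ⊗ Y) ≫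
        shuf (T.1 ⊗ T.1) (bTensor (hb T X) (hb T X)) Y ≫
        ((α_ T.1 T.1 X).hom ⊗ₘ (α_ T.1 T.1 Y).hom)) ≫
        (T.1 ◁ m ⊗ₘ T.1 ◁ n) ≫ (m ⊗ₘ n) := by
    rw [tact, ← comp_whiskerRight_assoc, mulF_comulF, comp_whiskerRight, comp_whiskerRight]
    simp only [Category.assoc]
    rw [← Category.assoc ((mulF T ⊗ₘ mulF T) ▷ (X ⊗ Y)), shuf_left _ _ (mulF_comm T X),
      Category.assoc, tensorHom_comp_tensorHom, hm, hn, tensorHom_comp_tensorHom,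
      tensorHom_comp_tensorHom]
  have e2 : T.1 ◁ tact T m n ≫ comulF T ▷ (X ⊗ Y) = comulF T ▷ (T.1 ⊗ X ⊗ Y) ≫
      (T.1 ⊗ T.1) ◁ comulF T ▷ (X ⊗ Y) ≫ (T.1 ⊗ T.1) ◁ shuf T.1 (hb T X) Y ≫
      (T.1 ⊗ T.1) ◁ (m ⊗ₘ n) := by
    rw [whisker_exchange, tact, MonoidalCategory.whiskerLeft_comp,
      MonoidalCategory.whiskerLeft_comp]
  have e3 : (comulF T ⊗ₘ comulF T) ▷ (X ⊗ Y) ≫ (α_ (T.1 ⊗ T.1) (T.1 ⊗ T.1) (X ⊗ Y)).hom =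
      (α_ T.1 T.1 (X ⊗ Y)).hom ≫ comulF T ▷ (T.1 ⊗ X ⊗ Y) ≫
        (T.1 ⊗ T.1) ◁ comulF T ▷ (X ⊗ Y) := by
    rw [MonoidalCategory.tensorHom_def]
    monoidal
  have e4 : shuf T.1 (hb T (T.1 ⊗ X)) (T.1 ⊗ Y) ≫ (T.1 ◁ m ⊗ₘ T.1 ◁ n) =
      (T.1 ⊗ T.1) ◁ (m ⊗ₘ n) ≫ shuf T.1 (hb T X) Y := (shuf_right m n (hb_nat T m)).symm
  rw [e1, shuf_mul, ← hb_obj]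
  conv_rhs => rw [tact.eq_1 T m n, ← Category.assoc (T.1 ◁ _), ← tact.eq_1 T m n, e2]
  simp only [Category.assoc]
  rw [← Category.assoc ((comulF T ⊗ₘ comulF T) ▷ (X ⊗ Y)), e3, ← Category.assoc (shuf _ _ (T.1 ⊗ Y)),
    e4]
  simp only [Category.assoc]

lemma tact_nat {X X' Y Y' : C} {m : T.1 ⊗ X ⟶ X} {n : T.1 ⊗ Y ⟶ Y} {m' : T.1 ⊗ X' ⟶ X'}
    {n' : T.1 ⊗ Y' ⟶ Y'} {f : X ⟶ X'} {g : Y ⟶ Y'} (hf : m ≫ f = T.1 ◁ f ≫ m')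
    (hg : n ≫ g = T.1 ◁ g ≫ n') :
    tact T m n ≫ (f ⊗ₘ g) = T.1 ◁ (f ⊗ₘ g) ≫ tact T m' n' := by
  rw [tact, tact, whisker_exchange_assoc, ← Category.assoc ((T.1 ⊗ T.1) ◁ (f ⊗ₘ g)),
    shuf_right f g (hb_nat T f)]
  simp only [Category.assoc, tensorHom_comp_tensorHom, hf, hg]

lemma tact_assoc {X Y Z : C} (m : T.1 ⊗ X ⟶ X) (n : T.1 ⊗ Y ⟶ Y) (p : T.1 ⊗ Z ⟶ Z) :
    tact T (tact T m n) p ≫ (α_ X Y Z).hom =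
      T.1 ◁ (α_ X Y Z).hom ≫ tact T m (tact T n p) := by
  have e1 : shuf T.1 (hb T (X ⊗ Y)) Z ≫ (comulF T ▷ (X ⊗ Y) ⊗ₘ 𝟙 (T.1 ⊗ Z)) =
      (comulF T ▷ T.1) ▷ ((X ⊗ Y) ⊗ Z) ≫ shuf (T.1 ⊗ T.1) (hb T (X ⊗ Y)) Z := by
    have := (shuf_left (b := hb T (X ⊗ Y)) (b' := hb T (X ⊗ Y)) (comulF T) (𝟙 T.1)
      (by simp) Z).symm
    simpa only [id_whiskerRight, tensorHom_id, id_tensorHom] using this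
  have e2 : shuf T.1 (hb T X) (Y ⊗ Z) ≫ (𝟙 (T.1 ⊗ X) ⊗ₘ comulF T ▷ (Y ⊗ Z)) =
      (T.1 ◁ comulF T) ▷ (X ⊗ Y ⊗ Z) ≫ shuf T.1 (bTensor (hb T X) (hb T X)) (Y ⊗ Z) := by
    have := (shuf_left (𝟙 T.1) (comulF T) (comulF_comm T X) (Y ⊗ Z)).symm
    simpa only [id_whiskerRight, tensorHom_id, id_tensorHom] using this
  have l1 : (tact T m n ⊗ₘ p) ≫ (α_ X Y Z).hom = (comulF T ▷ (X ⊗ Y) ⊗ₘ 𝟙 (T.1 ⊗ Z)) ≫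
      shuf T.1 (hb T X) Y ▷ (T.1 ⊗ Z) ≫ (α_ (T.1 ⊗ X) (T.1 ⊗ Y) (T.1 ⊗ Z)).hom ≫
        (m ⊗ₘ n ⊗ₘ p) := by
    rw [← associator_naturality, ← tensorHom_id (shuf _ _ _), tensorHom_comp_tensorHom_assoc,
      tensorHom_comp_tensorHom_assoc, tact]
    simp
  have l2 : (m ⊗ₘ tact T n p) = (𝟙 (T.1 ⊗ X) ⊗ₘ comulF T ▷ (Y ⊗ Z)) ≫
      (T.1 ⊗ X) ◁ shuf T.1 (hb T Y) Z ≫ (m ⊗ₘ n ⊗ₘ p) := by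
    rw [← id_tensorHom (T.1 ⊗ X), tensorHom_comp_tensorHom, tensorHom_comp_tensorHom, tact]
    simp
  rw [tact, Category.assoc, Category.assoc, l1, ← Category.assoc (shuf _ _ _), e1, hb_obj]
  have e3 := shuf_assoc (p := T.1) (hb T X) (hb T X) (hb T Y) Z
  calc
    _ = (comulF T ≫ comulF T ▷ T.1) ▷ ((X ⊗ Y) ⊗ Z) ≫
        (shuf (T.1 ⊗ T.1) (bObj (hb T X) (hb T Y)) Z ≫ shuf T.1 (hb T X) Y ▷ (T.1 ⊗ Z) ≫
        (α_ (T.1 ⊗ X) (T.1 ⊗ Y) (T.1 ⊗ Z)).hom) ≫ (m ⊗ₘ n ⊗ₘ p) := by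
      simp only [comp_whiskerRight, Category.assoc]
    _ = (comulF T ≫ comulF T ▷ T.1 ≫ (α_ T.1 T.1 T.1).hom) ▷ ((X ⊗ Y) ⊗ Z) ≫
        (T.1 ⊗ T.1 ⊗ T.1) ◁ (α_ X Y Z).hom ≫ shuf T.1 (bTensor (hb T X) (hb T X)) (Y ⊗ Z) ≫
        (T.1 ⊗ X) ◁ shuf T.1 (hb T Y) Z ≫ (m ⊗ₘ n ⊗ₘ p) := by
      rw [e3]
      simp only [comp_whiskerRight, Category.assoc]
    _ = T.1 ◁ (α_ X Y Z).hom ≫ comulF T ▷ (X ⊗ Y ⊗ Z) ≫ ((T.1 ◁ comulF T) ▷ (X ⊗ Y ⊗ Z) ≫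
        shuf T.1 (bTensor (hb T X) (hb T X)) (Y ⊗ Z)) ≫
        (T.1 ⊗ X) ◁ shuf T.1 (hb T Y) Z ≫ (m ⊗ₘ n ⊗ₘ p) := by
      rw [comulF_assoc, comp_whiskerRight, whisker_exchange_assoc]
      simp only [Category.assoc, whisker_exchange_assoc]
    _ = _ := by
      rw [← e2, tact, l2]
      simp only [Category.assoc]

variable (T) in
/-- The action on the unit object. -/
def uact : T.1 ⊗ 𝟙_ C ⟶ 𝟙_ C := (ρ_ T.1).hom ≫ counitF T

lemma uact_eq : uact T = counitF T ▷ 𝟙_ C ≫ (ρ_ (𝟙_ C)).hom := by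
  rw [uact, rightUnitor_naturality]

lemma uact_one : oneF T ▷ 𝟙_ C ≫ uact T = (λ_ (𝟙_ C)).hom := by
  rw [uact_eq, ← comp_whiskerRight_assoc, oneF_counitF, id_whiskerRight, Category.id_comp,
    unitors_equal]

lemma uact_mul : mulF T ▷ 𝟙_ C ≫ uact T =
    (α_ T.1 T.1 (𝟙_ C)).hom ≫ T.1 ◁ uact T ≫ uact T := by
  rw [uact_eq, ← comp_whiskerRight_assoc, mulF_counitF, MonoidalCategory.tensorHom_def]
  calc
    _ = 𝟙 _ ⊗≫ (counitF T ▷ T.1 ≫ 𝟙_ C ◁ counitF T) ⊗≫ 𝟙 _ := by monoidal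
    _ = _ := by rw [← whisker_exchange]; monoidal

lemma tact_left {X : C} (m : T.1 ⊗ X ⟶ X) :
    tact T (uact T) m ≫ (λ_ X).hom = T.1 ◁ (λ_ X).hom ≫ m := by
  have e1 : shuf T.1 (hb T (𝟙_ C)) X ≫ (counitF T ▷ 𝟙_ C ⊗ₘ 𝟙 (T.1 ⊗ X)) =
      (counitF T ▷ T.1) ▷ (𝟙_ C ⊗ X) ≫ shuf (𝟙_ C) (hb T (𝟙_ C)) X := by
    have := (shuf_left (b := hb T (𝟙_ C)) (b' := hb T (𝟙_ C)) (counitF T) (𝟙 T.1)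
      (by simp) X).symm
    simpa only [id_whiskerRight, tensorHom_id, id_tensorHom] using this
  have e2 : (uact T ⊗ₘ m) = (counitF T ▷ 𝟙_ C ⊗ₘ 𝟙 (T.1 ⊗ X)) ≫ ((ρ_ (𝟙_ C)).hom ⊗ₘ m) := by
    rw [tensorHom_comp_tensorHom, uact_eq, Category.id_comp]
  rw [tact, e2, ← Category.assoc (shuf _ _ _), e1]
  simp only [Category.assoc]
  rw [← comp_whiskerRight_assoc, counitF_comulF, hb_unit, shuf, MonoidalCategory.tensorHom_def]
  monoidal

lemma tact_right {X : C} (m : T.1 ⊗ X ⟶ X) :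
    tact T m (uact T) ≫ (ρ_ X).hom = T.1 ◁ (ρ_ X).hom ≫ m := by
  have e1 : shuf T.1 (hb T X) (𝟙_ C) ≫ (𝟙 (T.1 ⊗ X) ⊗ₘ counitF T ▷ 𝟙_ C) =
      (T.1 ◁ counitF T) ▷ (X ⊗ 𝟙_ C) ≫ shuf T.1 ((λ_ X).hom ≫ (ρ_ X).inv) (𝟙_ C) := by
    have := (shuf_left (𝟙 T.1) (counitF T) (counitF_comm T X) (𝟙_ C)).symm
    simpa only [id_whiskerRight, tensorHom_id, id_tensorHom] using this
  have e2 : (m ⊗ₘ uact T) = (𝟙 (T.1 ⊗ X) ⊗ₘ counitF T ▷ 𝟙_ C) ≫ (m ⊗ₘ (ρ_ (𝟙_ C)).hom) := by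
    rw [tensorHom_comp_tensorHom, uact_eq, Category.id_comp]
  rw [tact, e2, ← Category.assoc (shuf _ _ _), e1]
  simp only [Category.assoc]
  rw [← comp_whiskerRight_assoc, comulF_counitF, shuf, MonoidalCategory.tensorHom_def]
  monoidal

/-- The tensor product. -/
def tensor (M N : TMod T) : TMod T :=
  ⟨M.X ⊗ N.X, tact T M.act N.act, tact_one M.one_act N.one_act, tact_mul M.mul_act N.mul_act⟩

/-- The tensor product of morphisms. -/
def tensorMap {M N M' N' : TMod T} (f : M ⟶ M') (g : N ⟶ N') : tensor M N ⟶ tensor M' N' :=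
  ⟨f.hom ⊗ₘ g.hom, tact_nat f.comm g.comm⟩

variable (T) in
/-- The unit object. -/
def unit : TMod T := ⟨𝟙_ C, uact T, uact_one, uact_mul⟩

instance : MonoidalCategoryStruct (TMod T) where
  tensorObj M N := tensor M N
  tensorUnit := unit T
  tensorHom f g := tensorMap f g
  whiskerLeft M _ _ f := tensorMap (𝟙 M) f
  whiskerRight f N := tensorMap f (𝟙 N)
  associator M N P := mkIso (α_ M.X N.X P.X) (tact_assoc M.act N.act P.act)
  leftUnitor M := mkIso (λ_ M.X) (tact_left M.act)
  rightUnitor M := mkIso (ρ_ M.X) (tact_right M.act)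

variable (T) in
/-- The monoidal structure is the one of `C`. -/
def forgetData : Monoidal.InducingFunctorData (forget T) where
  μIso X Y := Iso.refl _
  εIso := Iso.refl _
  whiskerLeft_eq M _ _ f := by
    change 𝟙 M.X ⊗ₘ f.hom = 𝟙 _ ≫ (M.X ◁ f.hom) ≫ 𝟙 _
    rw [id_tensorHom, Category.comp_id, Category.id_comp]
  whiskerRight_eq f N := by
    change f.hom ⊗ₘ 𝟙 N.X = 𝟙 _ ≫ (f.hom ▷ N.X) ≫ 𝟙 _
    rw [tensorHom_id, Category.comp_id, Category.id_comp]
  tensorHom_eq f g := by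
    change f.hom ⊗ₘ g.hom = 𝟙 _ ≫ (f.hom ⊗ₘ g.hom) ≫ 𝟙 _
    rw [Category.comp_id, Category.id_comp]
  associator_eq M N P := by
    change (α_ M.X N.X P.X).hom = ((𝟙 _ ≫ (𝟙 _ ⊗ₘ 𝟙 _)) ≫ (α_ M.X N.X P.X).hom ≫
      (𝟙 _ ⊗ₘ 𝟙 _) ≫ 𝟙 _)
    simp
  leftUnitor_eq M := by
    change (λ_ M.X).hom = (𝟙 _ ≫ (𝟙 _ ⊗ₘ 𝟙 _)) ≫ (λ_ M.X).hom
    simp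
  rightUnitor_eq M := by
    change (ρ_ M.X).hom = (𝟙 _ ≫ (𝟙 _ ⊗ₘ 𝟙 _)) ≫ (ρ_ M.X).hom
    simp

instance : MonoidalCategory (TMod T) := Monoidal.induced (forget T) (forgetData T)

end TMod
end Mod
end Cats

section CenterAdd
universe v u
variable {C : Type u} [Category.{v} C] [MonoidalCategory C] [Preadditive C] [MonoidalPreadditive C]

/-! ### Additive structure of the centre -/

section Hom
variable {X Y : Center C}

instance : Zero (X ⟶ Y) := ⟨⟨0, fun U => by simp⟩⟩
instance : Add (X ⟶ Y) := ⟨fun f g => ⟨f.f + g.f, fun U => by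
  rw [MonoidalPreadditive.add_whiskerRight, MonoidalPreadditive.whiskerLeft_add,
    Preadditive.add_comp, Preadditive.comp_add, f.comm, g.comm]⟩⟩
instance : Neg (X ⟶ Y) := ⟨fun f => ⟨-f.f, fun U => by
  have h1 : (-f.f) ▷ U = -(f.f ▷ U) := eq_neg_of_add_eq_zero_left (by
    rw [← MonoidalPreadditive.add_whiskerRight, neg_add_cancel,
      MonoidalPreadditive.zero_whiskerRight])
  have h2 : U ◁ (-f.f) = -(U ◁ f.f) := eq_neg_of_add_eq_zero_left (by
    rw [← MonoidalPreadditive.whiskerLeft_add, neg_add_cancel,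
      MonoidalPreadditive.whiskerLeft_zero])
  rw [h1, h2, Preadditive.neg_comp, Preadditive.comp_neg, f.comm]⟩⟩

instance : AddCommGroup (X ⟶ Y) where
  add_assoc f g h := Center.ext _ _ (add_assoc f.f g.f h.f)
  zero_add f := Center.ext _ _ (zero_add f.f)
  add_zero f := Center.ext _ _ (add_zero f.f)
  nsmul := nsmulRec
  zsmul := zsmulRec
  neg_add_cancel f := Center.ext _ _ (neg_add_cancel f.f)
  add_comm f g := Center.ext _ _ (add_comm f.f g.f)

end Hom

instance : Preadditive (Center C) where
  add_comp _ _ _ f f' g := Center.ext _ _ (Preadditive.add_comp _ _ _ f.f f'.f g.f)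
  comp_add _ _ _ f g g' := Center.ext _ _ (Preadditive.comp_add _ _ _ f.f g.f g'.f)

section Sum
variable [HasBinaryBiproducts C] (F G : Center C)

lemma biprod_whisker_ext {X Y U Z : C} {f g : (X ⊞ Y) ⊗ U ⟶ Z}
    (h : (biprod.inl : X ⟶ X ⊞ Y) ▷ U ≫ f = biprod.inl ▷ U ≫ g)
    (h' : (biprod.inr : Y ⟶ X ⊞ Y) ▷ U ≫ f = biprod.inr ▷ U ≫ g) : f = g := by
  have e : ∀ k : (X ⊞ Y) ⊗ U ⟶ Z, k = biprod.fst ▷ U ≫ biprod.inl ▷ U ≫ k +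
      biprod.snd ▷ U ≫ biprod.inr ▷ U ≫ k := fun k => by
    rw [← comp_whiskerRight_assoc, ← comp_whiskerRight_assoc, ← Preadditive.add_comp,
      ← MonoidalPreadditive.add_whiskerRight, biprod.total, id_whiskerRight, Category.id_comp]
  rw [e f, e g, h, h']

/-- The half-braiding of a direct sum. -/
def sumHom (U : C) : (F.1 ⊞ G.1) ⊗ U ⟶ U ⊗ (F.1 ⊞ G.1) :=
  biprod.fst ▷ U ≫ hb F U ≫ U ◁ biprod.inl + biprod.snd ▷ U ≫ hb G U ≫ U ◁ biprod.inr

/-- The inverse of the half-braiding of a direct sum. -/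
def sumInv (U : C) : U ⊗ (F.1 ⊞ G.1) ⟶ (F.1 ⊞ G.1) ⊗ U :=
  U ◁ biprod.fst ≫ (F.2.β U).inv ≫ biprod.inl ▷ U + U ◁ biprod.snd ≫ (G.2.β U).inv ≫
    biprod.inr ▷ U

lemma inl_sumHom (U : C) : biprod.inl ▷ U ≫ sumHom F G U = hb F U ≫ U ◁ biprod.inl := by
  rw [sumHom, Preadditive.comp_add, ← comp_whiskerRight_assoc, ← comp_whiskerRight_assoc,
    biprod.inl_fst, biprod.inl_snd, id_whiskerRight, MonoidalPreadditive.zero_whiskerRight,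
    Category.id_comp, Limits.zero_comp, add_zero]

lemma inr_sumHom (U : C) : biprod.inr ▷ U ≫ sumHom F G U = hb G U ≫ U ◁ biprod.inr := by
  rw [sumHom, Preadditive.comp_add, ← comp_whiskerRight_assoc, ← comp_whiskerRight_assoc,
    biprod.inr_fst, biprod.inr_snd, id_whiskerRight, MonoidalPreadditive.zero_whiskerRight,
    Category.id_comp, Limits.zero_comp, zero_add]

lemma inl_sumInv (U : C) : U ◁ biprod.inl ≫ sumInv F G U = (F.2.β U).inv ≫ biprod.inl ▷ U := by
  rw [sumInv, Preadditive.comp_add, ← MonoidalCategory.whiskerLeft_comp_assoc,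
    ← MonoidalCategory.whiskerLeft_comp_assoc, biprod.inl_fst, biprod.inl_snd,
    MonoidalCategory.whiskerLeft_id, MonoidalPreadditive.whiskerLeft_zero,
    Category.id_comp, Limits.zero_comp, add_zero]

lemma inr_sumInv (U : C) : U ◁ biprod.inr ≫ sumInv F G U = (G.2.β U).inv ≫ biprod.inr ▷ U := by
  rw [sumInv, Preadditive.comp_add, ← MonoidalCategory.whiskerLeft_comp_assoc,
    ← MonoidalCategory.whiskerLeft_comp_assoc, biprod.inr_fst, biprod.inr_snd,
    MonoidalCategory.whiskerLeft_id, MonoidalPreadditive.whiskerLeft_zero,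
    Category.id_comp, Limits.zero_comp, zero_add]

/-- The half-braiding of a direct sum, as an isomorphism. -/
def sumIso (U : C) : (F.1 ⊞ G.1) ⊗ U ≅ U ⊗ (F.1 ⊞ G.1) where
  hom := sumHom F G U
  inv := sumInv F G U
  hom_inv_id := biprod_whisker_ext
    (by
      rw [← Category.assoc, inl_sumHom, Category.assoc, inl_sumInv, Iso.hom_inv_id_assoc,
        Category.comp_id])
    (by
      rw [← Category.assoc, inr_sumHom, Category.assoc, inr_sumInv, Iso.hom_inv_id_assoc,
        Category.comp_id])
  inv_hom_id := by
    rw [sumInv, Preadditive.add_comp, Category.assoc, Category.assoc, Category.assoc,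
      Category.assoc, inl_sumHom, inr_sumHom, Iso.inv_hom_id_assoc, Iso.inv_hom_id_assoc,
      ← MonoidalCategory.whiskerLeft_comp, ← MonoidalCategory.whiskerLeft_comp,
      ← MonoidalPreadditive.whiskerLeft_add, biprod.total, MonoidalCategory.whiskerLeft_id]

lemma sum_monoidal {H : C} {k : ∀ U, H ⊗ U ⟶ U ⊗ H} (i : F.1 ⟶ H)
    (h : ∀ U, i ▷ U ≫ k U = hb F U ≫ U ◁ i) (U U' : C) :
    i ▷ (U ⊗ U') ≫ k (U ⊗ U') = i ▷ (U ⊗ U') ≫ bObj (k U) (k U') := by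
  rw [h, hb_obj, bObj, bObj]
  symm
  calc
    _ = 𝟙 _ ⊗≫ (i ▷ U ≫ k U) ▷ U' ⊗≫ U ◁ k U' ⊗≫ 𝟙 _ := by monoidal
    _ = 𝟙 _ ⊗≫ hb F U ▷ U' ⊗≫ U ◁ (i ▷ U' ≫ k U') ⊗≫ 𝟙 _ := by rw [h]; monoidal
    _ = _ := by rw [h]; monoidal

lemma sum_nat {H : C} {k : ∀ U, H ⊗ U ⟶ U ⊗ H} (i : F.1 ⟶ H)
    (h : ∀ U, i ▷ U ≫ k U = hb F U ≫ U ◁ i) {U U' : C} (f : U ⟶ U') :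
    i ▷ U ≫ H ◁ f ≫ k U' = i ▷ U ≫ k U ≫ f ▷ H := by
  rw [← whisker_exchange_assoc, h, ← Category.assoc, hb_nat, ← Category.assoc, h, Category.assoc,
    Category.assoc, whisker_exchange]

/-- The direct sum in the centre. -/
def centerSum : Center C :=
  ⟨F.1 ⊞ G.1,
    { β := sumIso F G
      monoidal := fun U U' => biprod_whisker_ext
        (sum_monoidal F _ (inl_sumHom F G) U U') (sum_monoidal G _ (inr_sumHom F G) U U')
      naturality := fun f => biprod_whisker_ext
        (sum_nat F _ (inl_sumHom F G) f) (sum_nat G _ (inr_sumHom F G) f) }⟩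

/-- The direct sum in the centre, as a bicone. -/
def centerBicone : BinaryBicone F G where
  pt := centerSum F G
  fst := ⟨biprod.fst, fun U => by
    change biprod.fst ▷ U ≫ hb F U = sumHom F G U ≫ U ◁ biprod.fst
    refine biprod_whisker_ext ?_ ?_
    · rw [← Category.assoc (_ ▷ U) (sumHom F G U), inl_sumHom, ← comp_whiskerRight_assoc,
        Category.assoc, ← MonoidalCategory.whiskerLeft_comp, biprod.inl_fst]
      simp
    · rw [← Category.assoc (_ ▷ U) (sumHom F G U), inr_sumHom, ← comp_whiskerRight_assoc,
        Category.assoc, ← MonoidalCategory.whiskerLeft_comp, biprod.inr_fst]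
      simp⟩
  snd := ⟨biprod.snd, fun U => by
    change biprod.snd ▷ U ≫ hb G U = sumHom F G U ≫ U ◁ biprod.snd
    refine biprod_whisker_ext ?_ ?_
    · rw [← Category.assoc (_ ▷ U) (sumHom F G U), inl_sumHom, ← comp_whiskerRight_assoc,
        Category.assoc, ← MonoidalCategory.whiskerLeft_comp, biprod.inl_snd]
      simp
    · rw [← Category.assoc (_ ▷ U) (sumHom F G U), inr_sumHom, ← comp_whiskerRight_assoc,
        Category.assoc, ← MonoidalCategory.whiskerLeft_comp, biprod.inr_snd]
      simp⟩
  inl := ⟨biprod.inl, inl_sumHom F G⟩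
  inr := ⟨biprod.inr, inr_sumHom F G⟩
  inl_fst := Center.ext _ _ biprod.inl_fst
  inl_snd := Center.ext _ _ biprod.inl_snd
  inr_fst := Center.ext _ _ biprod.inr_fst
  inr_snd := Center.ext _ _ biprod.inr_snd

instance : HasBinaryBiproducts (Center C) :=
  ⟨fun F G => hasBinaryBiproduct_of_total (centerBicone F G) (Center.ext _ _ biprod.total)⟩

end Sum

/-! ### Tensor algebras -/

open MonObj ComonObj in
/-- The tensor algebra `T(F)` of an object `F` of the centre: its underlying algebra in `C` is the
tensor algebra of the object `F` of `C`, i.e. it has the universal property among all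
algebras in `C`, and it carries the bialgebra structure in the centre which is determined by
`Δ|_F = ι ⊗ η + η ⊗ ι` and `ε|_F = 0`. -/
structure TensorAlg (F : Center C) where
  T : Center C
  [bimon : BimonObj T]
  incl : F ⟶ T
  univ : ∀ (A : C) [MonObj A] (f : F.1 ⟶ A), ∃! g : T.1 ⟶ A,
    oneF T ≫ g = η[A] ∧ mulF T ≫ g = (g ⊗ₘ g) ≫ μ[A] ∧ incl.f ≫ g = f
  incl_comul : incl ≫ Δ[T] = (ρ_ F).inv ≫ (incl ⊗ₘ η[T]) + (λ_ F).inv ≫ (η[T] ⊗ₘ incl)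
  incl_counit : incl ≫ ε[T] = 0

attribute [instance] TensorAlg.bimon

end CenterAdd

/-- Two monoidal categories are monoidally isomorphic: there is an isomorphism of categories
which is a (strong) monoidal functor. -/
def MonoidallyIsomorphic (C : Type*) (D : Type*) [Category C] [Category D] [MonoidalCategory C]
    [MonoidalCategory D] : Prop :=
  ∃ (Φ : C ⥤ D) (Ψ : D ⥤ C), Φ ⋙ Ψ = 𝟭 C ∧ Ψ ⋙ Φ = 𝟭 D ∧ Nonempty Φ.Monoidal

/-! ### The data of the uncompactified free boson -/

section Boson

/-- `ι⁺`: the lift to the centre by the braiding `c_{F,-}`. -/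
def centerPos {C : Type*} [Category C] [MonoidalCategory C] [BraidedCategory C] (X : C) :
    Center C := Center.ofBraidedObj X

/-- `ι⁻`: the lift to the centre by the inverse braiding `c_{-,F}⁻¹`. -/
def centerNeg {C : Type*} [Category C] [MonoidalCategory C] [BraidedCategory C] (X : C) :
    Center C :=
  ⟨X, { β := fun Y => (β_ Y X).symm
        monoidal := fun U U' => by
          simp
        naturality := fun f => by
          simp }⟩

variable (κ ω : ℂ)

/-- `F_ω = ℂ_ω ⊕ ℂ_{-ω}`. -/
def Fω : Cat κ := Cat.char ω ⊞ Cat.char (-ω)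

/-- `F = ι⁺(F_ω) ⊕ ι⁻(F_ω)`. -/
def bosonF : Center (Cat κ) := centerPos (Fω κ ω) ⊞ centerNeg (Fω κ ω)

/-- The signs `±` of `f^±` and `f̄^±`. -/
def sgn : Bool → ℂ
  | true => 1
  | false => -1

/-- The data of `A_F`: the generators are `f^±`, given by `(±, false)`, and `f̄^±`, given by
`(±, true)`. The relations are `[h, f^±] = ±ω f^±`, `[h, f̄^±] = ±ω f̄^±`, the coproduct is
`Δ(f^±) = f^± ⊗ 1 + e^{±κω h} ⊗ f^±`, `Δ(f̄^±) = f̄^± ⊗ 1 + e^{∓κω h} ⊗ f̄^±`. -/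
def bosonDatum : Datum where
  X := Bool × Bool
  fin := inferInstance
  a p := sgn p.1 * ω
  c p := if p.2 then -(sgn p.1 * κ * ω) else sgn p.1 * κ * ω

/-- `Rep^{A-ss}(A_F)`. -/
abbrev RepAF : Type 1 := Rep (bosonDatum κ ω)

end Boson

end FreeBoson

end

/-!
The three categories have the same objects up to the form in which an action is recorded. The object
`F` has a basis indexed by the generators `x` of `A_F`, on whose members `h` acts by a scalar `a_x`
and whose half-braiding is `e_x ⊗ u ↦ e^{c_x h} u ⊗ e_x`; here `a_x = ±ω` and `c_x = ±κω`
(`bosonLetters`). This is the only information about `F` which is used: everything below holds for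
any `F : Center (Cat κ)` with such a basis (`LetterBasis`). Objects of `Cat κ` are spanned by weight
vectors, so that a morphism is a linear map which preserves weights, and a morphism of the centre is
one which also preserves the exponents `c` of homogeneous elements (`Homog`, `mkCenter`).

*Existence of `T(F)`.* The span of the words in the generators (`freeCenter`) is an object of the
centre, in which a word has the sums of the `a_x` and of the `c_x` as its bidegree, and
concatenation makes it an algebra. A homogeneous family in an algebra of the centre extends uniquely
to a homomorphism in the centre (`exists_centerLift`, `center_hom_ext`). This gives the coproduct
and the counit, and the axioms of a bialgebra hold since they hold on letters.

*Modules over `T(F)`.* By the universal property an arbitrary `T(F)` is spanned by words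
(`LetterBasis.span_tword`), so that actions and their morphisms are determined by the restriction to
`F` (`LetterBasis.comm_of_restrict`), and every morphism `F ⊗ X ⟶ X` extends to an action
(`LetterBasis.extObj`). The restriction is monoidal as the elements of `F` are primitive
(`LetterBasis.incl_tact`).

*Representations of `A_F`.* A morphism `F ⊗ X ⟶ X` is a family of operators `x` on `X` with
`[h, x] = a_x x`. As they shift weights, all series in `h` and the `x` act on weight vectors, and
the operators extend to a continuous representation of `A_F` (`Rep.ofGen`), which is determined by
the generators. The functor is monoidal as the tensor product of `C_F` acts by
`x ⊗ 1 + e^{c_x h} ⊗ x` (`app_tp`), the coproduct of `A_F`.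
-/

noncomputable section

namespace FreeBoson

open Weighted WeightedMonoid
open CategoryTheory MonoidalCategory Limits

/-! ### Elements of objects of the category of weight spaces -/

section Elements
variable {κ : ℂ}

/-- The vector space underlying an object of `Cat κ`. It is a separate definition, so that the
elements of an object, the maps `app f` and the pure tensors `tm v w` form an interface in which
equations between morphisms of `Cat κ` are checked by `simp`. -/
def Vec (X : Cat κ) : Type := (Rep.V X : ModuleCat.{0} ℂ)

instance (X : Cat κ) : AddCommGroup (Vec X) := ModuleCat.isAddCommGroup (Rep.V X)
instance (X : Cat κ) : Module ℂ (Vec X) := ModuleCat.isModule (Rep.V X)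

/-- The action of `h`. -/
def hact (X : Cat κ) : Module.End ℂ (Vec X) := Rep.ρ X (Bialg.h _)

/-- The action of `e^{c h}`. -/
def eact (X : Cat κ) (c : ℂ) : Module.End ℂ (Vec X) := Rep.ρ X (Bialg.expH _ c)

/-- The linear map underlying a morphism. -/
def app {X Y : Cat κ} (f : X ⟶ Y) : Vec X →ₗ[ℂ] Vec Y := (Rep.Hom.hom f).hom

/-- A pure tensor. -/
def tm {X Y : Cat κ} (v : Vec X) (w : Vec Y) : Vec (X ⊗ Y) := v ⊗ₜ[ℂ] w

variable {X Y Z X' Y' : Cat κ}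

lemma tm_add (v : Vec X) (w w' : Vec Y) : tm v (w + w') = tm v w + tm v w' :=
  TensorProduct.tmul_add _ _ _
lemma add_tm (v v' : Vec X) (w : Vec Y) : tm (v + v') w = tm v w + tm v' w :=
  TensorProduct.add_tmul _ _ _
lemma tm_smul (c : ℂ) (v : Vec X) (w : Vec Y) : tm v (c • w) = c • tm v w :=
  TensorProduct.tmul_smul (R := ℂ) (M := Rep.V X) (N := Rep.V Y) c v w
lemma smul_tm (c : ℂ) (v : Vec X) (w : Vec Y) : tm (c • v) w = c • tm v w :=
  (TensorProduct.smul_tmul' (R := ℂ) (M := Rep.V X) (N := Rep.V Y) c v w).symm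
lemma tm_zero (v : Vec X) : tm v (0 : Vec Y) = 0 := TensorProduct.tmul_zero _ _
lemma zero_tm (w : Vec Y) : tm (0 : Vec X) w = 0 := TensorProduct.zero_tmul _ _

lemma hom_ext_app {f g : X ⟶ Y} (h : ∀ v, app f v = app g v) : f = g :=
  Rep.hom_ext (ModuleCat.hom_ext (LinearMap.ext h))

lemma tm_induction {P : Vec (X ⊗ Y) → Prop} (zero : P 0) (add : ∀ x y, P x → P y → P (x + y))
    (tmul : ∀ v w, P (tm v w)) (x : Vec (X ⊗ Y)) : P x :=
  TensorProduct.induction_on x zero tmul add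

lemma linear_ext_tm {V : Type} [AddCommGroup V] [Module ℂ V] {f g : Vec (X ⊗ Y) →ₗ[ℂ] V}
    (h : ∀ v w, f (tm v w) = g (tm v w)) : f = g :=
  TensorProduct.ext' h

lemma hom_ext_tm {f g : X ⊗ Y ⟶ Z} (h : ∀ v w, app f (tm v w) = app g (tm v w)) : f = g :=
  hom_ext_app fun v => LinearMap.congr_fun (linear_ext_tm (f := app f) (g := app g) h) v

@[simp] lemma app_id (v : Vec X) : app (𝟙 X) v = v := rfl
@[simp] lemma app_comp (f : X ⟶ Y) (g : Y ⟶ Z) (v : Vec X) : app (f ≫ g) v = app g (app f v) := rfl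
lemma app_add (f g : X ⟶ Y) (v : Vec X) : app (f + g) v = app f v + app g v := rfl
lemma app_zero (v : Vec X) : app (0 : X ⟶ Y) v = 0 := rfl
@[simp] lemma app_tensor (f : X ⟶ X') (g : Y ⟶ Y') (v : Vec X) (w : Vec Y) :
    app (f ⊗ₘ g) (tm v w) = tm (app f v) (app g w) := rfl
@[simp] lemma app_whiskerLeft (f : Y ⟶ Y') (v : Vec X) (w : Vec Y) :
    app (X ◁ f) (tm v w) = tm v (app f w) := rfl
@[simp] lemma app_whiskerRight (f : X ⟶ X') (v : Vec X) (w : Vec Y) :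
    app (f ▷ Y) (tm v w) = tm (app f v) w := rfl
@[simp] lemma app_assoc (v : Vec X) (w : Vec Y) (u : Vec Z) :
    app (α_ X Y Z).hom (tm (tm v w) u) = tm v (tm w u) := rfl
@[simp] lemma app_assoc_inv (v : Vec X) (w : Vec Y) (u : Vec Z) :
    app (α_ X Y Z).inv (tm v (tm w u)) = tm (tm v w) u := rfl

/-- The element `1` of the unit object. -/
def one' : Vec (𝟙_ (Cat κ)) := (1 : ℂ)

lemma app_leftUnitor (c : ℂ) (v : Vec X) : app (λ_ X).hom (tm (c • one') v) = c • v := by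
  exact (TensorProduct.lid_tmul (R := ℂ) v (c • (1 : ℂ))).trans
    (by rw [smul_eq_mul, mul_one])
@[simp] lemma app_leftUnitor_one (v : Vec X) : app (λ_ X).hom (tm one' v) = v := by
  simpa using app_leftUnitor (1 : ℂ) v
@[simp] lemma app_rightUnitor_one (v : Vec X) : app (ρ_ X).hom (tm v one') = v := by
  exact (TensorProduct.rid_tmul (R := ℂ) v (1 : ℂ)).trans (one_smul ℂ v)
@[simp] lemma app_leftUnitor_inv (v : Vec X) : app (λ_ X).inv v = tm one' v := rfl
@[simp] lemma app_rightUnitor_inv (v : Vec X) : app (ρ_ X).inv v = tm v one' := rfl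

lemma exists_smul_one (c : Vec (𝟙_ (Cat κ))) : ∃ z : ℂ, c = z • one' :=
  ⟨(c : ℂ), (mul_one (M := ℂ) c).symm⟩

lemma hom_ext_one {f g : 𝟙_ (Cat κ) ⟶ Y} (h : app f one' = app g one') : f = g :=
  hom_ext_app fun v => by
    obtain ⟨z, rfl⟩ := exists_smul_one v
    rw [map_smul, map_smul, h]

lemma app_hact (f : X ⟶ Y) (v : Vec X) : app f (hact X v) = hact Y (app f v) :=
  Rep.Hom.comm f _ v
lemma app_eact (f : X ⟶ Y) (c : ℂ) (v : Vec X) : app f (eact X c v) = eact Y c (app f v) :=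
  Rep.Hom.comm f _ v

lemma weight_map (f : X ⟶ Y) {v : Vec X} {l : ℂ} (hv : hact X v = l • v) :
    hact Y (app f v) = l • app f v := by
  rw [← app_hact, hv, map_smul]

lemma hact_tm (v : Vec X) (w : Vec Y) :
    hact (X ⊗ Y) (tm v w) = tm (hact X v) w + tm v (hact Y w) :=
  tensorRep_h _ _ v w

lemma hact_tm_eig {v : Vec X} {w : Vec Y} {l m : ℂ} (hv : hact X v = l • v)
    (hw : hact Y w = m • w) : hact (X ⊗ Y) (tm v w) = (l + m) • tm v w := by
  rw [hact_tm, hv, hw, smul_tm, tm_smul, add_smul]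

lemma hact_one : hact (𝟙_ (Cat κ)) one' = 0 := (Rep.unitRep_h (1 : ℂ)).trans (zero_smul ℂ _)

/-- Every object is spanned by its weight vectors, as it is a semisimple representation of `A`. -/
lemma eig_induction {P : Vec X → Prop} (add : ∀ x y, P x → P y → P (x + y))
    (eig : ∀ v (l : ℂ), hact X v = l • v → P v) (v : Vec X) : P v := by
  have hs : eigSpan (hact X) = ⊤ := Rep.span X
  have hv : v ∈ eigSpan (hact X) := hs ▸ Submodule.mem_top
  rw [eigSpan] at hv
  -- The claim is strengthened to all scalar multiples, under which `P` need not be stable.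
  suffices h : ∀ c : ℂ, P (c • v) by simpa only [one_smul] using h 1
  refine Submodule.span_induction (p := fun v _ => ∀ c : ℂ, P (c • v)) ?_ ?_ ?_ ?_ hv
  · rintro v ⟨l, hl⟩ c
    exact eig _ l (by rw [map_smul, hl, smul_comm])
  · intro c
    exact eig _ 0 (by simp)
  · intro v w _ _ hv hw c
    rw [smul_add]
    exact add _ _ (hv c) (hw c)
  · intro a v _ hv c
    rw [smul_smul]
    exact hv _

lemma eact_eig (c : ℂ) {v : Vec X} {l : ℂ} (hv : hact X v = l • v) :
    eact X c v = Complex.exp (c * l) • v :=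
  eExp_act (ρ := (Rep.ρ X).comp TopQuot.mk) ((Rep.cont X).comp TopQuot.continuous_mk) c
    (Word.gen (Sum.inl ())) (Word.deg_inl _) hv

lemma eact_zero (v : Vec X) : eact X 0 v = v := by
  induction v using eig_induction with
  | add v w hv hw => rw [map_add, hv, hw]
  | eig v l h => rw [eact_eig 0 h, zero_mul, Complex.exp_zero, one_smul]

lemma eact_add (c c' : ℂ) (v : Vec X) : eact X (c + c') v = eact X c (eact X c' v) := by
  induction v using eig_induction with
  | add v w hv hw => simp only [map_add, hv, hw]
  | eig v l h =>
    rw [eact_eig _ h, eact_eig _ h, map_smul, eact_eig _ h, smul_smul, ← Complex.exp_add]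
    ring_nf

lemma eact_neg (c : ℂ) (v : Vec X) : eact X c (eact X (-c) v) = v := by
  rw [← eact_add, add_neg_cancel, eact_zero]
lemma eact_neg' (c : ℂ) (v : Vec X) : eact X (-c) (eact X c v) = v := by
  rw [← eact_add, neg_add_cancel, eact_zero]

lemma eact_hact (c : ℂ) (v : Vec X) : eact X c (hact X v) = hact X (eact X c v) := by
  induction v using eig_induction with
  | add v w hv hw => simp only [map_add, hv, hw]
  | eig v l h => rw [h, map_smul, eact_eig _ h, map_smul, h, smul_comm]

lemma eact_tm (c : ℂ) (v : Vec X) (w : Vec Y) :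
    eact (X ⊗ Y) c (tm v w) = tm (eact X c v) (eact Y c w) := by
  induction v using eig_induction with
  | add v v' hv hv' => simp only [add_tm, map_add, hv, hv']
  | eig v l h =>
    induction w using eig_induction with
    | add w w' hw hw' => simp only [tm_add, map_add, hw, hw']
    | eig w m h' =>
      rw [eact_eig _ (hact_tm_eig h h'), eact_eig _ h, eact_eig _ h', smul_tm, tm_smul, smul_smul,
        ← Complex.exp_add, mul_add]

/-- A linear map which commutes with `h` is a morphism. -/
def mkC (f : Vec X →ₗ[ℂ] Vec Y) (h : ∀ v, f (hact X v) = hact Y (f v)) : X ⟶ Y :=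
  Rep.mkHom (D := Datum.empty) (ModuleCat.ofHom f) (LinearMap.ext h) (fun j => j.elim)

lemma hom_ext_span {J : Type} {s : J → Vec X} (hs : Submodule.span ℂ (Set.range s) = ⊤)
    {f g : X ⟶ Y} (h : ∀ j, app f (s j) = app g (s j)) : f = g :=
  hom_ext_app fun v => LinearMap.congr_fun
    (LinearMap.ext_on_range (f := app f) (g := app g) hs h) v

lemma hom_ext_span_left {J : Type} {s : J → Vec X} (hs : Submodule.span ℂ (Set.range s) = ⊤)
    {f g : X ⊗ Y ⟶ Z} (h : ∀ j w, app f (tm (s j) w) = app g (tm (s j) w)) : f = g :=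
  hom_ext_tm fun v w => by
    have hv : v ∈ Submodule.span ℂ (Set.range s) := hs ▸ Submodule.mem_top
    induction hv using Submodule.span_induction with
    | mem v hv => obtain ⟨j, rfl⟩ := hv; exact h j w
    | zero => simp only [map_zero, zero_tm]
    | add v v' _ _ hv hv' => simp only [map_add, add_tm, hv, hv']
    | smul c v _ hv => simp only [map_smul, smul_tm, hv]

lemma hom_ext_span_right {J : Type} {s : J → Vec Y} (hs : Submodule.span ℂ (Set.range s) = ⊤)
    {f g : X ⊗ Y ⟶ Z} (h : ∀ v j, app f (tm v (s j)) = app g (tm v (s j))) : f = g :=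
  hom_ext_tm fun v w => by
    have hw : w ∈ Submodule.span ℂ (Set.range s) := hs ▸ Submodule.mem_top
    induction hw using Submodule.span_induction with
    | mem w hw => obtain ⟨j, rfl⟩ := hw; exact h v j
    | zero => simp only [map_zero, tm_zero]
    | add w w' _ _ hw hw' => simp only [map_add, tm_add, hw, hw']
    | smul c w _ hw => simp only [map_smul, tm_smul, hw]

lemma span_one : Submodule.span ℂ (Set.range fun _ : Unit => (one' : Vec (𝟙_ (Cat κ)))) = ⊤ := by
  rw [eq_top_iff]
  intro v _
  obtain ⟨z, rfl⟩ := exists_smul_one v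
  exact Submodule.smul_mem _ _ (Submodule.subset_span ⟨(), rfl⟩)

/-- Pure tensors of elements of two spanning families span. -/
lemma span_tm {J J' : Type} {s : J → Vec X} {t : J' → Vec Y}
    (hs : Submodule.span ℂ (Set.range s) = ⊤) (ht : Submodule.span ℂ (Set.range t) = ⊤) :
    Submodule.span ℂ (Set.range fun p : J × J' => (tm (s p.1) (t p.2) : Vec (X ⊗ Y))) = ⊤ := by
  have h : ∀ v w, (tm v w : Vec (X ⊗ Y)) ∈
      Submodule.span ℂ (Set.range fun p : J × J' => (tm (s p.1) (t p.2) : Vec (X ⊗ Y))) := by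
    intro v w
    have hv : v ∈ Submodule.span ℂ (Set.range s) := hs ▸ Submodule.mem_top
    have hw : w ∈ Submodule.span ℂ (Set.range t) := ht ▸ Submodule.mem_top
    induction hv using Submodule.span_induction with
    | mem v hv =>
      obtain ⟨j, rfl⟩ := hv
      induction hw using Submodule.span_induction with
      | mem w hw => obtain ⟨j', rfl⟩ := hw; exact Submodule.subset_span ⟨(j, j'), rfl⟩
      | zero => rw [tm_zero]; exact Submodule.zero_mem _
      | add w w' _ _ hw hw' => rw [tm_add]; exact Submodule.add_mem _ hw hw'
      | smul c w _ hw => rw [tm_smul]; exact Submodule.smul_mem _ c hw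
    | zero => rw [zero_tm]; exact Submodule.zero_mem _
    | add v v' _ _ hv hv' => rw [add_tm]; exact Submodule.add_mem _ hv hv'
    | smul c v _ hv => rw [smul_tm]; exact Submodule.smul_mem _ c hv
  rw [eq_top_iff]
  intro x _
  induction x using tm_induction with
  | zero => exact Submodule.zero_mem _
  | add x y hx hy => exact Submodule.add_mem _ (hx trivial) (hy trivial)
  | tmul v w => exact h v w

/-- A linear map which sends the members of a spanning family of weight vectors to weight vectors of
the same weight is a morphism. -/
def mkSpan {J : Type} {s : J → Vec X} (hs : Submodule.span ℂ (Set.range s) = ⊤) (a : J → ℂ)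
    (f : Vec X →ₗ[ℂ] Vec Y) (h : ∀ j, hact X (s j) = a j • s j)
    (h' : ∀ j, hact Y (f (s j)) = a j • f (s j)) : X ⟶ Y :=
  mkC f fun v => LinearMap.congr_fun (LinearMap.ext_on_range (f := f ∘ₗ hact X)
    (g := hact Y ∘ₗ f) hs fun j => by
      rw [LinearMap.comp_apply, LinearMap.comp_apply, h, h', map_smul]) v

@[simp] lemma app_mkSpan {J : Type} {s : J → Vec X} (hs : Submodule.span ℂ (Set.range s) = ⊤)
    (a : J → ℂ) (f : Vec X →ₗ[ℂ] Vec Y) (h h') (v : Vec X) :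
    app (mkSpan hs a f h h') v = f v := rfl

section Bilinear

/-- The linear map on a tensor product which is given by a bilinear map. -/
def liftTm {V : Type} [AddCommGroup V] [Module ℂ V]
    (f : Vec X →ₗ[ℂ] Vec Y →ₗ[ℂ] V) : Vec (X ⊗ Y) →ₗ[ℂ] V := TensorProduct.lift f

lemma liftTm_tm {V : Type} [AddCommGroup V] [Module ℂ V]
    (f : Vec X →ₗ[ℂ] Vec Y →ₗ[ℂ] V) (v : Vec X) (w : Vec Y) : liftTm f (tm v w) = f v w := rfl

variable (X Y) in
/-- Pure tensors as a bilinear map. -/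
def tmₗ : Vec X →ₗ[ℂ] Vec Y →ₗ[ℂ] Vec (X ⊗ Y) := TensorProduct.mk ℂ (Rep.V X) (Rep.V Y)

@[simp] lemma tmₗ_apply (v : Vec X) (w : Vec Y) : tmₗ X Y v w = tm v w := rfl

/-- The morphism which is given by a bilinear map on which `h` acts as a derivation. -/
def mkTm (f : Vec X →ₗ[ℂ] Vec Y →ₗ[ℂ] Vec Z)
    (h : ∀ v w, f (hact X v) w + f v (hact Y w) = hact Z (f v w)) : X ⊗ Y ⟶ Z :=
  mkC (liftTm f) fun x => by
    induction x using tm_induction with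
    | zero => simp only [map_zero]
    | add x y hx hy => simp only [map_add, hx, hy]
    | tmul v w => rw [hact_tm, map_add, liftTm_tm, liftTm_tm, liftTm_tm, h]

@[simp] lemma app_mkTm (f : Vec X →ₗ[ℂ] Vec Y →ₗ[ℂ] Vec Z) (h) (v : Vec X) (w : Vec Y) :
    app (mkTm f h) (tm v w) = f v w := rfl

lemma derivation_of_span_left {J : Type} {s : J → Vec X}
    (hs : Submodule.span ℂ (Set.range s) = ⊤) (f : Vec X →ₗ[ℂ] Vec Y →ₗ[ℂ] Vec Z)
    (h : ∀ j w, f (hact X (s j)) w + f (s j) (hact Y w) = hact Z (f (s j) w)) (v : Vec X)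
    (w : Vec Y) : f (hact X v) w + f v (hact Y w) = hact Z (f v w) := by
  have := LinearMap.ext_on_range (f := f.flip w ∘ₗ hact X + f.flip (hact Y w))
    (g := hact Z ∘ₗ f.flip w) hs fun j => h j w
  exact LinearMap.congr_fun this v

lemma derivation_of_span_right {J : Type} {s : J → Vec Y}
    (hs : Submodule.span ℂ (Set.range s) = ⊤) (f : Vec X →ₗ[ℂ] Vec Y →ₗ[ℂ] Vec Z)
    (h : ∀ v j, f (hact X v) (s j) + f v (hact Y (s j)) = hact Z (f v (s j))) (v : Vec X)
    (w : Vec Y) : f (hact X v) w + f v (hact Y w) = hact Z (f v w) := by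
  have := derivation_of_span_left hs f.flip (fun j v => (add_comm _ _).trans (h v j)) w v
  exact (add_comm _ _).trans this

lemma derivation_of_span {J J' : Type} {s : J → Vec X} {t : J' → Vec Y}
    (hs : Submodule.span ℂ (Set.range s) = ⊤) (ht : Submodule.span ℂ (Set.range t) = ⊤)
    (f : Vec X →ₗ[ℂ] Vec Y →ₗ[ℂ] Vec Z)
    (h : ∀ j k, f (hact X (s j)) (t k) + f (s j) (hact Y (t k)) = hact Z (f (s j) (t k)))
    (v : Vec X) (w : Vec Y) : f (hact X v) w + f v (hact Y w) = hact Z (f v w) :=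
  derivation_of_span_left hs f (fun j w => LinearMap.congr_fun
    (LinearMap.ext_on_range (f := f (hact X (s j)) + f (s j) ∘ₗ hact Y) (g := hact Z ∘ₗ f (s j)) ht
      fun k => h j k) w) v w

end Bilinear

/-- The linear map out of the unit object which sends `1` to `y`. -/
def liftOne (y : Vec X) : Vec (𝟙_ (Cat κ)) →ₗ[ℂ] Vec X := LinearMap.toSpanSingleton ℂ (Vec X) y

lemma liftOne_one (y : Vec X) : liftOne y one' = y := one_smul ℂ y

/-- The morphism out of the unit object which sends `1` to a vector of weight `0`. -/
def mkOne (y : Vec X) (hy : hact X y = 0) : 𝟙_ (Cat κ) ⟶ X :=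
  mkSpan span_one (fun _ => 0) (liftOne y) (fun _ => hact_one.trans (zero_smul ℂ _).symm)
    (fun _ => by rw [liftOne_one, hy, zero_smul])

@[simp] lemma app_mkOne (y : Vec X) (hy) : app (mkOne y hy) one' = y := liftOne_one y

end Elements

/-! ### Homogeneous elements of objects of the centre -/

section Homogeneous
variable {κ : ℂ}

/-- An element `b` of an object of the centre is homogeneous of bidegree `(a, c)` if `h` acts on it
by `a` and if the half-braiding is `b ⊗ u ↦ e^{c h} u ⊗ b`. -/
structure Homog (B : Center (Cat κ)) (a c : ℂ) (b : Vec B.1) : Prop where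
  weight : hact B.1 b = a • b
  braid : ∀ (U : Cat κ) (u : Vec U), app (hb B U) (tm b u) = tm (eact U c u) b

variable {A B B' : Center (Cat κ)} {a a' c c' : ℂ}

lemma Homog.map {b : Vec B.1} (h : Homog B a c b) (f : B ⟶ B') : Homog B' a c (app f.f b) :=
  ⟨by rw [← app_hact, h.weight, map_smul], fun U u => by
    have := congrArg (fun k => app k (tm b u)) (f.comm U)
    simp only [app_comp, app_whiskerRight] at this
    rw [h.braid, app_whiskerLeft] at this
    exact this⟩

lemma app_bTensor {p q X : Cat κ} {bp : p ⊗ X ⟶ X ⊗ p} {bq : q ⊗ X ⟶ X ⊗ q}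
    {v : Vec p} {w : Vec q} {u u' u'' : Vec X} (hq : app bq (tm w u) = tm u' w)
    (hp : app bp (tm v u') = tm u'' v) :
    app (bTensor bp bq) (tm (tm v w) u) = tm u'' (tm v w) := by
  simp only [bTensor, app_comp, app_assoc, app_whiskerLeft, hq, app_assoc_inv, app_whiskerRight, hp]

lemma Homog.tm {b : Vec B.1} {b' : Vec B'.1} (h : Homog B a c b) (h' : Homog B' a' c' b') :
    Homog (B ⊗ B') (a + a') (c + c') (tm b b' : Vec (B.1 ⊗ B'.1)) :=
  ⟨by
    refine (hact_tm b b').trans ?_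
    rw [h.weight, h'.weight, smul_tm, tm_smul]
    exact (add_smul a a' (FreeBoson.tm b b')).symm, fun U u => by
    have e : hb (B ⊗ B') U = bTensor (hb B U) (hb B' U) := by
      rw [hb, Center.tensor_β]; rfl
    rw [e, eact_add]
    exact app_bTensor (h'.braid U u) (h.braid U _)⟩

lemma Homog.one : Homog (𝟙_ (Center (Cat κ))) 0 0 (one' : Vec (𝟙_ (Cat κ))) :=
  ⟨hact_one.trans (zero_smul ℂ _).symm, fun U u => by
    rw [hb, Center.tensorUnit_β, eact_zero]
    change app ((λ_ U).hom ≫ (ρ_ U).inv) (FreeBoson.tm one' u) = FreeBoson.tm u one'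
    rw [app_comp, app_leftUnitor_one, app_rightUnitor_inv]⟩

/-- A morphism of `Cat κ` which preserves the bidegrees of a spanning family of homogeneous elements
is a morphism of the centre. -/
def mkCenter {J : Type} {s : J → Vec A.1} (hs : Submodule.span ℂ (Set.range s) = ⊤) {a c : J → ℂ}
    (h : ∀ j, Homog A (a j) (c j) (s j)) (f : A.1 ⟶ B.1)
    (h' : ∀ j, Homog B (a j) (c j) (app f (s j))) : A ⟶ B :=
  ⟨f, fun U => hom_ext_tm fun v u => by
    have hv : v ∈ Submodule.span ℂ (Set.range s) := hs ▸ Submodule.mem_top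
    change app (f ▷ U ≫ hb B U) _ = app (hb A U ≫ U ◁ f) _
    simp only [app_comp, app_whiskerRight]
    induction hv using Submodule.span_induction with
    | mem v hv =>
      obtain ⟨j, rfl⟩ := hv
      rw [(h j).braid, (h' j).braid, app_whiskerLeft]
    | zero => simp only [map_zero, zero_tm]
    | add v v' _ _ hv hv' => simp only [map_add, add_tm, hv, hv']
    | smul c v _ hv => simp only [map_smul, smul_tm, hv]⟩

end Homogeneous

/-! ### A homogeneous basis of `F` -/

section Letters
variable {κ : ℂ}

/-- A basis of an object of the centre, indexed by the generators of a datum, whose members are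
homogeneous: `h` acts on the basis vector of `x` by `a_x` and the half-braiding is through
`e^{c_x h}`. -/
structure LetterBasis (F : Center (Cat κ)) (D : Datum) where
  basis : Module.Basis D.X ℂ (Vec F.1)
  homog : ∀ j, Homog F (D.a j) (D.c j) (basis j)

section Biproduct
variable {X Y Z : Cat κ}

/-- The underlying vector space of a direct sum, which is given by its injections and
projections. -/
def vecEquiv (i : X ⟶ Z) (j : Y ⟶ Z) (p : Z ⟶ X) (q : Z ⟶ Y) (hip : i ≫ p = 𝟙 X)
    (hiq : i ≫ q = 0) (hjp : j ≫ p = 0) (hjq : j ≫ q = 𝟙 Y) (htot : p ≫ i + q ≫ j = 𝟙 Z) :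
    Vec Z ≃ₗ[ℂ] Vec X × Vec Y where
  toLinearMap := (app p).prod (app q)
  invFun v := app i v.1 + app j v.2
  left_inv v := congrArg (fun k => app k v) htot
  right_inv v := by
    have h1 := congrArg (fun k => app k v.1) hip
    have h2 := congrArg (fun k => app k v.1) hiq
    have h3 := congrArg (fun k => app k v.2) hjp
    have h4 := congrArg (fun k => app k v.2) hjq
    simp only [app_comp, app_id, app_zero] at h1 h2 h3 h4
    refine Prod.ext ?_ ?_
    · change app p (app i v.1 + app j v.2) = _
      rw [map_add, h1, h3, add_zero]
    · change app q (app i v.1 + app j v.2) = _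
      rw [map_add, h2, h4, zero_add]

variable (i : X ⟶ Z) (j : Y ⟶ Z) (p : Z ⟶ X) (q : Z ⟶ Y) (hip : i ≫ p = 𝟙 X)
    (hiq : i ≫ q = 0) (hjp : j ≫ p = 0) (hjq : j ≫ q = 𝟙 Y) (htot : p ≫ i + q ≫ j = 𝟙 Z)

lemma vecEquiv_symm_left (v : Vec X) :
    (vecEquiv i j p q hip hiq hjp hjq htot).symm (v, 0) = app i v :=
  (congrArg (app i v + ·) (map_zero (app j))).trans (add_zero _)

lemma vecEquiv_symm_right (v : Vec Y) :
    (vecEquiv i j p q hip hiq hjp hjq htot).symm (0, v) = app j v :=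
  (congrArg (· + app j v) (map_zero (app i))).trans (zero_add _)

end Biproduct

lemma hact_char (α : ℂ) (v : Vec (Cat.char α : Cat κ)) : hact (Cat.char α) v = α • v :=
  LinearMap.congr_fun (Cat.charRep_h α) v

lemma app_braiding {X Y : Cat κ} {v : Vec X} {a : ℂ} (hv : hact X v = a • v) (w : Vec Y) :
    app (β_ X Y).hom (tm v w) = tm (eact Y (κ * a) w) v := by
  induction w using eig_induction with
  | add w w' hw hw' => simp only [tm_add, map_add, add_tm, hw, hw']
  | eig w l h =>
    rw [eact_eig _ h, smul_tm, mul_assoc]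
    exact Rep.braidLin_eig (Rep.span X) (Rep.span Y) κ hv h

lemma app_braiding_inv {X Y : Cat κ} {v : Vec X} {a : ℂ} (hv : hact X v = a • v) (w : Vec Y) :
    app (β_ Y X).inv (tm v w) = tm (eact Y (-(κ * a)) w) v := by
  induction w using eig_induction with
  | add w w' hw hw' => simp only [tm_add, map_add, add_tm, hw, hw']
  | eig w l h =>
    rw [eact_eig _ h, smul_tm, neg_mul_eq_neg_mul, mul_assoc]
    exact Rep.braidLin_eig (Rep.span X) (Rep.span Y) (-κ) hv h

lemma homog_centerPos {X : Cat κ} {v : Vec X} {a : ℂ} (hv : hact X v = a • v) :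
    Homog (centerPos X) a (κ * a) v :=
  ⟨hv, fun _ u => app_braiding hv u⟩

lemma homog_centerNeg {X : Cat κ} {v : Vec X} {a : ℂ} (hv : hact X v = a • v) :
    Homog (centerNeg X) a (-(κ * a)) v :=
  ⟨hv, fun _ u => app_braiding_inv hv u⟩

/-- Four numbers as a family indexed by two booleans. -/
def quadEquiv : ((ℂ × ℂ) × (ℂ × ℂ)) ≃ₗ[ℂ] (Bool × Bool → ℂ) where
  toFun v p := match p with
    | (true, false) => v.1.1
    | (false, false) => v.1.2
    | (true, true) => v.2.1
    | (false, true) => v.2.2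
  map_add' v w := by ext ⟨s, t⟩; cases s <;> cases t <;> rfl
  map_smul' c v := by ext ⟨s, t⟩; cases s <;> cases t <;> rfl
  invFun f := ((f (true, false), f (false, false)), (f (true, true), f (false, true)))
  left_inv _ := rfl
  right_inv f := by ext ⟨s, t⟩; cases s <;> cases t <;> rfl

variable (κ ω : ℂ)

/-- The coordinates on `F_ω`. -/
def fωEquiv : Vec (Fω κ ω) ≃ₗ[ℂ] Vec (Cat.char ω : Cat κ) × Vec (Cat.char (-ω) : Cat κ) :=
  vecEquiv biprod.inl biprod.inr biprod.fst biprod.snd biprod.inl_fst biprod.inl_snd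
    biprod.inr_fst biprod.inr_snd biprod.total

lemma hact_fω_pos (z : Vec (Cat.char ω : Cat κ)) :
    hact (Fω κ ω) ((fωEquiv κ ω).symm (z, 0)) = ω • (fωEquiv κ ω).symm (z, 0) := by
  have e : (fωEquiv κ ω).symm (z, 0) = app (Y := Fω κ ω) biprod.inl z :=
    vecEquiv_symm_left _ _ _ _ _ _ _ _ _ z
  rw [e]
  exact weight_map (Y := Fω κ ω) biprod.inl (hact_char ω z)

lemma hact_fω_neg (z : Vec (Cat.char (-ω) : Cat κ)) :
    hact (Fω κ ω) ((fωEquiv κ ω).symm (0, z)) = (-ω) • (fωEquiv κ ω).symm (0, z) := by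
  have e : (fωEquiv κ ω).symm (0, z) = app (Y := Fω κ ω) biprod.inr z :=
    vecEquiv_symm_right _ _ _ _ _ _ _ _ _ z
  rw [e]
  exact weight_map (Y := Fω κ ω) biprod.inr (hact_char (-ω) z)

/-- The coordinates on a direct sum in the centre. -/
def centerEquiv (A B : Center (Cat κ)) : Vec (A ⊞ B).1 ≃ₗ[ℂ] Vec A.1 × Vec B.1 :=
  vecEquiv (biprod.inl : A ⟶ A ⊞ B).f (biprod.inr : B ⟶ A ⊞ B).f (biprod.fst : A ⊞ B ⟶ A).f
    (biprod.snd : A ⊞ B ⟶ B).f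
    (congrArg Center.Hom.f (biprod.inl_fst (X := A) (Y := B)))
    (congrArg Center.Hom.f (biprod.inl_snd (X := A) (Y := B)))
    (congrArg Center.Hom.f (biprod.inr_fst (X := A) (Y := B)))
    (congrArg Center.Hom.f (biprod.inr_snd (X := A) (Y := B)))
    (congrArg Center.Hom.f (biprod.total (X := A) (Y := B)))

lemma homog_inl {A B : Center (Cat κ)} {v : Vec A.1} {a c : ℂ} (hv : Homog A a c v) :
    Homog (A ⊞ B) a c ((centerEquiv κ A B).symm (v, 0)) := by
  rw [centerEquiv, vecEquiv_symm_left]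
  exact hv.map _

lemma homog_inr {A B : Center (Cat κ)} {v : Vec B.1} {a c : ℂ} (hv : Homog B a c v) :
    Homog (A ⊞ B) a c ((centerEquiv κ A B).symm (0, v)) := by
  rw [centerEquiv, vecEquiv_symm_right]
  exact hv.map _

/-- The coordinates on `F`. -/
def bosonEquiv : Vec (bosonF κ ω).1 ≃ₗ[ℂ] Vec (Fω κ ω) × Vec (Fω κ ω) :=
  centerEquiv κ (centerPos (Fω κ ω)) (centerNeg (Fω κ ω))

lemma homog_boson_pos {v : Vec (Fω κ ω)} {a : ℂ} (hv : hact (Fω κ ω) v = a • v) :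
    Homog (bosonF κ ω) a (κ * a) ((bosonEquiv κ ω).symm (v, 0)) :=
  homog_inl κ (homog_centerPos hv)

lemma homog_boson_neg {v : Vec (Fω κ ω)} {a : ℂ} (hv : hact (Fω κ ω) v = a • v) :
    Homog (bosonF κ ω) a (-(κ * a)) ((bosonEquiv κ ω).symm (0, v)) :=
  homog_inr κ (homog_centerNeg hv)

/-- Four numbers as the coordinates with respect to the generators: the two summands of `F` carry
the generators `f^±` and `f̄^±`. -/
def bosonCoord : Vec (bosonF κ ω).1 ≃ₗ[ℂ] (Bool × Bool → ℂ) :=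
  (bosonEquiv κ ω).trans (((fωEquiv κ ω).prodCongr (fωEquiv κ ω)).trans quadEquiv)

lemma bosonCoord_symm (f : Bool × Bool → ℂ) : (bosonCoord κ ω).symm f =
    (bosonEquiv κ ω).symm ((fωEquiv κ ω).symm (f (true, false), f (false, false)),
      (fωEquiv κ ω).symm (f (true, true), f (false, true))) := rfl

/-- The generators `f^±`, `f̄^±` as a homogeneous basis of `F`. A vector of weight `a` in `F_ω` is
moved past `u` by `c_{F,-}` with the factor `e^{κ a h}` and by `c_{-,F}⁻¹` with the factor
`e^{-κ a h}`, which are the group-like factors of the coproducts of `f^±` and `f̄^±`. -/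
def bosonLetters : LetterBasis (bosonF κ ω) (bosonDatum κ ω) where
  basis := Module.Basis.ofEquivFun (ι := Bool × Bool) (bosonCoord κ ω)
  homog := by
    have e : ∀ p : Bool × Bool, Homog (bosonF κ ω) (sgn p.1 * ω)
        (if p.2 then -(sgn p.1 * κ * ω) else sgn p.1 * κ * ω)
        ((bosonCoord κ ω).symm (Pi.single p 1)) := by
      have hz : (fωEquiv κ ω).symm ((0 : ℂ), (0 : ℂ)) = 0 := map_zero (fωEquiv κ ω).symm
      have o : ∀ p q : Bool × Bool, (Pi.single p 1 : Bool × Bool → ℂ) q = if q = p then 1 else 0 :=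
        fun p q => Pi.single_apply p 1 q
      rintro ⟨s, t⟩
      rw [bosonCoord_symm]
      cases s <;> cases t <;>
        simp only [o, Prod.mk.injEq, Bool.true_eq_false, Bool.false_eq_true, and_true, and_false,
          and_self, if_true, if_false, hz, sgn]
      · convert homog_boson_pos κ ω (hact_fω_neg κ ω (1 : ℂ)) using 1
        exacts [by ring, by ring, rfl]
      · convert homog_boson_neg κ ω (hact_fω_neg κ ω (1 : ℂ)) using 1
        exacts [by ring, by ring, rfl]
      · convert homog_boson_pos κ ω (hact_fω_pos κ ω (1 : ℂ)) using 1
        exacts [by ring, by ring, rfl]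
      · convert homog_boson_neg κ ω (hact_fω_pos κ ω (1 : ℂ)) using 1
        exacts [by ring, by ring, rfl]
    intro p
    have e' : Module.Basis.ofEquivFun (ι := Bool × Bool) (bosonCoord κ ω) p =
        (bosonCoord κ ω).symm (Pi.single p 1) :=
      congrFun (Module.Basis.coe_ofEquivFun (ι := Bool × Bool) (bosonCoord κ ω)) p
    exact e' ▸ e p

end Letters

/-! ### Representations from the action of the generators -/

section Generators

variable (D : Datum) (V : ModuleCat.{0} ℂ) (T : Module.End ℂ V) (S : D.X → Module.End ℂ V)
  (hrel : ∀ j v, T (S j v) = S j (T v) + D.a j • S j v) (hs : eigSpan T = ⊤)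

include hrel hs in
/-- The action of the words extends to the completion: a generator `x` shifts weights, so that the
series in `h` are evaluated at finitely many weights. -/
lemma genAct_good (v : V) :
    Good (Word.lift (Sum.elim (fun _ : Unit => T) S) fun _ _ => rfl) v :=
  good_of_span (Sum.elim (fun _ : Unit => T) S) (fun _ _ => rfl) (fun j _ => D.a j)
    (fun _ j v => hrel j v) (by
      have : {v : V | ∀ h : Unit, ∃ l : ℂ, Sum.elim (fun _ : Unit => T) S (Sum.inl h) v = l • v} =
          {v | ∃ l : ℂ, T v = l • v} := by
        ext v; exact ⟨fun h => h (), fun h _ => h⟩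
      rw [this]; exact hs) v

/-- The action of the algebra which is determined by a diagonalisable action of `h` and an action of
the generators `x` which satisfies the relations: the series converge as `x` shifts the weights. -/
def genAct : Bialg D →ₐ[ℂ] Module.End ℂ V :=
  TopQuot.lift (weakExt (genAct_good D V T S hrel hs))
    (weakExt_cont (genAct_good D V T S hrel hs)).isClosed_ker (by
      rintro _ ⟨j, rfl⟩
      have e : ∀ g, weakExt (genAct_good D V T S hrel hs) (K.of (Word.gen g)) =
        Sum.elim (fun _ : Unit => T) S g := fun g => (weakExt_of _ _).trans (Word.lift_gen _ _ _)
      rw [map_sub, map_sub, map_smul, map_mul, map_mul, EAlg.h, EAlg.x, e, e, sub_sub, sub_eq_zero]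
      exact LinearMap.ext fun v => hrel j v)

lemma genAct_h : genAct D V T S hrel hs (Bialg.h D) = T :=
  (TopQuot.lift_mk _ _ _ _).trans ((weakExt_of _ _).trans (Word.lift_gen _ _ _))

lemma genAct_x (j : D.X) : genAct D V T S hrel hs (Bialg.x D j) = S j :=
  (TopQuot.lift_mk _ _ _ _).trans ((weakExt_of _ _).trans (Word.lift_gen _ _ _))

lemma genAct_cont : WeakCont (genAct D V T S hrel hs) := fun v φ =>
  TopQuot.continuous_iff.2 (weakExt_cont (genAct_good D V T S hrel hs) v φ)

/-- The representation which is determined by the action of the generators. -/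
def Rep.ofGen : Rep D :=
  Rep.ofSpan V (genAct D V T S hrel hs) (genAct_cont D V T S hrel hs)
    (by rw [genAct_h]; exact hs)

end Generators

/-! ### The tensor algebra as an algebra in the centre -/

section Free
variable {κ : ℂ} (D : Datum)

/-- The weight of a word in the generators. -/
def wordA (w : List D.X) : ℂ := (w.map D.a).sum

/-- The exponent by which the half-braiding acts on a word in the generators. -/
def wordC (w : List D.X) : ℂ := (w.map D.c).sum

lemma wordA_nil : wordA D [] = 0 := rfl
lemma wordC_nil : wordC D [] = 0 := rfl
lemma wordA_append (w w' : List D.X) : wordA D (w ++ w') = wordA D w + wordA D w' := by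
  simp [wordA]
lemma wordC_append (w w' : List D.X) : wordC D (w ++ w') = wordC D w + wordC D w' := by
  simp [wordC]
lemma wordA_single (j : D.X) : wordA D [j] = D.a j := by simp [wordA]
lemma wordC_single (j : D.X) : wordC D [j] = D.c j := by simp [wordC]

/-- The diagonal action of `h` on the span of the words. -/
def wordH : Module.End ℂ (List D.X →₀ ℂ) :=
  Finsupp.linearCombination ℂ fun w => wordA D w • Finsupp.single w 1

lemma wordH_single (w : List D.X) :
    wordH D (Finsupp.single w 1) = wordA D w • Finsupp.single w 1 := by
  rw [wordH, Finsupp.linearCombination_single, one_smul]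

lemma span_single {J : Type} :
    Submodule.span ℂ (Set.range fun w : J => (Finsupp.single w 1 : J →₀ ℂ)) = ⊤ := by
  rw [← Finsupp.coe_basisSingleOne]
  exact Module.Basis.span_eq _

lemma wordH_span : eigSpan (wordH D) = ⊤ := by
  rw [eq_top_iff, ← span_single]
  refine Submodule.span_mono ?_
  rintro _ ⟨w, rfl⟩
  exact ⟨_, wordH_single D w⟩

variable (κ) in
/-- The span of the words in the generators, i.e. the tensor algebra of `F` in terms of a basis,
with the diagonal action of `h`. -/
def freeCat : Cat κ :=
  Rep.ofGen Datum.empty (ModuleCat.of ℂ (List D.X →₀ ℂ)) (wordH D) (fun j => j.elim)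
    (fun j => j.elim) (wordH_span D)

variable (κ) in
/-- A word as a vector. -/
def word (w : List D.X) : Vec (freeCat κ D) := Finsupp.single (M := ℂ) w 1

lemma span_word : Submodule.span ℂ (Set.range (word κ D)) = ⊤ :=
  span_single

lemma hact_word (w : List D.X) : hact (freeCat κ D) (word κ D w) = wordA D w • word κ D w :=
  (LinearMap.congr_fun (genAct_h Datum.empty (ModuleCat.of ℂ (List D.X →₀ ℂ)) (wordH D)
    (fun j => j.elim) (fun j => j.elim) (wordH_span D)) _).trans (wordH_single D w)

variable {D}

/-- The linear map with given values on the words. -/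
def liftWord {V : Type} [AddCommGroup V] [Module ℂ V] (y : List D.X → V) :
    Vec (freeCat κ D) →ₗ[ℂ] V := Finsupp.linearCombination ℂ y

@[simp] lemma liftWord_word {V : Type} [AddCommGroup V] [Module ℂ V] (y : List D.X → V)
    (w : List D.X) : liftWord y (word κ D w) = y w :=
  (Finsupp.linearCombination_single ℂ _ _).trans (one_smul ℂ _)

section HalfBraiding
variable (U : Cat κ)

/-- The half-braiding `w ⊗ u ↦ e^{c_w h} u ⊗ w` of the span of the words. -/
def freeHb : freeCat κ D ⊗ U ⟶ U ⊗ freeCat κ D :=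
  mkTm (liftWord fun w => (tmₗ U _).flip (word κ D w) ∘ₗ eact U (wordC D w)) <|
    derivation_of_span_left (span_word D) _ fun w u => by
      simp [hact_word, hact_tm, tm_smul, eact_hact, add_comm]

@[simp] lemma app_freeHb (w : List D.X) (u : Vec U) :
    app (freeHb U) (tm (word κ D w) u) = tm (eact U (wordC D w) u) (word κ D w) := by
  simp [freeHb]

/-- The inverse of the half-braiding of the span of the words. -/
def freeHbInv : U ⊗ freeCat κ D ⟶ freeCat κ D ⊗ U :=
  mkTm (liftWord fun w => tmₗ _ U (word κ D w) ∘ₗ eact U (-wordC D w)).flip <|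
    derivation_of_span_right (span_word D) _ fun u w => by
      simp [hact_word, hact_tm, smul_tm, eact_hact, add_comm]

@[simp] lemma app_freeHbInv (w : List D.X) (u : Vec U) :
    app (freeHbInv U) (tm u (word κ D w)) = tm (word κ D w) (eact U (-wordC D w) u) := by
  simp [freeHbInv]

end HalfBraiding

variable (κ D) in
/-- The span of the words as an object of the centre. -/
def freeCenter : Center (Cat κ) :=
  ⟨freeCat κ D,
    { β := fun U =>
        { hom := freeHb U
          inv := freeHbInv U
          hom_inv_id := hom_ext_span_left (span_word D) fun w u => by
            simp only [app_comp, app_freeHb, app_freeHbInv, eact_neg', app_id]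
          inv_hom_id := hom_ext_span_right (span_word D) fun u w => by
            simp only [app_comp, app_freeHb, app_freeHbInv, eact_neg, app_id] }
      monoidal := fun U U' => hom_ext_span_left (span_word D) fun w x => by
        induction x using tm_induction with
        | zero => simp only [tm_zero, map_zero]
        | add x y hx hy => simp only [tm_add, map_add, hx, hy]
        | tmul u u' =>
          simp only [app_comp, app_freeHb, app_assoc_inv, app_whiskerRight, app_assoc,
            app_whiskerLeft, eact_tm]
      naturality := fun f => hom_ext_span_left (span_word D) fun w u => by
        simp only [app_comp, app_freeHb, app_whiskerRight, app_whiskerLeft, app_eact] }⟩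

lemma homog_word (w : List D.X) :
    Homog (freeCenter κ D) (wordA D w) (wordC D w) (word κ D w) :=
  ⟨hact_word D w, fun U u => app_freeHb U w u⟩

/-- The multiplication of words is the concatenation. -/
def freeMulC : freeCat κ D ⊗ freeCat κ D ⟶ freeCat κ D :=
  mkTm (liftWord fun w => liftWord fun w' => word κ D (w ++ w')) <|
    derivation_of_span (span_word D) (span_word D) _ fun w w' => by
      simp [hact_word, wordA_append, add_smul]

@[simp] lemma app_freeMulC (w w' : List D.X) :
    app freeMulC (tm (word κ D w) (word κ D w')) = word κ D (w ++ w') := by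
  simp [freeMulC]

/-- The unit is the empty word. -/
def freeOneC : 𝟙_ (Cat κ) ⟶ freeCat κ D :=
  mkOne (word κ D []) (by rw [hact_word, wordA_nil, zero_smul])

@[simp] lemma app_freeOneC : app (freeOneC (κ := κ) (D := D)) one' = word κ D [] := app_mkOne _ _

lemma freeOneC_mul : (freeOneC ▷ freeCat κ D) ≫ freeMulC = (λ_ (freeCat κ D)).hom :=
  hom_ext_span (span_tm span_one (span_word D)) fun p => by
    simp only [app_comp, app_whiskerRight, app_leftUnitor_one, app_freeOneC, app_freeMulC,
      List.nil_append]

lemma freeMulC_one : (freeCat κ D ◁ freeOneC) ≫ freeMulC = (ρ_ (freeCat κ D)).hom :=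
  hom_ext_span (span_tm (span_word D) span_one) fun p => by
    simp only [app_comp, app_whiskerLeft, app_rightUnitor_one, app_freeOneC, app_freeMulC,
      List.append_nil]

lemma freeMulC_assoc : (freeMulC ▷ freeCat κ D) ≫ freeMulC =
    (α_ (freeCat κ D) (freeCat κ D) (freeCat κ D)).hom ≫ freeCat κ D ◁ freeMulC ≫ freeMulC :=
  hom_ext_span (span_tm (span_tm (span_word D) (span_word D)) (span_word D)) fun p => by
    simp only [app_comp, app_whiskerRight, app_assoc, app_whiskerLeft, app_freeMulC,
      List.append_assoc]

instance : MonObj (freeCenter κ D) where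
  one := mkCenter (A := 𝟙_ (Center (Cat κ))) (B := freeCenter κ D) (a := fun _ => 0)
    (c := fun _ => 0) span_one (fun _ => Homog.one) freeOneC fun _ => by
      exact (app_freeOneC (κ := κ) (D := D)).symm ▸ homog_word (κ := κ) (D := D) []
  mul := mkCenter (A := freeCenter κ D ⊗ freeCenter κ D) (B := freeCenter κ D)
    (span_tm (span_word D) (span_word D)) (fun p => (homog_word p.1).tm (homog_word p.2)) freeMulC
    fun p => by
      rw [← wordA_append, ← wordC_append]
      exact (app_freeMulC (κ := κ) p.1 p.2).symm ▸ homog_word (κ := κ) (p.1 ++ p.2)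
  one_mul := Center.ext _ _ freeOneC_mul
  mul_one := Center.ext _ _ freeMulC_one
  mul_assoc := Center.ext _ _ freeMulC_assoc

end Free

/-! ### The universal property of the tensor algebra -/

section Universal
open MonObj
variable {κ : ℂ} {D : Datum}

section Products
variable {A : Cat κ} [MonObj A]

lemma app_one_mul (a : Vec A) : app μ[A] (tm (app η[A] one') a) = a := by
  have := congrArg (fun k => app k (tm one' a)) (one_mul A)
  simpa only [app_comp, app_whiskerRight, app_leftUnitor_one] using this

lemma app_mul_one (a : Vec A) : app μ[A] (tm a (app η[A] one')) = a := by
  have := congrArg (fun k => app k (tm a one')) (mul_one A)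
  simpa only [app_comp, app_whiskerLeft, app_rightUnitor_one] using this

lemma app_mul_assoc (a b c : Vec A) :
    app μ[A] (tm (app μ[A] (tm a b)) c) = app μ[A] (tm a (app μ[A] (tm b c))) := by
  have := congrArg (fun k => app k (tm (tm a b) c)) (mul_assoc A)
  simpa only [app_comp, app_whiskerRight, app_assoc, app_whiskerLeft] using this

variable (y : D.X → Vec A)

/-- The product in `A` of the values `y` of the letters of a word. -/
def wordProd : List D.X → Vec A
  | [] => app η[A] one'
  | j :: w => app μ[A] (tm (y j) (wordProd w))

lemma wordProd_append (w w' : List D.X) :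
    wordProd y (w ++ w') = app μ[A] (tm (wordProd y w) (wordProd y w')) := by
  induction w with
  | nil => rw [List.nil_append, wordProd, app_one_mul]
  | cons j w ih => rw [List.cons_append, wordProd, ih, wordProd, app_mul_assoc]

variable {y}

lemma hact_wordProd (hy : ∀ j, hact A (y j) = D.a j • y j) (w : List D.X) :
    hact A (wordProd y w) = wordA D w • wordProd y w := by
  induction w with
  | nil => rw [wordProd, ← app_hact, hact_one, map_zero, wordA_nil, zero_smul]
  | cons j w ih =>
    rw [wordProd, ← app_hact, hact_tm, hy, ih, smul_tm, tm_smul, ← add_smul, map_smul]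
    rfl

/-- The homomorphism of algebras which is determined by the values of the letters. -/
def freeLift (hy : ∀ j, hact A (y j) = D.a j • y j) : freeCat κ D ⟶ A :=
  mkSpan (span_word D) (wordA D) (liftWord (wordProd y)) (hact_word D) fun w => by
    rw [liftWord_word, hact_wordProd hy]

@[simp] lemma app_freeLift (hy : ∀ j, hact A (y j) = D.a j • y j) (w : List D.X) :
    app (freeLift hy) (word κ D w) = wordProd y w := by
  rw [freeLift, app_mkSpan, liftWord_word]

lemma one_freeLift (hy : ∀ j, hact A (y j) = D.a j • y j) : freeOneC ≫ freeLift hy = η[A] :=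
  hom_ext_one (by rw [app_comp, app_freeOneC, app_freeLift, wordProd])

lemma mul_freeLift (hy : ∀ j, hact A (y j) = D.a j • y j) :
    freeMulC ≫ freeLift hy = (freeLift hy ⊗ₘ freeLift hy) ≫ μ[A] :=
  hom_ext_span (span_tm (span_word D) (span_word D)) fun p => by
    simp only [app_comp, app_freeMulC, app_freeLift, app_tensor, wordProd_append]

/-- A homomorphism of algebras on the tensor algebra is determined by its values on the letters. -/
lemma app_of_mul {g : freeCat κ D ⟶ A} (h1 : freeOneC ≫ g = η[A])
    (h2 : freeMulC ≫ g = (g ⊗ₘ g) ≫ μ[A]) (w : List D.X) :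
    app g (word κ D w) = wordProd (fun j => app g (word κ D [j])) w := by
  induction w with
  | nil => rw [wordProd, ← h1, app_comp, app_freeOneC]
  | cons j w ih =>
    have := congrArg (fun k => app k (tm (word κ D [j]) (word κ D w))) h2
    simp only [app_comp, app_freeMulC, app_tensor] at this
    rw [wordProd, ← ih, ← this, List.singleton_append]

end Products

section Center
variable {B : Center (Cat κ)} [MonObj B]

variable (B) in
/-- The algebra in `Cat κ` underlying an algebra in the centre. -/
@[reducible] def centerMon : MonObj B.1 where
  one := (η[B]).f
  mul := (μ[B]).f
  one_mul := congrArg Center.Hom.f (MonObj.one_mul B)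
  mul_one := congrArg Center.Hom.f (MonObj.mul_one B)
  mul_assoc := congrArg Center.Hom.f (MonObj.mul_assoc B)

lemma homog_wordProd {y : D.X → Vec B.1} (hy : ∀ j, Homog B (D.a j) (D.c j) (y j))
    (w : List D.X) :
    Homog B (wordA D w) (wordC D w) (@wordProd κ D B.1 (centerMon B) y w) := by
  induction w with
  | nil => exact Homog.one.map η[B]
  | cons j w ih =>
    have := ((hy j).tm ih).map μ[B]
    rwa [← wordA_single D j, ← wordC_single D j, ← wordA_append, ← wordC_append] at this

/-- A homogeneous family in an algebra `B` of the centre extends to a homomorphism of algebras in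
the centre out of the tensor algebra: the products of homogeneous elements are homogeneous. -/
lemma exists_centerLift {y : D.X → Vec B.1} (hy : ∀ j, Homog B (D.a j) (D.c j) (y j)) :
    ∃ g : freeCenter κ D ⟶ B, IsMonHom g ∧ ∀ j, app g.f (word κ D [j]) = y j := by
  let : MonObj B.1 := centerMon B
  refine ⟨mkCenter (A := freeCenter κ D) (span_word D) homog_word
    (freeLift fun j => (hy j).weight) fun w => ?_, ⟨?_, ?_⟩, fun j => ?_⟩
  · exact (app_freeLift (fun j => (hy j).weight) w).symm ▸ homog_wordProd hy w
  · exact Center.ext _ _ (one_freeLift fun j => (hy j).weight)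
  · exact Center.ext _ _ (mul_freeLift fun j => (hy j).weight)
  · exact (app_freeLift (fun j => (hy j).weight) [j]).trans (app_mul_one (y j))

/-- Homomorphisms of algebras out of the tensor algebra agree when they agree on the letters. The
coalgebra axioms follow, as their two sides are homomorphisms of algebras in the centre. -/
lemma center_hom_ext {g g' : freeCenter κ D ⟶ B} [hg : IsMonHom g] [hg' : IsMonHom g']
    (h : ∀ j, app g.f (word κ D [j]) = app g'.f (word κ D [j])) : g = g' := by
  let : MonObj B.1 := centerMon B
  refine Center.ext _ _ (hom_ext_span (span_word D) fun w => ?_)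
  have e1 := app_of_mul (A := B.1) (g := g.f) (congrArg Center.Hom.f hg.one_hom)
    (congrArg Center.Hom.f hg.mul_hom) w
  have e2 := app_of_mul (A := B.1) (g := g'.f) (congrArg Center.Hom.f hg'.one_hom)
    (congrArg Center.Hom.f hg'.mul_hom) w
  rw [e1, e2]
  exact congrArg (fun y => wordProd y w) (funext h)

end Center
end Universal

/-! ### The bialgebra structure -/

section Bialgebra
open MonObj ComonObj
variable {κ : ℂ} {D : Datum}

lemma Homog.add {B : Center (Cat κ)} {a c : ℂ} {b b' : Vec B.1} (h : Homog B a c b)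
    (h' : Homog B a c b') : Homog B a c (b + b') :=
  ⟨by rw [map_add, h.weight, h'.weight, smul_add], fun U u => by
    rw [add_tm, map_add, h.braid, h'.braid, tm_add]⟩

lemma Homog.zero {B : Center (Cat κ)} {a c : ℂ} : Homog B a c 0 :=
  ⟨by rw [map_zero, smul_zero], fun U u => by rw [zero_tm, map_zero, tm_zero]⟩

variable (κ) in
/-- The value `x ⊗ 1 + 1 ⊗ x` of the coproduct on a letter. -/
def primitive (j : D.X) : Vec (freeCat κ D ⊗ freeCat κ D) :=
  tm (word κ D [j]) (word κ D []) + tm (word κ D []) (word κ D [j])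

/-- The value of the coproduct on a letter has the bidegree of the letter, so that the coproduct is
a morphism of the centre. -/
lemma homog_primitive (j : D.X) :
    Homog (freeCenter κ D ⊗ freeCenter κ D) (D.a j) (D.c j) (primitive κ j) := by
  have h1 := (homog_word (κ := κ) (D := D) [j]).tm (homog_word (κ := κ) (D := D) [])
  have h2 := (homog_word (κ := κ) (D := D) []).tm (homog_word (κ := κ) (D := D) [j])
  rw [wordA_single, wordC_single, wordA_nil, wordC_nil] at h1 h2
  rw [add_zero, add_zero] at h1
  rw [zero_add, zero_add] at h2
  exact h1.add h2

variable (κ D) in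
/-- The coproduct: the homomorphism of algebras in the centre with `x ↦ x ⊗ 1 + 1 ⊗ x`. -/
def freeComul : freeCenter κ D ⟶ freeCenter κ D ⊗ freeCenter κ D :=
  (exists_centerLift homog_primitive).choose

instance : IsMonHom (freeComul κ D) := (exists_centerLift homog_primitive).choose_spec.1

variable (κ D) in
/-- The counit: the homomorphism of algebras in the centre with `x ↦ 0`. -/
def freeCounit : freeCenter κ D ⟶ 𝟙_ (Center (Cat κ)) :=
  (exists_centerLift (y := fun _ => 0) fun _ => Homog.zero).choose

instance : IsMonHom (freeCounit κ D) :=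
  (exists_centerLift (y := fun _ => 0) fun _ => Homog.zero).choose_spec.1

variable (κ D) in
/-- The coproduct as a morphism of `Cat κ`. -/
def comulC : freeCat κ D ⟶ freeCat κ D ⊗ freeCat κ D := (freeComul κ D).f

variable (κ D) in
/-- The counit as a morphism of `Cat κ`. -/
def counitC : freeCat κ D ⟶ 𝟙_ (Cat κ) := (freeCounit κ D).f

lemma app_comulC (j : D.X) : app (comulC κ D) (word κ D [j]) =
    tm (word κ D [j]) (word κ D []) + tm (word κ D []) (word κ D [j]) :=
  (exists_centerLift homog_primitive).choose_spec.2 j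

lemma app_counitC (j : D.X) : app (counitC κ D) (word κ D [j]) = 0 :=
  (exists_centerLift (y := fun _ => 0) fun _ => Homog.zero).choose_spec.2 j

lemma app_comulC_nil : app (comulC κ D) (word κ D []) = tm (word κ D []) (word κ D []) := by
  have h := congrArg Center.Hom.f (IsMonHom.one_hom (freeComul κ D))
  rw [MonObj.tensorObj.one_def, Center.comp_f, Center.comp_f, Center.tensor_f,
    Center.leftUnitor_inv_f] at h
  have h' : freeOneC ≫ comulC κ D = (λ_ (𝟙_ (Cat κ))).inv ≫ (freeOneC ⊗ₘ freeOneC) := h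
  have := congrArg (fun k => app k one') h'
  simpa only [app_comp, app_freeOneC, app_leftUnitor_inv, app_tensor] using this

lemma app_counitC_nil : app (counitC κ D) (word κ D []) = one' := by
  have h' : freeOneC ≫ counitC κ D = 𝟙 _ :=
    congrArg Center.Hom.f (IsMonHom.one_hom (freeCounit κ D))
  have := congrArg (fun k => app k one') h'
  simpa only [app_comp, app_freeOneC, app_id] using this

lemma freeCounit_comul :
    freeComul κ D ≫ freeCounit κ D ▷ freeCenter κ D = (λ_ (freeCenter κ D)).inv :=
  center_hom_ext fun j => by
    rw [Center.leftUnitor_inv_f]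
    change app (comulC κ D ≫ counitC κ D ▷ freeCat κ D) _ = app (λ_ (freeCat κ D)).inv _
    simp only [app_comp, app_comulC, map_add, app_whiskerRight, app_counitC, app_counitC_nil,
      zero_tm, zero_add, app_leftUnitor_inv]

lemma comul_freeCounit :
    freeComul κ D ≫ freeCenter κ D ◁ freeCounit κ D = (ρ_ (freeCenter κ D)).inv :=
  center_hom_ext fun j => by
    rw [Center.rightUnitor_inv_f]
    change app (comulC κ D ≫ freeCat κ D ◁ counitC κ D) _ = app (ρ_ (freeCat κ D)).inv _
    simp only [app_comp, app_comulC, map_add, app_whiskerLeft, app_counitC, app_counitC_nil,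
      tm_zero, add_zero, app_rightUnitor_inv]

lemma freeComul_assoc : freeComul κ D ≫ freeCenter κ D ◁ freeComul κ D =
    freeComul κ D ≫ freeComul κ D ▷ freeCenter κ D ≫
      (α_ (freeCenter κ D) (freeCenter κ D) (freeCenter κ D)).hom :=
  center_hom_ext fun j => by
    change app (comulC κ D ≫ freeCat κ D ◁ comulC κ D) _ =
      app (comulC κ D ≫ comulC κ D ▷ freeCat κ D ≫
        (α_ (freeCat κ D) (freeCat κ D) (freeCat κ D)).hom) _
    simp only [app_comp, app_comulC, app_comulC_nil, map_add, app_whiskerLeft, app_whiskerRight,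
      tm_add, add_tm, app_assoc]
    abel

instance : ComonObj (freeCenter κ D) where
  counit := freeCounit κ D
  comul := freeComul κ D
  counit_comul := freeCounit_comul
  comul_counit := comul_freeCounit
  comul_assoc := freeComul_assoc

instance : BimonObj (freeCenter κ D) where
  mul_comul := IsMonHom.mul_hom (freeComul κ D)
  one_comul := IsMonHom.one_hom (freeComul κ D)
  mul_counit := IsMonHom.mul_hom (freeCounit κ D)
  one_counit := IsMonHom.one_hom (freeCounit κ D)

/-! ### The existence of the tensor algebra -/

section Existence

/-- The morphism with given values on a basis of weight vectors. -/
def mkBasis {J : Type} {X Y : Cat κ} (b : Module.Basis J ℂ (Vec X)) {a : J → ℂ}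
    (hb : ∀ j, hact X (b j) = a j • b j) {y : J → Vec Y} (hy : ∀ j, hact Y (y j) = a j • y j) :
    X ⟶ Y :=
  mkSpan b.span_eq a (b.constr ℂ y) hb fun j => by rw [b.constr_basis, hy]

@[simp] lemma app_mkBasis {J : Type} {X Y : Cat κ} (b : Module.Basis J ℂ (Vec X)) {a : J → ℂ}
    (hb : ∀ j, hact X (b j) = a j • b j) {y : J → Vec Y} (hy : ∀ j, hact Y (y j) = a j • y j)
    (j : J) : app (mkBasis b hb hy) (b j) = y j :=
  b.constr_basis _ _ _

variable {F : Center (Cat κ)} (L : LetterBasis F D)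

lemma LetterBasis.weight (j : D.X) : hact F.1 (L.basis j) = D.a j • L.basis j := (L.homog j).weight

lemma hact_letter (j : D.X) : hact (freeCat κ D) (word κ D [j]) = D.a j • word κ D [j] := by
  rw [hact_word, wordA_single]

/-- The inclusion of `F` into the tensor algebra, in `Cat κ`. -/
def LetterBasis.inclC : F.1 ⟶ freeCat κ D := mkBasis L.basis L.weight hact_letter

lemma LetterBasis.app_inclC (j : D.X) : app L.inclC (L.basis j) = word κ D [j] :=
  app_mkBasis _ _ _ j

/-- The inclusion of `F` into the tensor algebra. -/
def LetterBasis.incl : F ⟶ freeCenter κ D :=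
  mkCenter (A := F) (B := freeCenter κ D) (s := L.basis) L.basis.span_eq L.homog L.inclC
    fun j => by
      have h := homog_word (κ := κ) (D := D) [j]
      rw [wordA_single, wordC_single] at h
      exact (L.app_inclC j).symm ▸ h

include L in
lemma LetterBasis.nonempty_tensorAlg : Nonempty (TensorAlg F) := by
  refine ⟨⟨freeCenter κ D, L.incl, fun A _ f => ?_, ?_, ?_⟩⟩
  · have hy : ∀ j, hact A (app f (L.basis j)) = D.a j • app f (L.basis j) := fun j =>
      weight_map f (L.weight j)
    refine ⟨freeLift hy, ⟨one_freeLift hy, mul_freeLift hy, ?_⟩, ?_⟩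
    · refine hom_ext_span L.basis.span_eq fun j => ?_
      exact (congrArg (app (freeLift hy)) (L.app_inclC j)).trans
        ((app_freeLift hy [j]).trans (app_mul_one _))
    · rintro g ⟨h1, h2, h3⟩
      refine hom_ext_span (span_word D) fun w => ?_
      rw [app_freeLift, app_of_mul h1 h2]
      refine congrArg (fun y => wordProd y w) (funext fun j => ?_)
      rw [← h3]
      exact (congrArg (app g) (L.app_inclC j)).symm
  · refine Center.ext _ _ (hom_ext_span L.basis.span_eq fun j => ?_)
    have e1 : ((ρ_ F).inv ≫ (L.incl ⊗ₘ η[freeCenter κ D])).f =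
        (ρ_ F.1).inv ≫ (L.inclC ⊗ₘ freeOneC) := by
      rw [Center.comp_f, Center.tensor_f, Center.rightUnitor_inv_f]
      rfl
    have e2 : ((λ_ F).inv ≫ (η[freeCenter κ D] ⊗ₘ L.incl)).f =
        (λ_ F.1).inv ≫ (freeOneC ⊗ₘ L.inclC) := by
      rw [Center.comp_f, Center.tensor_f, Center.leftUnitor_inv_f]
      rfl
    have e : app (L.inclC ≫ comulC κ D) (L.basis j) = app ((ρ_ F.1).inv ≫ (L.inclC ⊗ₘ freeOneC) +
        (λ_ F.1).inv ≫ (freeOneC ⊗ₘ L.inclC)) (L.basis j) := by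
      simp only [app_comp, app_add, L.app_inclC, app_comulC, app_rightUnitor_inv,
        app_leftUnitor_inv, app_tensor, app_freeOneC]
    exact e.trans (congrArg (fun k => app k (L.basis j)) (congrArg₂ (· + ·) e1 e2)).symm
  · refine Center.ext _ _ (hom_ext_span L.basis.span_eq fun j => ?_)
    exact (congrArg (app (counitC κ D)) (L.app_inclC j)).trans (app_counitC j)

end Existence
end Bialgebra

/-! ### Modules over the tensor algebra -/

section Modules
open MonObj ComonObj
variable {κ : ℂ} {D : Datum} {F : Center (Cat κ)} (L : LetterBasis F D)

section Action
variable {X : Cat κ} (m : F.1 ⊗ X ⟶ X)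

/-- The operator on `X` by which a letter acts through `m : F ⊗ X ⟶ X`. -/
def LetterBasis.op (j : D.X) : Module.End ℂ (Vec X) := app m ∘ₗ tmₗ F.1 X (L.basis j)

lemma LetterBasis.op_apply (j : D.X) (v : Vec X) : L.op m j v = app m (tm (L.basis j) v) := rfl

lemma LetterBasis.hact_op (j : D.X) (v : Vec X) :
    hact X (L.op m j v) = L.op m j (hact X v) + D.a j • L.op m j v := by
  rw [L.op_apply, ← app_hact, hact_tm, L.weight, smul_tm, map_add, map_smul, add_comm]
  rfl

/-- The action of words. -/
def LetterBasis.wordOp (w : List D.X) : Module.End ℂ (Vec X) := (w.map (L.op m)).prod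

lemma LetterBasis.hact_wordOp (w : List D.X) (v : Vec X) :
    hact X (L.wordOp m w v) = L.wordOp m w (hact X v) + wordA D w • L.wordOp m w v := by
  induction w with
  | nil => simp [LetterBasis.wordOp, wordA]
  | cons j w ih =>
    have e : ∀ v, L.wordOp m (j :: w) v = L.op m j (L.wordOp m w v) := fun v => by
      simp [LetterBasis.wordOp]
    rw [e, e, L.hact_op, ih, map_add, map_smul, add_assoc, ← add_smul, add_comm (wordA D w)]
    rfl

/-- The action of the span of the words which extends `m : F ⊗ X ⟶ X`. -/
def LetterBasis.freeAct : freeCat κ D ⊗ X ⟶ X :=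
  mkTm (liftWord (L.wordOp m)) <| derivation_of_span_left (span_word D) _ fun w v => by
    rw [hact_word, map_smul, liftWord_word, L.hact_wordOp, LinearMap.smul_apply, add_comm]

lemma LetterBasis.app_freeAct (w : List D.X) (v : Vec X) :
    app (L.freeAct m) (tm (word κ D w) v) = L.wordOp m w v := by
  rw [LetterBasis.freeAct, app_mkTm, liftWord_word]

lemma LetterBasis.one_freeAct : freeOneC ▷ X ≫ L.freeAct m = (λ_ X).hom :=
  hom_ext_span_left span_one fun _ v => by
    rw [app_comp, app_whiskerRight, app_freeOneC, L.app_freeAct, app_leftUnitor_one]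
    rfl

lemma LetterBasis.mul_freeAct : freeMulC ▷ X ≫ L.freeAct m =
    (α_ (freeCat κ D) (freeCat κ D) X).hom ≫ freeCat κ D ◁ L.freeAct m ≫ L.freeAct m :=
  hom_ext_span_left (span_tm (span_word D) (span_word D)) fun p v => by
    simp only [app_comp, app_whiskerRight, app_freeMulC, L.app_freeAct, app_assoc,
      app_whiskerLeft, LetterBasis.wordOp, List.map_append, List.prod_append,
      Module.End.mul_apply]

lemma LetterBasis.incl_freeAct : L.inclC ▷ X ≫ L.freeAct m = m :=
  hom_ext_span_left L.basis.span_eq fun j v => by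
    rw [app_comp, app_whiskerRight, L.app_inclC, L.app_freeAct, LetterBasis.wordOp,
      List.map_singleton, List.prod_singleton, L.op_apply]

end Action

variable (S : TensorAlg F)

/-- The span of the words as an algebra in `Cat κ`. -/
@[reducible] def freeMon : MonObj (freeCat κ D) := centerMon (freeCenter κ D)

/-- The words in an arbitrary tensor algebra: the products of the images of the basis of `F`. -/
def LetterBasis.tword (w : List D.X) : Vec S.T.1 :=
  @wordProd κ D S.T.1 (centerMon S.T) (fun j => app S.incl.f (L.basis j)) w

/-- The homomorphism of algebras from an arbitrary tensor algebra to the span of the words. -/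
lemma LetterBasis.exists_section : ∃ g : S.T.1 ⟶ freeCat κ D, oneF S.T ≫ g = freeOneC ∧
    mulF S.T ≫ g = (g ⊗ₘ g) ≫ freeMulC ∧ S.incl.f ≫ g = L.inclC := by
  let : MonObj (freeCat κ D) := freeMon
  exact (S.univ (freeCat κ D) L.inclC).exists

/-- A tensor algebra is spanned by the words: the endomorphism which factors through the words is
the identity by the universal property. -/
lemma LetterBasis.span_tword : Submodule.span ℂ (Set.range (L.tword S)) = ⊤ := by
  obtain ⟨g, h1, h2, h3⟩ := L.exists_section S
  let : MonObj S.T.1 := centerMon S.T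
  have hy : ∀ j, hact S.T.1 (app S.incl.f (L.basis j)) = D.a j • app S.incl.f (L.basis j) :=
    fun j => weight_map S.incl.f (L.weight j)
  have e : g ≫ freeLift hy = 𝟙 S.T.1 := by
    refine (S.univ S.T.1 S.incl.f).unique ⟨?_, ?_, ?_⟩ ⟨?_, ?_, ?_⟩
    · rw [← Category.assoc, h1, one_freeLift]
    · rw [← Category.assoc, h2, Category.assoc, mul_freeLift, ← Category.assoc,
        tensorHom_comp_tensorHom]
    · rw [← Category.assoc, h3]
      refine hom_ext_span L.basis.span_eq fun j => ?_
      rw [app_comp, L.app_inclC, app_freeLift]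
      exact app_mul_one _
    · exact Category.comp_id _
    · rw [Category.comp_id, id_tensorHom_id, Category.id_comp]; rfl
    · exact Category.comp_id _
  rw [eq_top_iff]
  intro v _
  have hv : app g v ∈ Submodule.span ℂ (Set.range (word κ D)) := span_word D ▸ Submodule.mem_top
  have := Submodule.mem_map_of_mem (f := app (freeLift hy)) hv
  rw [Submodule.map_span, ← Set.range_comp] at this
  have e' : app (freeLift hy) (app g v) = v := congrArg (fun k => app k v) e
  rw [e'] at this
  convert this using 3
  funext w
  exact (app_freeLift hy w).symm

lemma TMod.app_one_act {T : Center (Cat κ)} [BimonObj T] (M : TMod T) (v : Vec M.X) :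
    app M.act (tm (app (oneF T) one') v) = v := by
  have := congrArg (fun k => app k (tm one' v)) M.one_act
  simpa only [app_comp, app_whiskerRight, app_leftUnitor_one] using this

lemma TMod.app_mul_act {T : Center (Cat κ)} [BimonObj T] (M : TMod T) (t t' : Vec T.1)
    (v : Vec M.X) : app M.act (tm (app (mulF T) (tm t t')) v) =
      app M.act (tm t (app M.act (tm t' v))) := by
  have := congrArg (fun k => app k (tm (tm t t') v)) M.mul_act
  simpa only [app_comp, app_whiskerRight, app_assoc, app_whiskerLeft] using this

include L in
/-- A morphism between modules is a morphism of modules as soon as it commutes with the action of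
`F`. -/
lemma LetterBasis.comm_of_restrict (M N : TMod S.T) (f : M.X ⟶ N.X)
    (h : (S.incl.f ▷ M.X ≫ M.act) ≫ f = F.1 ◁ f ≫ S.incl.f ▷ N.X ≫ N.act) :
    M.act ≫ f = S.T.1 ◁ f ≫ N.act := by
  have hF : ∀ j v, app f (app M.act (tm (app S.incl.f (L.basis j)) v)) =
      app N.act (tm (app S.incl.f (L.basis j)) (app f v)) := fun j v => by
    have := congrArg (fun k => app k (tm (L.basis j) v)) h
    simpa only [app_comp, app_whiskerRight, app_whiskerLeft] using this
  refine hom_ext_span_left (L.span_tword S) fun w v => ?_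
  rw [app_comp, app_comp, app_whiskerLeft]
  induction w generalizing v with
  | nil => exact (congrArg (app f) (M.app_one_act v)).trans (N.app_one_act _).symm
  | cons j w ih =>
    exact (congrArg (app f) (M.app_mul_act _ _ v)).trans ((hF j _).trans ((congrArg
      (fun u => app N.act (tm (app S.incl.f (L.basis j)) u)) (ih v)).trans
        (N.app_mul_act _ _ _).symm))

/-- The restriction of modules along `F ⟶ T(F)`. -/
def restrict : TMod S.T ⥤ Pert F where
  obj M := ⟨M.X, S.incl.f ▷ M.X ≫ M.act⟩
  map f := ⟨f.hom, by
    rw [Category.assoc, f.comm, ← whisker_exchange_assoc]⟩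

/-- The extension of `F ⊗ X ⟶ X` to an action of the tensor algebra. -/
def LetterBasis.extAct {X : Cat κ} (m : F.1 ⊗ X ⟶ X) : S.T.1 ⊗ X ⟶ X :=
  (L.exists_section S).choose ▷ X ≫ L.freeAct m

lemma LetterBasis.incl_extAct {X : Cat κ} (m : F.1 ⊗ X ⟶ X) :
    S.incl.f ▷ X ≫ L.extAct S m = m := by
  rw [LetterBasis.extAct, ← comp_whiskerRight_assoc, (L.exists_section S).choose_spec.2.2,
    L.incl_freeAct]

/-- The module which is determined by an object of `C_F`. -/
def LetterBasis.extObj (M : Pert F) : TMod S.T where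
  X := M.X
  act := L.extAct S M.m
  one_act := by
    rw [LetterBasis.extAct, ← comp_whiskerRight_assoc, (L.exists_section S).choose_spec.1,
      L.one_freeAct]
  mul_act := by
    rw [LetterBasis.extAct, ← comp_whiskerRight_assoc, (L.exists_section S).choose_spec.2.1,
      comp_whiskerRight, Category.assoc, L.mul_freeAct, MonoidalCategory.tensorHom_def]
    generalize (L.exists_section S).choose = g
    rw [MonoidalCategory.whiskerLeft_comp, Category.assoc,
      whisker_exchange_assoc g (L.freeAct M.m), whisker_exchange_assoc g (g ▷ M.X)]
    simp

/-- The extension of morphisms `F ⊗ X ⟶ X` to modules, as a functor. -/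
def LetterBasis.ext : Pert F ⥤ TMod S.T where
  obj := L.extObj S
  map {M N} f := ⟨f.hom, L.comm_of_restrict S (L.extObj S M) (L.extObj S N) f.hom (by
    change (S.incl.f ▷ M.X ≫ L.extAct S M.m) ≫ f.hom =
      F.1 ◁ f.hom ≫ S.incl.f ▷ N.X ≫ L.extAct S N.m
    rw [L.incl_extAct, L.incl_extAct, f.comm])⟩

/-- Equality of modules, as opposed to isomorphism, is needed for isomorphisms of categories. -/
lemma TMod.ext_act {T : Center (Cat κ)} [BimonObj T] {M N : TMod T} (hX : M.X = N.X)
    (h : M.act ≫ eqToHom hX = T.1 ◁ eqToHom hX ≫ N.act) : M = N := by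
  obtain ⟨X, m, _, _⟩ := M
  obtain ⟨Y, n, _, _⟩ := N
  obtain rfl : X = Y := hX
  have h' : m = n := by simpa using h
  subst h'
  rfl

lemma Pert.ext_m {M N : Pert F} (hX : M.X = N.X)
    (h : M.m ≫ eqToHom hX = F.1 ◁ eqToHom hX ≫ N.m) : M = N := by
  obtain ⟨X, m⟩ := M
  obtain ⟨Y, n⟩ := N
  obtain rfl : X = Y := hX
  have h' : m = n := by simpa using h
  subst h'
  rfl

lemma TMod.eqToHom_hom {T : Center (Cat κ)} [BimonObj T] {M N : TMod T} (h : M = N) :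
    (eqToHom h).hom = eqToHom (congrArg TMod.X h) := by
  subst h; rfl

lemma Pert.eqToHom_hom {M N : Pert F} (h : M = N) :
    (eqToHom h).hom = eqToHom (congrArg Pert.X h) := by
  subst h; rfl

/-- An action is determined by its restriction to `F`. -/
lemma LetterBasis.restrict_ext : restrict S ⋙ L.ext S = 𝟭 _ := by
  have hobj : ∀ M : TMod S.T, (restrict S ⋙ L.ext S).obj M = M := fun M =>
    TMod.ext_act rfl (L.comm_of_restrict S (L.extObj S ⟨M.X, S.incl.f ▷ M.X ≫ M.act⟩) M (𝟙 M.X)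
      (by
        change (S.incl.f ▷ M.X ≫ L.extAct S (S.incl.f ▷ M.X ≫ M.act)) ≫ 𝟙 M.X =
          F.1 ◁ 𝟙 M.X ≫ S.incl.f ▷ M.X ≫ M.act
        rw [L.incl_extAct]
        simp))
  -- Both functors keep the underlying morphisms, and `eqToHom` is the identity underneath.
  refine CategoryTheory.Functor.ext hobj fun M N f => TMod.hom_ext ?_
  rw [TMod.comp_hom, TMod.comp_hom, TMod.eqToHom_hom, TMod.eqToHom_hom]
  change f.hom = 𝟙 _ ≫ f.hom ≫ 𝟙 _
  rw [Category.comp_id, Category.id_comp]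

lemma LetterBasis.ext_restrict : L.ext S ⋙ restrict S = 𝟭 _ := by
  have hobj : ∀ M : Pert F, (L.ext S ⋙ restrict S).obj M = M := fun M =>
    Pert.ext_m rfl (by
      change (S.incl.f ▷ M.X ≫ L.extAct S M.m) ≫ 𝟙 M.X = F.1 ◁ 𝟙 M.X ≫ M.m
      rw [L.incl_extAct]
      simp)
  -- Both functors keep the underlying morphisms, and `eqToHom` is the identity underneath.
  refine CategoryTheory.Functor.ext hobj fun M N f => Pert.hom_ext ?_
  rw [Pert.comp_hom, Pert.comp_hom, Pert.eqToHom_hom, Pert.eqToHom_hom]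
  change f.hom = 𝟙 _ ≫ f.hom ≫ 𝟙 _
  rw [Category.comp_id, Category.id_comp]

lemma app_shuf {t s X Y : Cat κ} {b : s ⊗ X ⟶ X ⊗ s} {v : Vec s} {x x' : Vec X}
    (h : app b (tm v x) = tm x' v) (u : Vec t) (y : Vec Y) :
    app (shuf t b Y) (tm (tm u v) (tm x y)) = tm (tm u x') (tm v y) := by
  simp only [shuf, app_comp, app_assoc, app_assoc_inv, app_whiskerLeft, app_whiskerRight, h]

/-- The action of a homogeneous element of `F` on a tensor product: this is the shape of the
coproduct `x ⊗ 1 + e^{c h} ⊗ x`. -/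
lemma app_tp {X Y : Cat κ} {m : F.1 ⊗ X ⟶ X} {n : F.1 ⊗ Y ⟶ Y} {a c : ℂ} {e : Vec F.1}
    (he : Homog F a c e) (x : Vec X) (y : Vec Y) :
    app (Pert.tp F m n) (tm e (tm x y)) =
      tm (app m (tm e x)) y + tm (eact X c x) (app n (tm e y)) := by
  simp only [Pert.tp, app_comp, app_add, app_assoc_inv, app_whiskerRight, he.braid, app_assoc,
    app_whiskerLeft]

lemma hom_ext_span_tm {J : Type} {X Y Z W : Cat κ} {s : J → Vec X}
    (hs : Submodule.span ℂ (Set.range s) = ⊤) {f g : X ⊗ (Y ⊗ Z) ⟶ W}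
    (h : ∀ j y z, app f (tm (s j) (tm y z)) = app g (tm (s j) (tm y z))) : f = g :=
  hom_ext_span_left hs fun j w => by
    induction w using tm_induction with
    | zero => simp only [tm_zero, map_zero]
    | add x y hx hy => simp only [tm_add, map_add, hx, hy]
    | tmul y z => exact h j y z

include L in
/-- The restriction of the tensor product of modules is the tensor product of the restrictions, as
the elements of `F` are primitive. -/
lemma LetterBasis.incl_tact (M N : TMod S.T) : S.incl.f ▷ (M.X ⊗ N.X) ≫ TMod.tact S.T M.act N.act =
    Pert.tp F (S.incl.f ▷ M.X ≫ M.act) (S.incl.f ▷ N.X ≫ N.act) := by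
  refine hom_ext_span_tm L.basis.span_eq fun j x y => ?_
  have e : S.incl.f ≫ comulF S.T =
      (ρ_ F.1).inv ≫ (S.incl.f ⊗ₘ oneF S.T) + (λ_ F.1).inv ≫ (oneF S.T ⊗ₘ S.incl.f) := by
    have e1 : ((ρ_ F).inv ≫ (S.incl ⊗ₘ η[S.T])).f = (ρ_ F.1).inv ≫ (S.incl.f ⊗ₘ oneF S.T) := by
      rw [Center.comp_f, Center.tensor_f, Center.rightUnitor_inv_f]
      rfl
    have e2 : ((λ_ F).inv ≫ (η[S.T] ⊗ₘ S.incl)).f = (λ_ F.1).inv ≫ (oneF S.T ⊗ₘ S.incl.f) := by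
      rw [Center.comp_f, Center.tensor_f, Center.leftUnitor_inv_f]
      rfl
    exact (congrArg Center.Hom.f S.incl_comul).trans (congrArg₂ (· + ·) e1 e2)
  have e' := congrArg (fun k => app k (L.basis j)) e
  simp only [app_comp, app_add, app_rightUnitor_inv, app_leftUnitor_inv, app_tensor] at e'
  have h1 : app (hb S.T M.X) (tm (app (oneF S.T) one') x) =
      tm (eact M.X 0 x) (app (oneF S.T) one') :=
    ((Homog.one (κ := κ)).map η[S.T]).braid M.X x
  have h2 := ((L.homog j).map S.incl).braid M.X x
  rw [app_tp (L.homog j)]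
  simp only [TMod.tact, app_comp, app_whiskerRight, e', add_tm, map_add, app_shuf h1, app_shuf h2,
    app_tensor, TMod.app_one_act, eact_zero]

lemma incl_uact : S.incl.f ▷ 𝟙_ (Cat κ) ≫ TMod.uact S.T = 0 := by
  have h : S.incl.f ≫ counitF S.T = 0 := congrArg Center.Hom.f S.incl_counit
  rw [TMod.uact_eq, ← comp_whiskerRight_assoc, h, MonoidalPreadditive.zero_whiskerRight,
    Limits.zero_comp]

include L in
/-- The restriction is monoidal; its structure morphisms are the identities of the underlying
objects. -/
lemma LetterBasis.nonempty_restrict_monoidal : Nonempty (restrict S).Monoidal :=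
  ⟨Functor.CoreMonoidal.toMonoidal
    { εIso := Pert.mkIso (M := Pert.unit F) (N := (restrict S).obj (TMod.unit S.T))
        (Iso.refl (𝟙_ (Cat κ))) (by
          change (0 : F.1 ⊗ 𝟙_ (Cat κ) ⟶ 𝟙_ (Cat κ)) ≫ 𝟙 _ =
            F.1 ◁ 𝟙 _ ≫ S.incl.f ▷ 𝟙_ (Cat κ) ≫ TMod.uact S.T
          rw [incl_uact]
          simp)
      μIso := fun M N => Pert.mkIso (M := Pert.tensor ((restrict S).obj M) ((restrict S).obj N))
        (N := (restrict S).obj (TMod.tensor M N)) (Iso.refl (M.X ⊗ N.X)) (by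
          change Pert.tp F (S.incl.f ▷ M.X ≫ M.act) (S.incl.f ▷ N.X ≫ N.act) ≫ 𝟙 (M.X ⊗ N.X) =
            F.1 ◁ 𝟙 (M.X ⊗ N.X) ≫ S.incl.f ▷ (M.X ⊗ N.X) ≫ TMod.tact S.T M.act N.act
          rw [L.incl_tact]
          simp)
      μIso_hom_natural_left := fun {M N} f P => Pert.hom_ext (by
        change (f.hom ⊗ₘ 𝟙 P.X) ≫ 𝟙 (N.X ⊗ P.X) = 𝟙 (M.X ⊗ P.X) ≫ (f.hom ⊗ₘ 𝟙 P.X)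
        simp)
      μIso_hom_natural_right := fun {M N} P f => Pert.hom_ext (by
        change (𝟙 P.X ⊗ₘ f.hom) ≫ 𝟙 (P.X ⊗ N.X) = 𝟙 (P.X ⊗ M.X) ≫ (𝟙 P.X ⊗ₘ f.hom)
        simp)
      associativity := fun M N P => Pert.hom_ext (by
        change (𝟙 (M.X ⊗ N.X) ⊗ₘ 𝟙 P.X) ≫ 𝟙 ((M.X ⊗ N.X) ⊗ P.X) ≫ (α_ M.X N.X P.X).hom =
          (α_ M.X N.X P.X).hom ≫ (𝟙 M.X ⊗ₘ 𝟙 (N.X ⊗ P.X)) ≫ 𝟙 (M.X ⊗ N.X ⊗ P.X)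
        simp)
      left_unitality := fun M => Pert.hom_ext (by
        change (λ_ M.X).hom = (𝟙 (𝟙_ (Cat κ)) ⊗ₘ 𝟙 M.X) ≫ 𝟙 (𝟙_ (Cat κ) ⊗ M.X) ≫ (λ_ M.X).hom
        simp)
      right_unitality := fun M => Pert.hom_ext (by
        change (ρ_ M.X).hom = (𝟙 M.X ⊗ₘ 𝟙 (𝟙_ (Cat κ))) ≫ 𝟙 (M.X ⊗ 𝟙_ (Cat κ)) ≫ (ρ_ M.X).hom
        simp) }⟩

include L in
lemma LetterBasis.monoidallyIsomorphic_restrict : MonoidallyIsomorphic (TMod S.T) (Pert F) :=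
  ⟨restrict S, L.ext S, L.restrict_ext S, L.ext_restrict S, L.nonempty_restrict_monoidal S⟩

end Modules

/-! ### Representations of the algebra with generators `h` and `x` -/

section Representations
variable {κ : ℂ} {D : Datum} {F : Center (Cat κ)} (L : LetterBasis F D)

/-- Representations on the same vector space are equal when the identity intertwines them. -/
lemma Rep.eq_of_hom {D : Datum} {X Y : Rep D} (f : X ⟶ Y) (hV : X.V = Y.V)
    (hf : f.hom = eqToHom hV) : X = Y := by
  obtain ⟨V, ρ, _, _⟩ := X
  obtain ⟨W, σ, _, _⟩ := Y
  obtain rfl : V = W := hV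
  have h : ρ = σ := AlgHom.ext fun a => LinearMap.ext fun v => by
    have := f.comm a v
    rw [hf] at this
    exact this
  subst h
  rfl

lemma Rep.eqToHom_hom {D : Datum} {X Y : Rep D} (h : X = Y) :
    (eqToHom h).hom = eqToHom (congrArg Rep.V h) := by
  subst h; rfl

/-- The representation which is determined by an object of `C_F`. -/
def LetterBasis.repObj (M : Pert F) : Rep D :=
  Rep.ofGen D (Rep.V M.X) (hact M.X) (L.op M.m) (L.hact_op M.m) (Rep.span M.X)

lemma LetterBasis.repObj_h (M : Pert F) : (L.repObj M).ρ (Bialg.h D) = hact M.X :=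
  genAct_h D (Rep.V M.X) (hact M.X) (L.op M.m) (L.hact_op M.m) (Rep.span M.X)

lemma LetterBasis.repObj_x (M : Pert F) (j : D.X) :
    (L.repObj M).ρ (Bialg.x D j) = L.op M.m j :=
  genAct_x D (Rep.V M.X) (hact M.X) (L.op M.m) (L.hact_op M.m) (Rep.span M.X) j

/-- The functor which sends a morphism `F ⊗ X ⟶ X` to the representation in which the generators act
through the basis of `F`. -/
def LetterBasis.rep : Pert F ⥤ Rep D where
  obj := L.repObj
  map {M N} f := Rep.mkHom (X := L.repObj M) (Y := L.repObj N) (ModuleCat.ofHom (app f.hom))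
    (by
      rw [L.repObj_h, L.repObj_h]
      exact LinearMap.ext fun v => app_hact f.hom v)
    (fun j => by
      rw [L.repObj_x, L.repObj_x]
      exact LinearMap.ext fun v => congrArg (fun k => app k (tm (L.basis j) v)) f.comm)

/-- The restriction of a representation to `A`. -/
def resCat (κ : ℂ) (V : Rep D) : Cat κ :=
  Rep.ofSpan (D := Datum.empty) V.V (V.ρ.comp (inclA D)) (V.cont.comp (inclA_cont D)) (by
    rw [AlgHom.comp_apply, inclA_h]; exact V.span)

lemma hact_resCat (V : Rep D) : hact (resCat κ V) = V.ρ (Bialg.h D) :=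
  congrArg V.ρ (inclA_h (D := D))

/-- The action of a generator on a representation. -/
def xact (κ : ℂ) (V : Rep D) (j : D.X) : Module.End ℂ (Vec (resCat κ V)) := V.ρ (Bialg.x D j)

lemma hact_xact (V : Rep D) (j : D.X) (v : Vec (resCat κ V)) : hact (resCat κ V) (xact κ V j v) =
    xact κ V j (hact (resCat κ V) v) + D.a j • xact κ V j v := by
  have h := congrArg V.ρ (Bialg.rel D j)
  rw [map_mul, map_add, map_mul, map_smul] at h
  rw [hact_resCat]
  exact LinearMap.congr_fun h v

/-- The morphism `F ⊗ V ⟶ V` which is given by the action of the generators. -/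
def LetterBasis.perturb (V : Rep D) : F.1 ⊗ resCat κ V ⟶ resCat κ V :=
  mkTm (L.basis.constr ℂ (xact κ V)) <| derivation_of_span_left L.basis.span_eq _ fun j v => by
    rw [L.weight, map_smul, L.basis.constr_basis, hact_xact, LinearMap.smul_apply, add_comm]

lemma LetterBasis.op_perturb (V : Rep D) (j : D.X) : L.op (L.perturb V) j = xact κ V j :=
  LinearMap.ext fun v => by
    rw [L.op_apply, LetterBasis.perturb, app_mkTm, L.basis.constr_basis]

/-- The functor which records the action of the generators. -/
def LetterBasis.unrep : Rep D ⥤ Pert F where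
  obj V := ⟨resCat κ V, L.perturb V⟩
  map {V W} f := ⟨(⟨f.hom, fun a v => f.comm (inclA D a) v⟩ :
      Rep.Hom (resCat κ V) (resCat κ W)), by
    refine hom_ext_span_left L.basis.span_eq fun j v => ?_
    have hV : app (L.perturb V) (tm (L.basis j) v) = xact κ V j v :=
      LinearMap.congr_fun (L.op_perturb V j) v
    have hW : ∀ w, app (L.perturb W) (tm (L.basis j) w) = xact κ W j w :=
      LinearMap.congr_fun (L.op_perturb W j)
    exact (congrArg f.hom.hom hV).trans ((f.comm (Bialg.x D j) v).trans (hW _).symm)⟩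

lemma Pert.eq_of_hom {M N : Pert F} (f : M ⟶ N) (hV : Rep.V M.X = Rep.V N.X)
    (hf : Rep.Hom.hom f.hom = eqToHom hV) : M = N := by
  have hX : M.X = N.X := Rep.eq_of_hom f.hom hV hf
  have e : f.hom = eqToHom hX := Rep.hom_ext (hf.trans (Rep.eqToHom_hom hX).symm)
  exact Pert.ext_m hX (e ▸ f.comm)

lemma LetterBasis.rep_unrep : L.rep ⋙ L.unrep = 𝟭 _ := by
  have hobj : ∀ M : Pert F, (L.rep ⋙ L.unrep).obj M = M := fun M => by
    refine Pert.eq_of_hom ⟨mkC (X := resCat κ (L.repObj M)) (Y := M.X) LinearMap.id fun v =>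
      LinearMap.congr_fun ((hact_resCat (κ := κ) (L.repObj M)).trans (L.repObj_h M)) v, ?_⟩ rfl rfl
    refine hom_ext_span_left L.basis.span_eq fun j v => ?_
    have h1 : app (L.perturb (L.repObj M)) (tm (L.basis j) v) = xact κ (L.repObj M) j v :=
      LinearMap.congr_fun (L.op_perturb (L.repObj M) j) v
    exact h1.trans (LinearMap.congr_fun (L.repObj_x M j) v)
  refine CategoryTheory.Functor.ext hobj fun M N f => Pert.hom_ext (Rep.hom_ext ?_)
  rw [Pert.comp_hom, Pert.comp_hom, Pert.eqToHom_hom, Pert.eqToHom_hom]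
  refine Eq.trans ?_ (congrArg₂ (fun a b => a ≫ Rep.Hom.hom f.hom ≫ b) (Rep.eqToHom_hom _)
    (Rep.eqToHom_hom _)).symm
  exact (Category.id_comp _).symm

/-- A representation is determined by the action of the generators, by continuity. -/
lemma LetterBasis.unrep_rep : L.unrep ⋙ L.rep = 𝟭 _ := by
  have hobj : ∀ V : Rep D, (L.unrep ⋙ L.rep).obj V = V := fun V => by
    refine Rep.eq_of_hom (Rep.mkHom (X := L.repObj (L.unrep.obj V)) (Y := V) (𝟙 V.V) ?_ ?_) rfl rfl
    · rw [L.repObj_h]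
      exact hact_resCat (κ := κ) V
    · intro j
      rw [L.repObj_x]
      exact L.op_perturb V j
  refine CategoryTheory.Functor.ext hobj fun V W f => Rep.hom_ext ?_
  rw [Rep.comp_hom, Rep.comp_hom, Rep.eqToHom_hom, Rep.eqToHom_hom]
  exact (Category.id_comp _).symm

/-- The unit object is preserved. -/
def LetterBasis.repUnit : Rep.unit D ≅ L.repObj (Pert.unit F) :=
  Rep.mkIso (X := Rep.unit D) (Y := L.repObj (Pert.unit F)) (Iso.refl (ModuleCat.of ℂ ℂ))
    (Rep.mkHom (X := Rep.unit D) (Y := L.repObj (Pert.unit F)) (𝟙 (ModuleCat.of ℂ ℂ))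
      (by
        rw [L.repObj_h]
        exact LinearMap.ext fun v => (Rep.unitRep_h (D := D) v).trans
          (Rep.unitRep_h (D := Datum.empty) v).symm)
      (fun j => by
        rw [L.repObj_x]
        exact LinearMap.ext fun v => Rep.unitRep_x (D := D) j v))
    rfl

lemma LetterBasis.op_tp {X Y : Cat κ} (m : F.1 ⊗ X ⟶ X) (n : F.1 ⊗ Y ⟶ Y) (j : D.X) {v : Vec X}
    {l : ℂ} (hv : hact X v = l • v) (w : Vec Y) : L.op (Pert.tp F m n) j (tm v w) =
      tm (L.op m j v) w + Complex.exp (D.c j * l) • tm v (L.op n j w) := by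
  rw [L.op_apply, app_tp (L.homog j), eact_eig (D.c j) hv, smul_tm]
  rfl

/-- The tensor product is preserved: both sides are `x v ⊗ w + e^{c_x h} v ⊗ x w`. -/
def LetterBasis.repTensor (M N : Pert F) :
    Rep.tensor (L.repObj M) (L.repObj N) ≅ L.repObj (Pert.tensor M N) :=
  Rep.mkIso (X := Rep.tensor (L.repObj M) (L.repObj N)) (Y := L.repObj (Pert.tensor M N))
    (Iso.refl (Rep.V M.X ⊗ Rep.V N.X))
    (Rep.mkHom (X := Rep.tensor (L.repObj M) (L.repObj N)) (Y := L.repObj (Pert.tensor M N))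
      (𝟙 (Rep.V M.X ⊗ Rep.V N.X))
      (tensor_ext (L.repObj M).span (L.repObj N).span fun v w l m hv hw => by
        have h1 := Rep.tensor_h (L.repObj M) (L.repObj N) hv hw
        rw [L.repObj_h] at hv hw ⊢
        exact h1.trans (hact_tm_eig (X := M.X) (Y := N.X) hv hw).symm)
      (fun j => tensor_ext (L.repObj M).span (L.repObj N).span fun v w l m hv hw => by
        have h1 := Rep.tensor_x (L.repObj M) (L.repObj N) j hv w
        rw [L.repObj_h] at hv
        rw [L.repObj_x, L.repObj_x] at h1
        rw [L.repObj_x]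
        exact h1.trans (L.op_tp M.m N.m j hv w).symm))
    rfl

/-- The structure morphisms are the identities of the underlying vector spaces. -/
lemma LetterBasis.nonempty_rep_monoidal : Nonempty L.rep.Monoidal :=
  ⟨Functor.CoreMonoidal.toMonoidal
    { εIso := L.repUnit
      μIso := L.repTensor
      μIso_hom_natural_left := fun {M N} f P => Rep.hom_ext rfl
      μIso_hom_natural_right := fun {M N} P f => Rep.hom_ext rfl
      associativity := fun M N P => Rep.hom_ext (by
        change (𝟙 (Rep.V M.X ⊗ Rep.V N.X) ⊗ₘ 𝟙 (Rep.V P.X)) ≫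
            𝟙 ((Rep.V M.X ⊗ Rep.V N.X) ⊗ Rep.V P.X) ≫
            (α_ (Rep.V M.X) (Rep.V N.X) (Rep.V P.X)).hom =
          (α_ (Rep.V M.X) (Rep.V N.X) (Rep.V P.X)).hom ≫
            (𝟙 (Rep.V M.X) ⊗ₘ 𝟙 (Rep.V N.X ⊗ Rep.V P.X)) ≫ 𝟙 (Rep.V M.X ⊗ Rep.V N.X ⊗ Rep.V P.X)
        simp)
      left_unitality := fun M => Rep.hom_ext (by
        change (λ_ (Rep.V M.X)).hom = (𝟙 (ModuleCat.of ℂ ℂ) ⊗ₘ 𝟙 (Rep.V M.X)) ≫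
          𝟙 (ModuleCat.of ℂ ℂ ⊗ Rep.V M.X) ≫ (λ_ (Rep.V M.X)).hom
        simp)
      right_unitality := fun M => Rep.hom_ext (by
        change (ρ_ (Rep.V M.X)).hom = (𝟙 (Rep.V M.X) ⊗ₘ 𝟙 (ModuleCat.of ℂ ℂ)) ≫
          𝟙 (Rep.V M.X ⊗ ModuleCat.of ℂ ℂ) ≫ (ρ_ (Rep.V M.X)).hom
        simp) }⟩

include L in
lemma LetterBasis.monoidallyIsomorphic_rep : MonoidallyIsomorphic (Pert F) (Rep D) :=
  ⟨L.rep, L.unrep, L.rep_unrep, L.unrep_rep, L.nonempty_rep_monoidal⟩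

end Representations

end FreeBoson

end

theorem mainTheorem5 (κ ω : ℂ) (hω : ω ≠ 0) :
    Nonempty (FreeBoson.TensorAlg (FreeBoson.bosonF κ ω)) ∧
      ∀ T : FreeBoson.TensorAlg (FreeBoson.bosonF κ ω),
        FreeBoson.MonoidallyIsomorphic (FreeBoson.TMod T.T)
            (FreeBoson.Pert (FreeBoson.bosonF κ ω)) ∧
          FreeBoson.MonoidallyIsomorphic (FreeBoson.Pert (FreeBoson.bosonF κ ω))
            (FreeBoson.RepAF κ ω) :=
  let L := FreeBoson.bosonLetters κ ω
  ⟨L.nonempty_tensorAlg, fun T => ⟨L.monoidallyIsomorphic_restrict T, L.monoidallyIsomorphic_rep⟩⟩
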